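/- **Conventions.** All structures are finite relational structures $\mathcal H=(H,R_1,\dots,R_k,\preceq)$ with relations of positive arity and a total preorder $\preceq$, whose equivalence classes are the *color classes*. For a color class $C$, $\mathrm{Aut}(C)$ denotes the automorphism group of the induced substructure $\mathcal H[C]$. A relation is *homogeneous* if all its tuples lie in $C^m$ for one color class $C$, and *heterogeneous* otherwise; $\mathcal H$ has *arity at most $r$* if all its heterogeneous relations do. $\mathcal H$ is *$q$-bounded* if color classes have at most $q$ elements and homogeneous relations have arity at most $q$. $\mathcal H$ is *dihedral* if every $\mathrm{Aut}(C)$ is cyclic or a dihedral group $D_n$ of order $2n$, $n\ge1$. It is *odd dihedral* if moreover every non-abelian $\mathrm{Aut}(C)$ is isomorphic to $D_k$ with $k$ odd. It is a *graph* if it has exactly one relation besides $\preceq$ and this relation is binary (directed or undirected). $\mathcal H$ is *transitive on 3 color classes* if for every set $I$ of at most three color classes, the automorphism group of $\mathcal H[\bigcup I]$ is transitive on each $C\in I$. A *type* is the tuple $(C_1,\dots,C_\ell)$, $\ell\ge2$, of pairwise distinct color classes containing the entries of some tuple of a relation. **Normal-form reduction.** It applies the following steps to $\mathcal H$, in the order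 (1), (2), (3), (1), (2), (4). (1) *Transitivity.* Refine the color classes according to the orbits of the automorphism groups of the substructures induced by at most three color classes. For every new class $D$ properly contained in an old class $C$, add as relations on $D$ the orbits, on pairs and on $|D|$-tuples over $D$, of the setwise stabilizer of $D$ in $\mathrm{Aut}(C)$. Repeat until the structure is transitive on 3 color classes. (2) *Typed relations.* Replace each color class by three copies, joined consecutively by perfect matchings and each carrying the restrictions to the class of all relations. Split each relation of arity at most $3$ according to the color classes of the entries of its tuples, placing the $i$-th entry in the $i$-th copy. (3) *Regularity.* Replace each color class $C$ by an orbit $O_C$ of $\mathrm{Aut}(C)$ on tuples over $C$ on which $\mathrm{Aut}(C)$ acts regularly and faithfully. Add the orbits of this action on pairs and on $|O_C|$-tuples over $O_C$, and the relation identifying tuples with the same first entry. In the old relations, replace a vertex by all tuples with this first entry. (4) *2-injectivity.* For each pair of color classes $C_1\prec C_2$ occurring in a binary relation, add a copy $C_2'$ of $C_2$ (with the relations inside $C_2$), replace the pairs $(u,v)\in C_1\times C_2$ of each such relation by the triples $(u,v,v')$, and add the relation of all triples $(u,v,v')$ with $u\in C_1$, $v\in C_2$, where $v'$ is the copy of $v$.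 Then, for each type $T=(C_1,C_2,C_3)$, ordered by $\prec$ after reordering positions, let $\Gamma_T\le\prod_i\mathrm{Aut}(C_i)$ be the automorphism group of the structure given by the relations inside the $C_i$ and the relations of type $T$. Let $N_i^T$ be the kernel of the projection of $\Gamma_T$ to the two factors other than the $i$-th. Add a new color class $Q_i^T$ consisting of the $N_i^T$-orbits on $C_i$. Add on $Q_i^T$ the orbits, on pairs and on $|Q_i^T|$-tuples, of the group induced by $\mathrm{Aut}(C_i)$, and add the orbit map $C_i\to Q_i^T$. Replace each tuple of type $T$ by the triple of the orbits of its entries. The color classes $Q_i^T$ are the *group color classes*, the others are the *extension color classes*. Orders of new color classes, and the regular orbits in (3), may be chosen arbitrarily. **2-injective quotient structures.** A structure whose color classes are divided into group and extension color classes is a *2-injective quotient structure* if the following hold. It has arity at most $3$; every relation is homogeneous or has all tuples of one type; and all $\mathrm{Aut}(C)$ are regular permutation groups. Every group color class $D$ is, for some normal subgroup $N$ of $\mathrm{Aut}(C)$, an $N$-quotient of an extension color class $C$ (that is, $\mathrm{Aut}(D)\cong\mathrm{Aut}(C)/N$ and one relation is the graph of a map from $C$ onto $D$ whose fibers are the $N$-orbits),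 and no other relation joins $D$ to extension color classes. Heterogeneous relations between group color classes only are ternary, and each group color class occurs in only one *group type* (type consisting of group color classes). For every group type $T=(C_1,C_2,C_3)$, the group $\mathrm{Aut}(\mathcal H[C_1\cup C_2\cup C_3])$ projects onto each $\mathrm{Aut}(C_i)$, and each of its projections to two factors is injective. **Double CFI group.** Let $\Gamma_{\mathrm{CFI}}=\{(g_1,g_2,g_3)\in D_1^3: g_1g_2g_3=1\}$ and $\Gamma_{\mathrm{2CFI}}=\Gamma_{\mathrm{CFI}}\wr C_2$, which is realized in $D_4^3$ as $\langle(1,\alpha,\alpha),(\alpha,1,\alpha),(\rho,\rho,\beta)\rangle$, where $\rho$ is a rotation of order $4$ and $\alpha,\beta$ are non-conjugate reflections. A 2-injective quotient structure with dihedral colors is *double-CFI-free* if for no group type $T$ the automorphism group of the substructure induced by the color classes of $T$ is isomorphic to $\Gamma_{\mathrm{2CFI}}$ or to $\Gamma_{\mathrm{2CFI}}\cap(C_4\times D_4\times D_4)$, where $C_4=\langle\rho\rangle$. **Statement.** Let $\mathcal H$ be a dihedral $q$-bounded structure of arity at most $3$ that is odd dihedral or a graph. Then the normal-form reduction applied to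 $\mathcal H$ has an output, and every output $\mathcal H'$ (for all choices made) is a 2-injective quotient structure with dihedral colors and is double-CFI-free. -/

import Mathlib

universe u

namespace NormalForm

theorem perm_apply_inv {X : Type u} (σ : Equiv.Perm X) (x : X) : σ (σ⁻¹ x) = x :=
  Equiv.apply_symm_apply σ x

theorem perm_inv_apply {X : Type u} (σ : Equiv.Perm X) (x : X) : σ⁻¹ (σ x) = x :=
  Equiv.symm_apply_apply σ x

/-! ### Total preorders and relational structures -/

/-- A total preorder on `V`. -/
structure TotalPreorder (V : Type u) where
  le : V → V → Prop
  total : ∀ v w, le v w ∨ le w v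
  trans : ∀ v w x, le v w → le w x → le v x

namespace TotalPreorder

/-- `v` and `w` are equivalent, that is, they lie in the same color class. -/
def Eqv {V : Type u} (P : TotalPreorder V) (v w : V) : Prop := P.le v w ∧ P.le w v

theorem eqv_refl {V : Type u} (P : TotalPreorder V) (v : V) : P.Eqv v v :=
  ⟨(P.total v v).elim id id, (P.total v v).elim id id⟩

/-- The total preorder induced on a subset. -/
def induce {V : Type u} (P : TotalPreorder V) (I : Set V) : TotalPreorder I where
  le v w := P.le v w
  total v w := P.total v w
  trans v w x := P.trans v w x

end TotalPreorder

/-- A relational structure with universe `V`: a family of relations of positive arities together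
with a total preorder on `V`. -/
structure RelStr (V : Type u) where
  Sym : Type u
  arity : Sym → ℕ
  arity_pos : ∀ R, 0 < arity R
  rel : (R : Sym) → Set (Fin (arity R) → V)
  ord : TotalPreorder V

namespace RelStr

variable {V : Type u}

/-- The automorphism group of a structure. -/
def autGroup (H : RelStr V) : Subgroup (Equiv.Perm V) where
  carrier := {σ | (∀ R (t : Fin (H.arity R) → V), (fun k => σ (t k)) ∈ H.rel R ↔ t ∈ H.rel R) ∧
    ∀ v w, H.ord.le (σ v) (σ w) ↔ H.ord.le v w}
  mul_mem' := by
    rintro σ τ ⟨h1, h2⟩ ⟨h3, h4⟩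
    refine ⟨fun R t => ?_, fun v w => ?_⟩
    · exact (h1 R (fun k => τ (t k))).trans (h3 R t)
    · exact (h2 (τ v) (τ w)).trans (h4 v w)
  one_mem' := ⟨fun _ _ => Iff.rfl, fun _ _ => Iff.rfl⟩
  inv_mem' := by
    rintro σ ⟨h1, h2⟩
    refine ⟨fun R t => ?_, fun v w => ?_⟩
    · have h := h1 R (fun k => σ⁻¹ (t k))
      simp only [perm_apply_inv] at h
      exact h.symm
    · have h := h2 (σ⁻¹ v) (σ⁻¹ w)
      simp only [perm_apply_inv] at h
      exact h.symm

/-- The substructure induced by a set `I` of vertices. -/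
def induce (H : RelStr V) (I : Set V) : RelStr I where
  Sym := H.Sym
  arity := H.arity
  arity_pos := H.arity_pos
  rel R := {t | (fun k => (t k : V)) ∈ H.rel R}
  ord := H.ord.induce I

/-- The color class of a vertex. -/
def cls (H : RelStr V) (v : V) : Set V := {w | H.ord.Eqv v w}

/-- The color classes of a structure. -/
abbrev ColorClass (H : RelStr V) : Type u := {C : Set V // ∃ v, C = H.cls v}

/-- The automorphism group of the substructure induced by a color class. -/
def colorAut (H : RelStr V) (C : H.ColorClass) : Subgroup (Equiv.Perm C.1) :=
  (H.induce C.1).autGroup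

/-- The union of a set of color classes. -/
def unionOf (H : RelStr V) (I : Set H.ColorClass) : Set V := {v | ∃ C ∈ I, v ∈ C.1}

/-- A relation is homogeneous if it only contains tuples over one fixed color class. -/
def Homogeneous (H : RelStr V) (R : H.Sym) : Prop :=
  ∀ t ∈ H.rel R, ∀ t' ∈ H.rel R, ∀ k k', H.ord.Eqv (t k) (t' k')

/-- All heterogeneous relations have arity at most `r`. -/
def ArityAtMost (H : RelStr V) (r : ℕ) : Prop := ∀ R, ¬ H.Homogeneous R → H.arity R ≤ r

/-- `q`-bounded structures. -/
def IsBounded (H : RelStr V) (q : ℕ) : Prop :=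
  (∀ C : H.ColorClass, C.1.encard ≤ q) ∧ ∀ R, H.Homogeneous R → H.arity R ≤ q

/-- Dihedral colors: every color class induces a dihedral or cyclic automorphism group. -/
def HasDihedralColors (H : RelStr V) : Prop :=
  ∀ C : H.ColorClass, IsCyclic (H.colorAut C) ∨
    ∃ n : ℕ, 0 < n ∧ Nonempty (H.colorAut C ≃* DihedralGroup n)

/-- Odd dihedral structures. -/
def IsOddDihedral (H : RelStr V) : Prop :=
  H.HasDihedralColors ∧ ∀ C : H.ColorClass, (¬ ∀ a b : H.colorAut C, a * b = b * a) →
    ∃ k : ℕ, Odd k ∧ Nonempty (H.colorAut C ≃* DihedralGroup k)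

/-- (Colored) graphs: structures with exactly one relation symbol, which is binary. The edge
relation need not be symmetric or irreflexive, so this covers directed and undirected graphs. -/
def IsGraph (H : RelStr V) : Prop := ∃ E : H.Sym, (∀ R, R = E) ∧ H.arity E = 2

/-- Transitivity on `s` color classes: in the substructure induced by any at most `s` color classes,
the automorphism group acts transitively on each of these color classes. -/
def TransitiveOn (H : RelStr V) (s : ℕ) : Prop :=
  ∀ I : Set H.ColorClass, I.encard ≤ s → ∀ C ∈ I, ∀ v w : H.unionOf I, (v : V) ∈ C.1 →
    (w : V) ∈ C.1 → ∃ σ ∈ (H.induce (H.unionOf I)).autGroup, σ v = w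

end RelStr

/-- A permutation group is regular if it is transitive and has as many elements as its domain. -/
def IsRegularGroup {X : Type u} (G : Subgroup (Equiv.Perm X)) : Prop :=
  (∀ x y : X, ∃ g ∈ G, g x = y) ∧ Nat.card G = Nat.card X

/-- Names for the orbits of a permutation group `G` on the `n`-tuples over its domain `X`,
where `n` is `2` or the size of `X`. (The orbits on `|X|`-tuples determine `G`; for a regular
group already the orbits on pairs do.) -/
structure OrbitSym {X : Type u} (G : Subgroup (Equiv.Perm X)) : Type u where
  n : ℕ
  pos : 0 < n
  size : n = 2 ∨ n = Nat.card X
  orb : Set (Fin n → X)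
  isOrbit : ∃ t : Fin n → X, orb = {s | ∃ g ∈ G, s = fun k => g (t k)}

namespace RelStr

variable {V : Type u}

/-! ### Transitivity: refining the color classes by local orbits -/

/-- `v` and `w` have the same color and lie in the same orbit of the automorphism group of every
substructure induced by at most `s` color classes. -/
def SameOrbits (H : RelStr V) (s : ℕ) (v w : V) : Prop :=
  H.ord.Eqv v w ∧ ∀ I : Set H.ColorClass, I.encard ≤ s →
    ∀ (hv : v ∈ H.unionOf I) (hw : w ∈ H.unionOf I),
      ∃ σ ∈ (H.induce (H.unionOf I)).autGroup, σ ⟨v, hv⟩ = ⟨w, hw⟩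

/-- `P` refines the preorder of `H`, and its classes are the classes of `SameOrbits 3`. -/
def IsOrbitRefinement (H : RelStr V) (P : TotalPreorder V) : Prop :=
  (∀ v w, P.le v w → H.ord.le v w) ∧ ∀ v w, P.Eqv v w ↔ H.SameOrbits 3 v w

/-- The union of the color classes of `H` that meet `D`. -/
def saturation (H : RelStr V) (D : Set V) : Set V := {w | ∃ d ∈ D, H.ord.Eqv d w}

theorem subset_saturation (H : RelStr V) (D : Set V) : D ⊆ H.saturation D :=
  fun d hd => ⟨d, hd, H.ord.eqv_refl d⟩

/-- For a subset `D` of a color class `C`: the setwise stabilizer of `D` in the automorphism group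
of the substructure induced by `C`, restricted to `D`. -/
def restrictAut (H : RelStr V) (D : Set V) : Subgroup (Equiv.Perm D) where
  carrier := {τ | ∃ σ ∈ (H.induce (H.saturation D)).autGroup,
    ∀ d : D, (σ ⟨d, H.subset_saturation D d.2⟩ : V) = τ d}
  mul_mem' := by
    rintro τ τ' ⟨σ, hσ, h⟩ ⟨σ', hσ', h'⟩
    refine ⟨σ * σ', mul_mem hσ hσ', fun d => ?_⟩
    have e : σ' ⟨d, H.subset_saturation D d.2⟩ =
        ⟨(τ' d : V), H.subset_saturation D (τ' d).2⟩ := Subtype.ext (h' d)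
    rw [Equiv.Perm.mul_apply, e, h (τ' d), Equiv.Perm.mul_apply]
  one_mem' := ⟨1, one_mem _, fun _ => rfl⟩
  inv_mem' := by
    rintro τ ⟨σ, hσ, h⟩
    refine ⟨σ⁻¹, inv_mem hσ, fun d => ?_⟩
    have e : σ ⟨(τ⁻¹ d : V), H.subset_saturation D (τ⁻¹ d).2⟩ =
        ⟨(d : V), H.subset_saturation D d.2⟩ := by
      apply Subtype.ext
      rw [h (τ⁻¹ d), perm_apply_inv]
    rw [← e, perm_inv_apply]

/-- The classes of `P` that are not color classes of `H`. -/
abbrev SplitClass (H : RelStr V) (P : TotalPreorder V) : Type u :=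
  {D : Set V // (∃ v, D = {w | P.Eqv v w}) ∧ D ≠ H.saturation D}

/-- One refinement pass: the preorder is replaced by `P`, and every new class `D`, split off from a
color class `C`, gets new homogeneous relations, so that the automorphism group of the substructure
induced by `D` becomes the restriction to `D` of the automorphism group of that induced by `C`. -/
def refine (H : RelStr V) (P : TotalPreorder V) : RelStr V where
  Sym := H.Sym ⊕ Σ D : H.SplitClass P, OrbitSym (H.restrictAut D.1)
  arity := Sum.elim H.arity (fun x => x.2.n)
  arity_pos R := match R with
    | Sum.inl R => H.arity_pos R
    | Sum.inr x => x.2.pos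
  rel R := match R with
    | Sum.inl R => H.rel R
    | Sum.inr x => {t | ∃ s ∈ x.2.orb, t = fun k => (s k : V)}
  ord := P

/-- `H'` arises from `H` by one refinement pass (for some admissible order of the new classes). -/
def RefineStep (H H' : RelStr V) : Prop := ∃ P, H.IsOrbitRefinement P ∧ H' = H.refine P

/-- `H'` arises from `H` by repeating refinement passes until the structure is transitive on three
color classes. -/
def TransitiveRefinement (H H' : RelStr V) : Prop :=
  Relation.ReflTransGen RefineStep H H' ∧ H'.TransitiveOn 3

/-! ### Typed relations: one copy of every color class for every position in a tuple -/

/-- The relation symbols of the structure with typed relations: perfect matchings between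
consecutive copies of a color class, the relations inside the copies of a color class, and the
relations (of arity at most three) split by the color classes of the entries. -/
inductive TypedSym (H : RelStr V) : Type u
  | matching (C : H.ColorClass) (p : Fin 2)
  | inside (C : H.ColorClass) (p : Fin 3) (R : H.Sym)
  | split (R : H.Sym) (hR : H.arity R ≤ 3) (T : Fin (H.arity R) → H.ColorClass)

/-- The arities of the typed relations. -/
def typedArity (H : RelStr V) : H.TypedSym → ℕ
  | .matching _ _ => 2
  | .inside _ _ R => H.arity R
  | .split R _ _ => H.arity R

/-- The typed relations; `(v, p)` is the `p`-th copy of `v`. -/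
def typedRel (H : RelStr V) : (R : H.TypedSym) → Set (Fin (H.typedArity R) → V × Fin 3)
  | .matching C p => {x : Fin 2 → V × Fin 3 | ∃ v ∈ C.1, x = ![(v, p.castSucc), (v, p.succ)]}
  | .inside C p R => {x : Fin (H.arity R) → V × Fin 3 |
      ∃ t ∈ H.rel R, (∀ k, t k ∈ C.1) ∧ x = fun k => (t k, p)}
  | .split R hR T => {x : Fin (H.arity R) → V × Fin 3 |
      ∃ t ∈ H.rel R, (∀ k, t k ∈ (T k).1) ∧ x = fun k => (t k, Fin.castLE hR k)}

/-- The structure with typed relations. -/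
def typed (H : RelStr V) (P : TotalPreorder (V × Fin 3)) : RelStr (V × Fin 3) where
  Sym := H.TypedSym
  arity := H.typedArity
  arity_pos R := match R with
    | .matching _ _ => Nat.zero_lt_two
    | .inside _ _ R => H.arity_pos R
    | .split R _ _ => H.arity_pos R
  rel := H.typedRel
  ord := P

/-- The color classes of the new structure are the copies of the old ones. -/
def IsTypedOrder (H : RelStr V) (P : TotalPreorder (V × Fin 3)) : Prop :=
  ∀ x y, P.Eqv x y ↔ H.ord.Eqv x.1 y.1 ∧ x.2 = y.2

/-! ### Regular color classes -/

/-- A choice, for every color class `C`, of a nonempty tuple over `C` with trivial pointwise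
stabilizer in the automorphism group of `C`. Equivalently, the group acts regularly and faithfully
on the orbit of this tuple. -/
structure BaseChoice (H : RelStr V) where
  len : H.ColorClass → ℕ
  pt : (C : H.ColorClass) → Fin (len C + 1) → C.1
  isBase : ∀ C, ∀ σ ∈ H.colorAut C, (∀ k, σ (pt C k) = pt C k) → σ = 1

/-- The orbit of the chosen tuple over `C`. -/
abbrev BaseOrbit (H : RelStr V) (b : H.BaseChoice) (C : H.ColorClass) : Type u :=
  {t : Fin (b.len C + 1) → C.1 // ∃ σ ∈ H.colorAut C, t = fun k => σ (b.pt C k)}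

/-- The permutation group on the orbit induced by the automorphism group of the color class. -/
def orbitAction (H : RelStr V) (b : H.BaseChoice) (C : H.ColorClass) :
    Subgroup (Equiv.Perm (H.BaseOrbit b C)) where
  carrier := {τ | ∃ σ ∈ H.colorAut C, ∀ x, (τ x).1 = fun k => σ (x.1 k)}
  mul_mem' := by
    rintro τ τ' ⟨σ, hσ, h⟩ ⟨σ', hσ', h'⟩
    refine ⟨σ * σ', mul_mem hσ hσ', fun x => ?_⟩
    rw [Equiv.Perm.mul_apply, h, h']
    rfl
  one_mem' := ⟨1, one_mem _, fun _ => rfl⟩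
  inv_mem' := by
    rintro τ ⟨σ, hσ, h⟩
    refine ⟨σ⁻¹, inv_mem hσ, fun x => ?_⟩
    have e := h (τ⁻¹ x)
    rw [perm_apply_inv] at e
    rw [e]
    funext k
    exact (perm_inv_apply σ _).symm

/-- The relation symbols of the structure with regular color classes: the orbit relations on a new
color class, the relation identifying tuples with the same first entry, and the old relations. -/
inductive RegularSym (H : RelStr V) (b : H.BaseChoice) : Type u
  | orbit (C : H.ColorClass) (o : OrbitSym (H.orbitAction b C))
  | first (C : H.ColorClass)
  | old (R : H.Sym)

/-- The arities of these relations. -/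
def regularArity (H : RelStr V) (b : H.BaseChoice) : H.RegularSym b → ℕ
  | .orbit _ o => o.n
  | .first _ => 2
  | .old R => H.arity R

/-- The relations; in the old relations a vertex is replaced by all tuples with this first entry. -/
def regularRel (H : RelStr V) (b : H.BaseChoice) :
    (R : H.RegularSym b) → Set (Fin (H.regularArity b R) → Σ C, H.BaseOrbit b C)
  | .orbit C o => {x : Fin o.n → Σ C, H.BaseOrbit b C | ∃ s ∈ o.orb, x = fun k => ⟨C, s k⟩}
  | .first C => {x : Fin 2 → Σ C, H.BaseOrbit b C |
      ∃ s s' : H.BaseOrbit b C, s.1 0 = s'.1 0 ∧ x = ![⟨C, s⟩, ⟨C, s'⟩]}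
  | .old R => {x : Fin (H.arity R) → Σ C, H.BaseOrbit b C |
      (fun k => ((x k).2.1 0 : V)) ∈ H.rel R}

/-- The structure with regular color classes: every color class `C` is replaced by the orbit of the
chosen tuple over `C`. -/
def regular (H : RelStr V) (b : H.BaseChoice) (P : TotalPreorder (Σ C, H.BaseOrbit b C)) :
    RelStr (Σ C, H.BaseOrbit b C) where
  Sym := H.RegularSym b
  arity := H.regularArity b
  arity_pos R := match R with
    | .orbit _ o => o.pos
    | .first _ => Nat.zero_lt_two
    | .old R => H.arity_pos R
  rel := H.regularRel b
  ord := P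

/-- The color classes of the new structure are the chosen orbits. -/
def IsRegularOrder (H : RelStr V) (b : H.BaseChoice)
    (P : TotalPreorder (Σ C, H.BaseOrbit b C)) : Prop :=
  ∀ x y, P.Eqv x y ↔ x.1 = y.1

/-! ### From binary to ternary relations -/

/-- The color class `C` comes strictly before the color class `D`. -/
def Before (H : RelStr V) (C D : H.ColorClass) : Prop :=
  ∀ v ∈ C.1, ∀ w ∈ D.1, H.ord.le v w ∧ ¬ H.ord.le w v

/-- The tuple with the entries `v i` is contained, up to reordering its positions, in `R`. -/
def RelUpToOrder (H : RelStr V) {m : ℕ} (R : H.Sym) (e : Fin (H.arity R) ≃ Fin m)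
    (v : Fin m → V) : Prop :=
  (fun k => v (e k)) ∈ H.rel R

/-- The pairs of color classes that occur in a binary relation. -/
abbrev PairType (H : RelStr V) : Type u :=
  {p : H.ColorClass × H.ColorClass // H.Before p.1 p.2 ∧
    ∃ R, ∃ e : Fin (H.arity R) ≃ Fin 2, ∃ v ∈ p.1.1, ∃ w ∈ p.2.1, H.RelUpToOrder R e ![v, w]}

/-- For every pair `(C, D)` of related color classes, a copy of `D` is added. -/
abbrev WithCopies (H : RelStr V) : Type u := V ⊕ Σ p : H.PairType, p.1.2.1

/-- The relation symbols of the structure in which all heterogeneous relations are ternary. -/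
inductive TernarySym (H : RelStr V) : Type u
  | inside (C : H.ColorClass) (R : H.Sym)
  | insideCopy (p : H.PairType) (R : H.Sym)
  | old (R : H.Sym) (hR : H.arity R = 3)
  | edge (p : H.PairType) (R : H.Sym) (e : Fin (H.arity R) ≃ Fin 2)
  | matching (p : H.PairType)

/-- The arities of these relations. -/
def ternaryArity (H : RelStr V) : H.TernarySym → ℕ
  | .inside _ R => H.arity R
  | .insideCopy _ R => H.arity R
  | .old R _ => H.arity R
  | .edge _ _ _ => 3
  | .matching _ => 3

/-- The relations: those inside the color classes and inside their copies, the ternary ones, and for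
every pair `(C, D)` the triples `(v, w, w')`, where `w'` is the copy of `w`, such that `v` and `w`
are related by a given binary relation, respectively such that `v ∈ C` and `w ∈ D`. -/
def ternaryRel (H : RelStr V) : (R : H.TernarySym) → Set (Fin (H.ternaryArity R) → H.WithCopies)
  | .inside C R => {x : Fin (H.arity R) → H.WithCopies |
      ∃ t ∈ H.rel R, (∀ k, t k ∈ C.1) ∧ x = fun k => Sum.inl (t k)}
  | .insideCopy p R => {x : Fin (H.arity R) → H.WithCopies |
      ∃ s : Fin (H.arity R) → p.1.2.1, (fun k => (s k : V)) ∈ H.rel R ∧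
        x = fun k => Sum.inr ⟨p, s k⟩}
  | .old R _ => {x : Fin (H.arity R) → H.WithCopies | ∃ t ∈ H.rel R, x = fun k => Sum.inl (t k)}
  | .edge p R e => {x : Fin 3 → H.WithCopies | ∃ v ∈ p.1.1.1, ∃ w : p.1.2.1,
      H.RelUpToOrder R e ![v, w] ∧ x = ![Sum.inl v, Sum.inl w, Sum.inr ⟨p, w⟩]}
  | .matching p => {x : Fin 3 → H.WithCopies | ∃ v ∈ p.1.1.1, ∃ w : p.1.2.1,
      x = ![Sum.inl v, Sum.inl w, Sum.inr ⟨p, w⟩]}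

/-- The structure in which all heterogeneous relations are ternary. -/
def ternary (H : RelStr V) (P : TotalPreorder H.WithCopies) : RelStr H.WithCopies where
  Sym := H.TernarySym
  arity := H.ternaryArity
  arity_pos R := match R with
    | .inside _ R => H.arity_pos R
    | .insideCopy _ R => H.arity_pos R
    | .old R _ => H.arity_pos R
    | .edge _ _ _ => Nat.zero_lt_succ 2
    | .matching _ => Nat.zero_lt_succ 2
  rel := H.ternaryRel
  ord := P

/-- The color classes of the new structure are the old ones and the copies. -/
def IsTernaryOrder (H : RelStr V) (P : TotalPreorder H.WithCopies) : Prop :=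
  (∀ v w, P.Eqv (Sum.inl v) (Sum.inl w) ↔ H.ord.Eqv v w) ∧
  (∀ x y, P.Eqv (Sum.inr x) (Sum.inr y) ↔ x.1 = y.1) ∧
  ∀ v y, ¬ P.Eqv (Sum.inl v) (Sum.inr y)

/-! ### Quotient color classes -/

/-- The increasing triples of color classes that occur in a ternary relation. -/
abbrev TripleType (H : RelStr V) : Type u :=
  {T : Fin 3 → H.ColorClass // (∀ i j, i < j → H.Before (T i) (T j)) ∧
    ∃ R, ∃ e : Fin (H.arity R) ≃ Fin 3, ∃ v : Fin 3 → V, (∀ i, v i ∈ (T i).1) ∧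
      H.RelUpToOrder R e v}

/-- The automorphism group of the structure on the three color classes of `T` given by the relations
inside these color classes and the relations of type `T`, as a subgroup of the product. -/
def typeGroup (H : RelStr V) (T : H.TripleType) :
    Subgroup ((i : Fin 3) → Equiv.Perm (T.1 i).1) where
  carrier := {σ | (∀ i, σ i ∈ H.colorAut (T.1 i)) ∧
    ∀ R (e : Fin (H.arity R) ≃ Fin 3) (v : (i : Fin 3) → (T.1 i).1),
      H.RelUpToOrder R e (fun i => (σ i (v i) : V)) ↔ H.RelUpToOrder R e (fun i => (v i : V))}
  mul_mem' := by
    rintro σ τ ⟨h1, h2⟩ ⟨h3, h4⟩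
    exact ⟨fun i => mul_mem (h1 i) (h3 i),
      fun R e v => (h2 R e (fun i => τ i (v i))).trans (h4 R e v)⟩
  one_mem' := ⟨fun _ => one_mem _, fun _ _ _ => Iff.rfl⟩
  inv_mem' := by
    rintro σ ⟨h1, h2⟩
    refine ⟨fun i => inv_mem (h1 i), fun R e v => ?_⟩
    have h := h2 R e (fun i => (σ i)⁻¹ (v i))
    have h' : (fun i => (σ i ((σ i)⁻¹ (v i)) : V)) = fun i => (v i : V) :=
      funext fun i => congrArg Subtype.val (perm_apply_inv (σ i) (v i))
    rw [h'] at h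
    exact h.symm

/-- The kernel of the projection of `typeGroup T` to the two factors other than the `i`-th one,
as a permutation group on the `i`-th color class. -/
def typeKernel (H : RelStr V) (T : H.TripleType) (i : Fin 3) :
    Subgroup (Equiv.Perm (T.1 i).1) :=
  (H.typeGroup T).comap (MonoidHom.mulSingle (fun i => Equiv.Perm (T.1 i).1) i)

/-- The set of orbits of the kernel on the `i`-th color class. -/
def QuotientClass (H : RelStr V) (T : H.TripleType) (i : Fin 3) : Type u :=
  MulAction.orbitRel.Quotient (H.typeKernel T i) (T.1 i).1

/-- The orbit of a vertex. -/
def toQuotient (H : RelStr V) (T : H.TripleType) (i : Fin 3) (v : (T.1 i).1) :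
    H.QuotientClass T i :=
  Quotient.mk _ v

/-- The permutations of the orbits induced by the automorphisms of the `i`-th color class. -/
def quotientAction (H : RelStr V) (T : H.TripleType) (i : Fin 3) :
    Subgroup (Equiv.Perm (H.QuotientClass T i)) where
  carrier := {τ | ∃ σ ∈ H.colorAut (T.1 i),
    ∀ v, τ (H.toQuotient T i v) = H.toQuotient T i (σ v)}
  mul_mem' := by
    rintro τ τ' ⟨σ, hσ, h⟩ ⟨σ', hσ', h'⟩
    refine ⟨σ * σ', mul_mem hσ hσ', fun v => ?_⟩
    rw [Equiv.Perm.mul_apply, h', h, Equiv.Perm.mul_apply]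
  one_mem' := ⟨1, one_mem _, fun _ => rfl⟩
  inv_mem' := by
    rintro τ ⟨σ, hσ, h⟩
    refine ⟨σ⁻¹, inv_mem hσ, fun v => ?_⟩
    have e := h (σ⁻¹ v)
    rw [perm_apply_inv] at e
    rw [← e, perm_inv_apply]

/-- The vertices of all quotient color classes. -/
abbrev QuotientVertex (H : RelStr V) : Type u :=
  Σ x : H.TripleType × Fin 3, H.QuotientClass x.1 x.2

/-- The relation symbols of the quotient structure. -/
inductive QuotientSym (H : RelStr V) : Type u
  | inside (C : H.ColorClass) (R : H.Sym)
  | orbit (x : H.TripleType × Fin 3) (o : OrbitSym (H.quotientAction x.1 x.2))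
  | orbitMap (x : H.TripleType × Fin 3)
  | moved (T : H.TripleType) (R : H.Sym)

/-- The arities of these relations. -/
def quotientArity (H : RelStr V) : H.QuotientSym → ℕ
  | .inside _ R => H.arity R
  | .orbit _ o => o.n
  | .orbitMap _ => 2
  | .moved _ _ => 3

/-- The relations: those inside the old color classes, the orbit relations on the quotient color
classes, the orbit maps, and the ternary relations moved to the quotient color classes. -/
def quotientRel (H : RelStr V) :
    (R : H.QuotientSym) → Set (Fin (H.quotientArity R) → V ⊕ H.QuotientVertex)
  | .inside C R => {x : Fin (H.arity R) → V ⊕ H.QuotientVertex |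
      ∃ t ∈ H.rel R, (∀ k, t k ∈ C.1) ∧ x = fun k => Sum.inl (t k)}
  | .orbit y o => {x : Fin o.n → V ⊕ H.QuotientVertex |
      ∃ s ∈ o.orb, x = fun k => Sum.inr ⟨y, s k⟩}
  | .orbitMap y => {x : Fin 2 → V ⊕ H.QuotientVertex |
      ∃ v : (y.1.1 y.2).1,
        x = ![Sum.inl (v : V), Sum.inr ⟨y, H.toQuotient y.1 y.2 v⟩]}
  | .moved T R => {x : Fin 3 → V ⊕ H.QuotientVertex |
      ∃ (e : Fin (H.arity R) ≃ Fin 3) (v : (i : Fin 3) → (T.1 i).1),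
        H.RelUpToOrder R e (fun i => (v i : V)) ∧
        x = fun i => Sum.inr ⟨(T, i), H.toQuotient T i (v i)⟩}

/-- The quotient structure. The old vertices are the extension vertices, the new ones are the group
vertices. -/
def quotient (H : RelStr V) (P : TotalPreorder (V ⊕ H.QuotientVertex)) :
    RelStr (V ⊕ H.QuotientVertex) where
  Sym := H.QuotientSym
  arity := H.quotientArity
  arity_pos R := match R with
    | .inside _ R => H.arity_pos R
    | .orbit _ o => o.pos
    | .orbitMap _ => Nat.zero_lt_two
    | .moved _ _ => Nat.zero_lt_succ 2
  rel := H.quotientRel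
  ord := P

/-- The color classes of the new structure are the old ones and the quotient color classes. -/
def IsQuotientOrder (H : RelStr V) (P : TotalPreorder (V ⊕ H.QuotientVertex)) : Prop :=
  (∀ v w, P.Eqv (Sum.inl v) (Sum.inl w) ↔ H.ord.Eqv v w) ∧
  (∀ x y, P.Eqv (Sum.inr x) (Sum.inr y) ↔ x.1 = y.1) ∧
  ∀ v y, ¬ P.Eqv (Sum.inl v) (Sum.inr y)

/-! ### The normal-form reduction -/

/-- `IsNormalFormOf H H' G`: the structure `H'` with set `G` of group vertices is the result of the
normal-form reduction applied to `H`, for some choice of the orders of the new color classes and of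
the tuples used to make the color classes regular. Making the color classes regular may destroy
transitivity, so the first two steps are applied again afterwards. -/
inductive IsNormalFormOf (H : RelStr V) : {W : Type u} → RelStr W → Set W → Prop
  | mk (H₁ : RelStr V) (h₁ : TransitiveRefinement H H₁)
      (P₂ : TotalPreorder (V × Fin 3)) (h₂ : H₁.IsTypedOrder P₂)
      (b : (H₁.typed P₂).BaseChoice)
      (P₃ : TotalPreorder (Σ C, (H₁.typed P₂).BaseOrbit b C))
      (h₃ : (H₁.typed P₂).IsRegularOrder b P₃)
      (H₄ : RelStr (Σ C, (H₁.typed P₂).BaseOrbit b C))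
      (h₄ : TransitiveRefinement ((H₁.typed P₂).regular b P₃) H₄)
      (P₅ : TotalPreorder ((Σ C, (H₁.typed P₂).BaseOrbit b C) × Fin 3))
      (h₅ : H₄.IsTypedOrder P₅)
      (P₆ : TotalPreorder (H₄.typed P₅).WithCopies)
      (h₆ : (H₄.typed P₅).IsTernaryOrder P₆)
      (P₇ : TotalPreorder
        ((H₄.typed P₅).WithCopies ⊕ ((H₄.typed P₅).ternary P₆).QuotientVertex))
      (h₇ : ((H₄.typed P₅).ternary P₆).IsQuotientOrder P₇) :
      IsNormalFormOf H (((H₄.typed P₅).ternary P₆).quotient P₇) (Set.range Sum.inr)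

/-! ### Two-injective quotient structures -/

/-- `T` is the type of some tuple in a heterogeneous relation. -/
def IsType (H : RelStr V) {n : ℕ} (T : Fin n → H.ColorClass) : Prop :=
  2 ≤ n ∧ Function.Injective T ∧ ∃ R, ∃ t ∈ H.rel R, ∃ h : H.arity R = n,
    ∀ k, t k ∈ (T (Fin.cast h k)).1

/-- `T` is a type that only consists of group color classes. -/
def IsGroupType (H : RelStr V) (G : Set V) {n : ℕ} (T : Fin n → H.ColorClass) : Prop :=
  H.IsType T ∧ ∀ i, (T i).1 ⊆ G

/-- The vertices in the color classes of `T`. -/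
def support (H : RelStr V) {n : ℕ} (T : Fin n → H.ColorClass) : Set V := {v | ∃ i, v ∈ (T i).1}

/-- The automorphism group of the substructure induced by the color classes of `T`. -/
def localAut (H : RelStr V) {n : ℕ} (T : Fin n → H.ColorClass) :
    Subgroup (Equiv.Perm (H.support T)) :=
  (H.induce (H.support T)).autGroup

/-- Every relation is homogeneous or all its tuples have one common type. -/
def TypedRelations (H : RelStr V) : Prop :=
  ∀ R, H.Homogeneous R ∨ ∃ T : Fin (H.arity R) → H.ColorClass, Function.Injective T ∧
    ∀ t ∈ H.rel R, ∀ k, t k ∈ (T k).1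

/-- `D` is an `N`-quotient of `C` with orbit map `R`: the group of `D` is isomorphic to that of `C`
modulo `N`, and `R` is (the graph of) a map from `C` onto `D` whose fibers are the `N`-orbits. -/
def IsQuotientVia (H : RelStr V) (C D : H.ColorClass) (N : Subgroup (H.colorAut C)) [N.Normal]
    (R : H.Sym) : Prop :=
  Nonempty (H.colorAut D ≃* H.colorAut C ⧸ N) ∧ H.arity R = 2 ∧
  ∃ f : C.1 → D.1, Function.Surjective f ∧
    (∀ v w, f v = f w ↔ ∃ g ∈ N, (g : Equiv.Perm C.1) v = w) ∧
    ∀ t, t ∈ H.rel R ↔ ∃ v : C.1, ∀ k, t k = if (k : ℕ) = 0 then (v : V) else (f v : V)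

/-- For a triple `T`: the group `localAut T` is a 2-injective subdirect product of the groups of the
color classes of `T`. -/
def IsTwoInjectiveSubdirect (H : RelStr V) (T : Fin 3 → H.ColorClass) : Prop :=
  (∀ i, ∀ τ ∈ H.colorAut (T i), ∃ σ ∈ H.localAut T,
    ∀ v : (T i).1, (σ ⟨v, i, v.2⟩ : V) = τ v) ∧
  ∀ i, ∀ σ ∈ H.localAut T,
    (∀ j, j ≠ i → ∀ v : H.support T, (v : V) ∈ (T j).1 → σ v = v) → σ = 1

/-- 2-injective quotient structures, where `G` is the set of vertices in group color classes and
the other color classes are the extension color classes. -/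
structure IsTwoInjectiveQuotient (H : RelStr V) (G : Set V) : Prop where
  union : ∀ v w, H.ord.Eqv v w → (v ∈ G ↔ w ∈ G)
  arity : H.ArityAtMost 3
  typed : H.TypedRelations
  regular : ∀ C, IsRegularGroup (H.colorAut C)
  /-- Every group color class is a quotient of an extension color class, and no relation except the
  orbit map connects it to any extension color class. -/
  quotient : ∀ D : H.ColorClass, D.1 ⊆ G → ∃ C : H.ColorClass, C.1 ∩ G = ∅ ∧
    ∃ N : Subgroup (H.colorAut C), ∃ _ : N.Normal, ∃ R : H.Sym, H.IsQuotientVia C D N R ∧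
      ∀ R', ∀ t ∈ H.rel R', (∃ k, t k ∈ D.1) → (∃ k, t k ∉ G) → R' = R
  /-- Heterogeneous relations between group color classes are ternary. -/
  group_arity : ∀ R, ¬ H.Homogeneous R → (∀ t ∈ H.rel R, ∀ k, t k ∈ G) → H.arity R = 3
  /-- Every group color class occurs in only one group type. -/
  group_type : ∀ (m n : ℕ) (T : Fin m → H.ColorClass) (T' : Fin n → H.ColorClass),
    H.IsGroupType G T → H.IsGroupType G T' → (∃ i j, T i = T' j) →
      (⟨m, T⟩ : Σ n : ℕ, Fin n → H.ColorClass) = ⟨n, T'⟩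
  two_injective : ∀ T : Fin 3 → H.ColorClass, H.IsGroupType G T → H.IsTwoInjectiveSubdirect T

end RelStr

/-! ### The double CFI group -/

/-- The CFI group: the triples over the dihedral group of order two with product one. -/
def CFIGroup : Subgroup (DihedralGroup 1 × DihedralGroup 1 × DihedralGroup 1) where
  carrier := {g | g.1 * g.2.1 * g.2.2 = 1}
  mul_mem' := by
    have h : ∀ a b c d e f : DihedralGroup 1, a * b * c = 1 → d * e * f = 1 →
      (a * d) * (b * e) * (c * f) = 1 := by decide
    intro x y hx hy
    exact h _ _ _ _ _ _ hx hy
  one_mem' := by decide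
  inv_mem' := by
    have h : ∀ a b c : DihedralGroup 1, a * b * c = 1 → a⁻¹ * b⁻¹ * c⁻¹ = 1 := by decide
    intro x hx
    exact h _ _ _ hx

/-- The double CFI group: the wreath product of the CFI group with the cyclic group of order two. -/
abbrev DoubleCFIGroup : Type := RegularWreathProduct CFIGroup (Multiplicative (ZMod 2))

/-- The realization of the double CFI group as a subgroup of the cube of the dihedral group of order
eight. -/
def doubleCFIInD4 : Subgroup (DihedralGroup 4 × DihedralGroup 4 × DihedralGroup 4) :=
  Subgroup.closure
    {(1, DihedralGroup.sr 0, DihedralGroup.sr 0), (DihedralGroup.sr 0, 1, DihedralGroup.sr 0),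
      (DihedralGroup.r 1, DihedralGroup.r 1, DihedralGroup.sr 1)}

/-- The intersection of this realization with `C₄ × D₄ × D₄`, where `C₄` is the group of
rotations. -/
def doubleCFICyclic : Subgroup (DihedralGroup 4 × DihedralGroup 4 × DihedralGroup 4) :=
  doubleCFIInD4 ⊓ (Subgroup.zpowers (DihedralGroup.r 1)).prod ⊤

/-- A structure with set `G` of group vertices is double-CFI-free if it is a 2-injective quotient
structure with dihedral colors and no local automorphism group of a group type is isomorphic to the
double CFI group or to its intersection with `C₄ × D₄ × D₄`. -/
structure RelStr.IsDoubleCFIFree {V : Type u} (H : RelStr V) (G : Set V) : Prop where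
  twoInjective : H.IsTwoInjectiveQuotient G
  dihedral : H.HasDihedralColors
  not_doubleCFI : ∀ (n : ℕ) (T : Fin n → H.ColorClass), H.IsGroupType G T →
    IsEmpty (H.localAut T ≃* DoubleCFIGroup)
  not_doubleCFICyclic : ∀ (n : ℕ) (T : Fin n → H.ColorClass), H.IsGroupType G T →
    IsEmpty (H.localAut T ≃* doubleCFICyclic)

end NormalForm

/-! Two independent arguments are combined: one gives the shape of a 2-injective quotient structure,
the other excludes the double CFI groups.

Shape. Choosing orbits of bases makes all color groups free (`isFreeGroup_orbitAction`). A later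
refinement only restricts automorphisms to smaller classes, so freeness survives
(`isFreeGroup_refine`) while transitivity on three classes is restored. Free and transitive groups
are regular. Freeness also turns transitivity of the local group of a type into surjectivity onto
each color group (`IsRegularTyped.exists_typeGroup`), so the kernels N_i are normal and the quotient
classes are well behaved. After the passage to N_i-orbits, an automorphism that is trivial on two
factors lifts to an element of the third kernel, and hence is trivial (`localAut_eq_one`). This is
2-injectivity.

Exclusion. Each type of the ternary structure is of one of two kinds (`commOrNotFour_or_isLinked`).
If it comes from a relation that was already ternary, its color groups are commutative or of order
not divisible by four: odd dihedral input has this property, graphs have no ternary relation, and a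
ternary orbit relation created on the way lives on a class with three elements, whose group embeds
in S_3. The property passes to sections, and it makes all 2-sections commutative. If the type comes
from a binary relation, two of its classes are linked by a bijection, so the local group of the
quotient embeds into a section of one dihedral group (`localAut_isCyclicOrDihedral`).

Both double CFI groups satisfy x^4 = 1, have more than eight elements and are not commutative. In
the first case the local group would be a 2-group and hence commutative (`localAut_comm`); in the
second case it would be cyclic or dihedral with fourth powers trivial, hence of order at most eight.

All control over groups along the reduction goes through sections (`IsSection`) and renamings of
points (`PermIso`). Existence of an output reduces to termination of the refinement, since
everything else is a free choice. -/

namespace NormalForm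

/-! ### Cyclic and dihedral groups -/

/-- A group that is cyclic or a dihedral group of finite order. -/
def IsCyclicOrDihedral (G : Type*) [Group G] : Prop :=
  IsCyclic G ∨ ∃ n : ℕ, 0 < n ∧ Nonempty (G ≃* DihedralGroup n)

/-- A generating rotation `r` and a reflection `s` inverting it. -/
structure DihedralPair {G : Type*} [Group G] (r s : G) : Prop where
  sq : s * s = 1
  conj : s * r * s = r⁻¹
  cover : ∀ g, g ∈ Subgroup.zpowers r ∨ g * s ∈ Subgroup.zpowers r

namespace DihedralPair

variable {G : Type*} [Group G] {r s : G}

theorem inv_eq (h : DihedralPair r s) : s⁻¹ = s := inv_eq_of_mul_eq_one_left h.sq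

theorem conj_zpow (h : DihedralPair r s) (k : ℤ) : s * r ^ k * s = (r ^ k)⁻¹ := by
  have e : s * r * s⁻¹ = r⁻¹ := by rw [h.inv_eq, h.conj]
  have e' : (s * r * s⁻¹) ^ k = s * r ^ k * s⁻¹ := _root_.conj_zpow
  rw [e, h.inv_eq] at e'
  rw [← e', inv_zpow]

/-- If s is a power of r, then r generates G. Otherwise the rotations and their products with s do
not overlap, and the standard presentation gives an isomorphism with the dihedral group on n =
`orderOf r`, where n may be 1 or 2. Working with such pairs makes closure under quotients immediate,
because the surjective image of a pair is again a pair. -/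
theorem isCyclicOrDihedral [Finite G] (h : DihedralPair r s) : IsCyclicOrDihedral G := by
  by_cases hs : s ∈ Subgroup.zpowers r
  · left
    refine ⟨r, fun g => ?_⟩
    rcases h.cover g with hg | hg
    · exact hg
    · have := mul_mem hg (inv_mem hs)
      rwa [mul_inv_cancel_right] at this
  right
  let n := orderOf r
  have hn : 0 < n := orderOf_pos r
  have : NeZero n := ⟨hn.ne'⟩
  -- Powers of r depend only on the exponent modulo its order; `f` below is this map written
  -- multiplicatively.
  let ρ : ZMod n →+ Additive G := ZMod.lift n ⟨zmultiplesHom (Additive G) (Additive.ofMul r), by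
    rw [zmultiplesHom_apply, ← ofMul_zpow]
    simp [n, pow_orderOf_eq_one]⟩
  let f : ZMod n → G := fun i => (ρ i).toMul
  have f_cast (k : ℤ) : f k = r ^ k := by
    change (ρ (k : ZMod n)).toMul = _
    simp only [ρ]
    erw [ZMod.lift_coe]
    rfl
  have f_add (i j) : f (i + j) = f i * f j := by
    change (ρ (i + j)).toMul = _
    rw [map_add]; rfl
  have f_neg (i) : f (-i) = (f i)⁻¹ := by
    change (ρ (-i)).toMul = _
    rw [map_neg]; rfl
  have f_sub (i j) : f (i - j) = f i * (f j)⁻¹ := by rw [sub_eq_add_neg, f_add, f_neg]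
  have f_comm (i j) : f i * f j = f j * f i := by rw [← f_add, add_comm, f_add]
  have f_mem (i) : f i ∈ Subgroup.zpowers r := by
    obtain ⟨k, rfl⟩ := ZMod.intCast_surjective i
    rw [f_cast]; exact ⟨k, rfl⟩
  have f_inj (i) (hi : f i = 1) : i = 0 := by
    obtain ⟨k, rfl⟩ := ZMod.intCast_surjective i
    rw [f_cast] at hi
    rw [ZMod.intCast_zmod_eq_zero_iff_dvd]
    exact orderOf_dvd_iff_zpow_eq_one.2 hi
  have f_conj (i) : f i * s = s * (f i)⁻¹ := by
    obtain ⟨k, rfl⟩ := ZMod.intCast_surjective i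
    rw [f_cast, ← h.conj_zpow, ← mul_assoc, ← mul_assoc, h.sq, one_mul]
  let F : DihedralGroup n →* G := MonoidHom.mk'
    (fun x => match x with
      | .r i => f i
      | .sr i => s * f i) (by
    rintro (i | i) (j | j)
    · exact f_add i j
    · change s * f (j - i) = f i * (s * f j)
      rw [f_sub, ← mul_assoc (f i), f_conj, mul_assoc, ← f_neg, f_comm]
    · change s * f (i + j) = s * f i * f j
      rw [f_add, mul_assoc]
    · change f (j - i) = s * f i * (s * f j)
      rw [f_sub, mul_assoc, ← mul_assoc (f i), f_conj, ← mul_assoc, ← mul_assoc, h.sq, one_mul,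
        ← f_neg, f_comm])
  refine ⟨n, hn, ⟨(MulEquiv.ofBijective F ⟨?_, ?_⟩).symm⟩⟩
  · rw [injective_iff_map_eq_one]
    rintro (i | i) hi
    · rw [f_inj i hi, DihedralGroup.r_zero]
    · exfalso
      have hi : s * f i = 1 := hi
      apply hs
      rw [eq_inv_of_mul_eq_one_left hi]
      exact inv_mem (f_mem i)
  · intro g
    rcases h.cover g with ⟨k, hk⟩ | ⟨k, hk⟩
    · refine ⟨.r k, ?_⟩
      change f k = g
      rw [f_cast, ← hk]
    -- From g s = r^k follows g = r^k s = s r^(-k), which explains the sign.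
    · refine ⟨.sr (-k : ℤ), ?_⟩
      change s * f ((-k : ℤ) : ZMod n) = g
      have hk : r ^ k = g * s := hk
      have e := f_conj k
      rw [f_cast] at e
      rw [f_cast, zpow_neg, ← e, hk, mul_assoc, h.sq, mul_one]

theorem map {A : Type*} [Group A] (h : DihedralPair r s) (f : G →* A)
    (hf : Function.Surjective f) : DihedralPair (f r) (f s) where
  sq := by rw [← map_mul, h.sq, map_one]
  conj := by rw [← map_mul, ← map_mul, h.conj, map_inv]
  cover a := by
    obtain ⟨g, rfl⟩ := hf a
    rcases h.cover g with ⟨k, hk⟩ | ⟨k, hk⟩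
    · exact .inl ⟨k, by rw [← hk]; exact (map_zpow f r k).symm⟩
    · exact .inr ⟨k, by rw [← map_mul, ← hk]; exact (map_zpow f r k).symm⟩

end DihedralPair

theorem dihedralPair (n : ℕ) : DihedralPair (DihedralGroup.r 1 : DihedralGroup n)
    (DihedralGroup.sr 0) where
  sq := by simp
  conj := by simp
  cover := by
    rintro (i | i)
    · obtain ⟨k, rfl⟩ := ZMod.intCast_surjective i
      exact .inl ⟨k, by simp⟩
    · obtain ⟨k, rfl⟩ := ZMod.intCast_surjective i
      exact .inr ⟨-k, by simp⟩

namespace IsCyclicOrDihedral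

variable {A G : Type*} [Group A] [Group G]

theorem exists_dihedralPair (h : ∃ n : ℕ, 0 < n ∧ Nonempty (G ≃* DihedralGroup n)) :
    ∃ r s : G, DihedralPair r s := by
  obtain ⟨n, -, ⟨e⟩⟩ := h
  exact ⟨_, _, (dihedralPair n).map e.symm.toMonoidHom e.symm.surjective⟩

theorem of_surjective [Finite G] (h : IsCyclicOrDihedral G) (f : G →* A)
    (hf : Function.Surjective f) : IsCyclicOrDihedral A := by
  have := Finite.of_surjective f hf
  rcases h with h | h
  · exact .inl (isCyclic_of_surjective f hf)
  · obtain ⟨r, s, h⟩ := exists_dihedralPair h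
    exact (h.map f hf).isCyclicOrDihedral

/-- The preimage of the rotation subgroup is cyclic. If it is not everything, its generator together
with any element outside it forms a dihedral pair, because two reflections multiply to a rotation.
-/
theorem of_injective [Finite G] (h : IsCyclicOrDihedral G) (f : A →* G)
    (hf : Function.Injective f) : IsCyclicOrDihedral A := by
  have := Finite.of_injective f hf
  rcases h with h | h
  · exact .inl (isCyclic_of_injective f hf)
  obtain ⟨r, s, h⟩ := exists_dihedralPair h
  let B := (Subgroup.zpowers r).comap f
  have hB : IsCyclic B := isCyclic_of_injective
    ((f.subgroupComap (Subgroup.zpowers r)) : B →* Subgroup.zpowers r) (by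
      rintro ⟨x, hx⟩ ⟨y, hy⟩ e
      exact Subtype.ext (hf (congrArg Subtype.val e)))
  obtain ⟨⟨b, hb⟩, hgen⟩ := hB
  have hgen' (a : A) (ha : f a ∈ Subgroup.zpowers r) : a ∈ Subgroup.zpowers b := by
    obtain ⟨k, hk⟩ := hgen ⟨a, ha⟩
    exact ⟨k, congrArg Subtype.val hk⟩
  by_cases hall : ∀ a, f a ∈ Subgroup.zpowers r
  · exact .inl ⟨b, fun a => hgen' a (hall a)⟩
  push Not at hall
  obtain ⟨a₀, ha₀⟩ := hall
  obtain ⟨k, hk⟩ := (h.cover (f a₀)).resolve_left ha₀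
  have form (a : A) (k : ℤ) (hk : r ^ k = f a * s) : f a = r ^ k * s := by
    rw [hk, mul_assoc, h.sq, mul_one]
  have e₀ := form a₀ k hk
  obtain ⟨j, hj⟩ := hb
  have hj : r ^ j = f b := hj
  -- The product of two reflections is the rotation by the difference of their exponents.
  have key (m : ℤ) : r ^ m * s * (r ^ k * s) = r ^ (m - k) := by
    rw [mul_assoc, ← mul_assoc s, h.conj_zpow, zpow_sub]
  refine DihedralPair.isCyclicOrDihedral (r := b) (s := a₀) ⟨?_, ?_, fun a => ?_⟩
  · apply hf
    rw [map_mul, e₀, key, sub_self, zpow_zero, map_one]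
  · apply hf
    rw [map_mul, map_mul, map_inv, e₀, ← hj, mul_assoc, ← mul_assoc (r ^ j), ← zpow_add,
      mul_assoc, ← mul_assoc s, h.conj_zpow, ← zpow_neg, ← zpow_add, ← zpow_neg]
    congr 1; ring
  · by_cases ha : f a ∈ Subgroup.zpowers r
    · exact .inl (hgen' a ha)
    · obtain ⟨m, hm⟩ := (h.cover (f a)).resolve_left ha
      right
      apply hgen'
      rw [map_mul, form a m hm, e₀, key]
      exact ⟨_, rfl⟩

/-- The generating rotation has order dividing four, so a cyclic group has order at most four and a
dihedral one at most 2 · 4. -/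
theorem card_le_eight (h : IsCyclicOrDihedral G) (hG : ∀ g : G, g ^ 4 = 1) :
    Nat.card G ≤ 8 := by
  rcases h with h | ⟨n, hn, ⟨e⟩⟩
  · obtain ⟨g, hg⟩ := IsCyclic.exists_generator (α := G)
    have h4 : orderOf g ∣ 4 := orderOf_dvd_of_pow_eq_one (hG g)
    rw [← Nat.card_zpowers, (Subgroup.eq_top_iff' _).2 hg, Subgroup.card_top] at h4
    exact (Nat.le_of_dvd (by norm_num) h4).trans (by norm_num)
  · have h4 : n ∣ 4 := by
      rw [← DihedralGroup.orderOf_r_one (n := n)]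
      apply orderOf_dvd_of_pow_eq_one
      apply e.symm.injective
      rw [map_pow, hG, map_one]
    rw [Nat.card_congr e.toEquiv, DihedralGroup.nat_card]
    have := Nat.le_of_dvd (by norm_num) h4
    omega

end IsCyclicOrDihedral

/-! ### Groups whose `2`-sections are commutative -/

/-- A group that is commutative or has no order divisible by four. -/
def CommOrNotFour (G : Type*) [Group G] : Prop :=
  (∀ a b : G, a * b = b * a) ∨ ¬ 4 ∣ Nat.card G

namespace CommOrNotFour

variable {A G : Type*} [Group A] [Group G]

theorem of_surjective (h : CommOrNotFour G) (f : G →* A) (hf : Function.Surjective f) :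
    CommOrNotFour A := by
  rcases h with h | h
  · refine .inl fun a b => ?_
    obtain ⟨a, rfl⟩ := hf a
    obtain ⟨b, rfl⟩ := hf b
    rw [← map_mul, h, map_mul]
  · exact .inr fun h' => h (h'.trans (Subgroup.card_dvd_of_surjective f hf))

theorem of_injective (h : CommOrNotFour G) (f : A →* G) (hf : Function.Injective f) :
    CommOrNotFour A := by
  rcases h with h | h
  · refine .inl fun a b => hf ?_
    rw [map_mul, h, map_mul]
  · exact .inr fun h' => h (h'.trans (Subgroup.card_dvd_of_injective f hf))

/-- A 2-group whose order is not divisible by four has order one or two. -/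
theorem comm_of_isPGroup [Finite G] (h : CommOrNotFour G) (hG : IsPGroup 2 G) (a b : G) :
    a * b = b * a := by
  rcases h with h | h
  · exact h a b
  obtain ⟨k, hk⟩ := IsPGroup.iff_card.1 hG
  have hk1 : k ≤ 1 := by
    by_contra hk2
    exact h (hk ▸ pow_dvd_pow 2 (by omega : 2 ≤ k))
  have hc : IsCyclic G := by
    interval_cases k
    · have := (Nat.card_eq_one_iff_unique.1 (by simpa using hk)).1
      infer_instance
    · have : Fact (Nat.Prime 2) := ⟨Nat.prime_two⟩
      exact isCyclic_of_prime_card (p := 2) (by simpa using hk)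
  exact IsCyclic.isMulCommutative.is_comm.comm a b

/-- The order divides 3! = 6. This covers the ternary relations that the reduction itself creates:
orbits of |D|-tuples on a class D with three elements. -/
theorem of_perm {X : Type*} (G : Subgroup (Equiv.Perm X)) (hX : Nat.card X = 3) :
    CommOrNotFour G := by
  have : Finite X := Nat.finite_of_card_ne_zero (by omega)
  refine .inr fun h => ?_
  have h' := h.trans (Subgroup.card_subgroup_dvd_card G)
  rw [Nat.card_perm, hX] at h'
  revert h'; decide

theorem of_odd_dihedral {k : ℕ} (hk : Odd k) (e : G ≃* DihedralGroup k) : CommOrNotFour G := by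
  refine .inr fun h => ?_
  rw [Nat.card_congr e.toEquiv, DihedralGroup.nat_card] at h
  obtain ⟨m, rfl⟩ := hk
  omega

end CommOrNotFour

/-! ### Sections of groups -/

/-- `A` is a quotient of a subgroup of `B`. -/
def IsSection (A B : Type u) [Group A] [Group B] : Prop :=
  ∃ (K : Subgroup (A × B)), Function.Surjective ((MonoidHom.fst A B).comp K.subtype) ∧
    Function.Injective ((MonoidHom.snd A B).comp K.subtype)

namespace IsSection

variable {A B : Type u} [Group A] [Group B]

/-- The relation `ρ` is the subgroup of the product that witnesses the section: totality gives the
surjection onto A, and `hu` the embedding into B. In the applications it says that a permutation of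
the new class is induced by one of the old class, so no choice of lifts is needed. -/
theorem of_rel (ρ : A → B → Prop) (h1 : ρ 1 1) (hm : ∀ a b a' b', ρ a b → ρ a' b' →
    ρ (a * a') (b * b')) (hi : ∀ a b, ρ a b → ρ a⁻¹ b⁻¹) (ht : ∀ a, ∃ b, ρ a b)
    (hu : ∀ a, ρ a 1 → a = 1) : IsSection A B := by
  refine ⟨{ carrier := {x | ρ x.1 x.2}, mul_mem' := fun h h' => hm _ _ _ _ h h', one_mem' := h1,
            inv_mem' := fun h => hi _ _ h }, fun a => ?_, ?_⟩
  · obtain ⟨b, hb⟩ := ht a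
    exact ⟨⟨(a, b), hb⟩, rfl⟩
  · rw [injective_iff_map_eq_one]
    rintro ⟨⟨a, b⟩, hab⟩ h
    have h : b = 1 := h
    subst h
    have := hu a hab
    subst this
    rfl

theorem isCyclicOrDihedral [Finite B] (h : IsSection A B) (hB : IsCyclicOrDihedral B) :
    IsCyclicOrDihedral A := by
  obtain ⟨K, hf, hg⟩ := h
  have := Finite.of_injective _ hg
  exact (hB.of_injective _ hg).of_surjective _ hf

theorem commOrNotFour (h : IsSection A B) (hB : CommOrNotFour B) : CommOrNotFour A := by
  obtain ⟨K, hf, hg⟩ := h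
  exact (hB.of_injective _ hg).of_surjective _ hf

end IsSection

/-! ### The double CFI groups -/

/-- The top group has exponent two, so squares lie in the base group, which has exponent two as
well. -/
theorem doubleCFI_pow_four (x : DoubleCFIGroup) : x ^ 4 = 1 := by
  have hc : ∀ a : CFIGroup, a * a = 1 := by
    rintro ⟨⟨a, b, c⟩, h⟩
    apply Subtype.ext
    have : ∀ a : DihedralGroup 1, a * a = 1 := by decide
    exact Prod.ext (this a) (Prod.ext (this b) (this c))
  have hq : ∀ q : Multiplicative (ZMod 2), q * q = 1 := by decide
  have e : x ^ 4 = x * x * (x * x) := by simp only [pow_succ, pow_zero, one_mul, mul_assoc]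
  rw [e]
  apply RegularWreathProduct.ext
  · funext q
    simp only [RegularWreathProduct.mul_left, RegularWreathProduct.mul_right, Pi.mul_apply, hq,
      inv_one, one_mul, hc]
    rfl
  · simp only [RegularWreathProduct.mul_right, hq]
    rfl

/-- The base has two factors, so four elements of the CFI group already force an order of at least 2
· 4². Two coordinates of a CFI triple can be prescribed freely, and the third is then determined. -/
theorem card_doubleCFI : 8 < Nat.card DoubleCFIGroup := by
  rw [RegularWreathProduct.card]
  have : Nat.card (Multiplicative (ZMod 2)) = 2 := by simp
  have h4 : 4 ≤ Nat.card CFIGroup := by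
    let f : ZMod 2 × ZMod 2 → CFIGroup := fun x =>
      ⟨(if x.1 = 0 then 1 else .sr 0, if x.2 = 0 then 1 else .sr 0,
        if x.1 = x.2 then 1 else .sr 0), by
          change _ * _ * _ = _
          revert x; decide⟩
    have hf : Function.Injective f := by
      intro x y h
      have h := congrArg Subtype.val h
      revert x y; simp only [f]; decide
    simpa using Nat.card_le_card_of_injective f hf
  rw [this]
  nlinarith

/-- A base element supported on a single coordinate does not commute with the element that exchanges
the two coordinates. -/
theorem doubleCFI_not_comm : ∃ x y : DoubleCFIGroup, x * y ≠ y * x := by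
  let c : CFIGroup := ⟨(.sr 0, .sr 0, 1), by change _ * _ * _ = _; decide⟩
  refine ⟨⟨fun q => if q = 1 then c else 1, 1⟩, ⟨1, Multiplicative.ofAdd 1⟩, fun h => ?_⟩
  have h := congrArg (fun x : DoubleCFIGroup => ((x.left 1).1).1) h
  revert h
  simp only [RegularWreathProduct.mul_left, Pi.mul_apply]
  simp [c]
  decide

theorem doubleCFICyclic_pow_four (x : doubleCFICyclic) : x ^ 4 = 1 := by
  have h : ∀ a : DihedralGroup 4, a ^ 4 = 1 := by decide
  obtain ⟨⟨a, b, c⟩, hx⟩ := x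
  exact Subtype.ext (Prod.ext (h a) (Prod.ext (h b) (h c)))

theorem doubleCFICyclic_generators :
    ((1, .sr 0, .sr 0) : DihedralGroup 4 × DihedralGroup 4 × DihedralGroup 4) ∈ doubleCFICyclic ∧
    ((.r 2, 1, .r 2) : DihedralGroup 4 × DihedralGroup 4 × DihedralGroup 4) ∈ doubleCFICyclic ∧
    ((.r 1, .r 1, .sr 1) : DihedralGroup 4 × DihedralGroup 4 × DihedralGroup 4) ∈
      doubleCFICyclic := by
  have h1 : ((1, .sr 0, .sr 0) : DihedralGroup 4 × DihedralGroup 4 × DihedralGroup 4) ∈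
    doubleCFIInD4 := Subgroup.subset_closure (by simp)
  have h2 : ((.sr 0, 1, .sr 0) : DihedralGroup 4 × DihedralGroup 4 × DihedralGroup 4) ∈
    doubleCFIInD4 := Subgroup.subset_closure (by simp)
  have h3 : ((.r 1, .r 1, .sr 1) : DihedralGroup 4 × DihedralGroup 4 × DihedralGroup 4) ∈
    doubleCFIInD4 := Subgroup.subset_closure (by simp)
  have hr : ∀ i : ZMod 4, (DihedralGroup.r i) ∈ Subgroup.zpowers (DihedralGroup.r (1 : ZMod 4)) := by
    intro i
    obtain ⟨k, rfl⟩ := ZMod.intCast_surjective i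
    exact ⟨k, by simp⟩
  refine ⟨⟨h1, one_mem (Subgroup.zpowers _), trivial⟩, ⟨?_, hr _, trivial⟩, ⟨h3, hr _, trivial⟩⟩
  -- A reflection times its conjugate by a rotation of order four is the half turn. So the generator
  -- (sr 0, 1, sr 0), which itself lies outside C₄ × D₄ × D₄, times its conjugate by the third
  -- generator lies inside.
  · have e : ((.r 2, 1, .r 2) : DihedralGroup 4 × DihedralGroup 4 × DihedralGroup 4) =
      (.sr 0, 1, .sr 0) * ((.r 1, .r 1, .sr 1) * (.sr 0, 1, .sr 0) * (.r 1, .r 1, .sr 1)⁻¹) := by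
      decide
    rw [e]
    exact Subgroup.mul_mem _ h2 (Subgroup.mul_mem _ (Subgroup.mul_mem _ h3 h2)
      (Subgroup.inv_mem _ h3))

/-- The words c^i a^j b^k with i < 4 and j, k < 2 are sixteen distinct elements. -/
theorem card_doubleCFICyclic : 8 < Nat.card doubleCFICyclic := by
  obtain ⟨h1, h2, h3⟩ := doubleCFICyclic_generators
  let a : doubleCFICyclic := ⟨_, h1⟩
  let b : doubleCFICyclic := ⟨_, h2⟩
  let c : doubleCFICyclic := ⟨_, h3⟩
  let f : Fin 4 × Fin 2 × Fin 2 → doubleCFICyclic := fun x =>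
    c ^ (x.1 : ℕ) * a ^ (x.2.1 : ℕ) * b ^ (x.2.2 : ℕ)
  have hf : Function.Injective f := by
    intro x y h
    replace h := congrArg Subtype.val h
    simp only [f, a, b, c, Subgroup.coe_mul, Subgroup.coe_pow] at h
    clear * - h
    revert x y
    decide
  have := Nat.card_le_card_of_injective f hf
  simp at this
  omega

theorem doubleCFICyclic_not_comm : ∃ x y : doubleCFICyclic, x * y ≠ y * x := by
  obtain ⟨h1, h2, h3⟩ := doubleCFICyclic_generators
  refine ⟨⟨_, h1⟩, ⟨_, h3⟩, fun h => ?_⟩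
  have h := congrArg Subtype.val h
  revert h
  simp only [Subgroup.coe_mul]
  decide

/-! ### Permutation groups -/

/-- A permutation group in which only the identity has fixed points. -/
def IsFreeGroup {X : Type u} (G : Subgroup (Equiv.Perm X)) : Prop :=
  ∀ g ∈ G, ∀ x, g x = x → g = 1

/-- A permutation group with only one orbit. -/
def IsTransitiveGroup {X : Type u} (G : Subgroup (Equiv.Perm X)) : Prop :=
  ∀ x y : X, ∃ g ∈ G, g x = y

/-- Evaluation at a point is a bijection from the group to the domain: freeness makes it injective
and transitivity surjective. -/
theorem isRegularGroup_of_free_of_transitive {X : Type u} [Nonempty X]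
    {G : Subgroup (Equiv.Perm X)} (hf : IsFreeGroup G) (ht : IsTransitiveGroup G) :
    IsRegularGroup G := by
  refine ⟨ht, ?_⟩
  obtain ⟨x⟩ := ‹Nonempty X›
  refine Nat.card_congr (Equiv.ofBijective (fun g : G => g.1 x) ⟨?_, fun y => ?_⟩)
  · intro g h e
    have e : g.1 x = h.1 x := e
    have := hf (h.1⁻¹ * g.1) (mul_mem (inv_mem h.2) g.2) x (by
      rw [Equiv.Perm.mul_apply, e, perm_inv_apply])
    exact Subtype.ext (inv_mul_eq_one.1 this).symm
  · obtain ⟨g, hg, e⟩ := ht x y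
    exact ⟨⟨g, hg⟩, e⟩

/-- Two permutation groups are equal up to a renaming of the points. -/
def PermIso {X Y : Type u} (G : Subgroup (Equiv.Perm X)) (G' : Subgroup (Equiv.Perm Y)) : Prop :=
  ∃ φ : X ≃ Y, ∀ σ, φ.permCongr σ ∈ G' ↔ σ ∈ G

namespace PermIso

variable {X Y : Type u} {G : Subgroup (Equiv.Perm X)} {G' : Subgroup (Equiv.Perm Y)}

theorem mulEquiv (h : PermIso G G') : Nonempty (G ≃* G') := by
  obtain ⟨φ, h⟩ := h
  exact ⟨{ toFun := fun σ => ⟨φ.permCongr σ, (h σ).2 σ.2⟩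
           invFun := fun τ => ⟨φ.permCongr.symm τ, (h _).1 (by
             rw [Equiv.apply_symm_apply]; exact τ.2)⟩
           left_inv := fun σ => Subtype.ext (φ.permCongr.symm_apply_apply _)
           right_inv := fun τ => Subtype.ext (φ.permCongr.apply_symm_apply _)
           map_mul' := fun σ τ => Subtype.ext (by ext; simp) }⟩

theorem free (h : PermIso G G') (hG : IsFreeGroup G) : IsFreeGroup G' := by
  obtain ⟨φ, h⟩ := h
  intro g hg x hx
  obtain ⟨σ, rfl⟩ := φ.permCongr.surjective g
  have := hG σ ((h σ).1 hg) (φ.symm x) (φ.injective (by simpa using hx))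
  subst this
  ext; simp

theorem transitive (h : PermIso G G') (hG : IsTransitiveGroup G) : IsTransitiveGroup G' := by
  obtain ⟨φ, h⟩ := h
  intro x y
  obtain ⟨g, hg, e⟩ := hG (φ.symm x) (φ.symm y)
  exact ⟨φ.permCongr g, (h g).2 hg, by simp [e]⟩

theorem isCyclicOrDihedral [Finite X] (h : PermIso G G') (hG : IsCyclicOrDihedral G) :
    IsCyclicOrDihedral G' := by
  obtain ⟨e⟩ := h.mulEquiv
  exact hG.of_surjective e.toMonoidHom e.surjective

theorem commOrNotFour (h : PermIso G G') (hG : CommOrNotFour G) : CommOrNotFour G' := by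
  obtain ⟨e⟩ := h.mulEquiv
  exact hG.of_surjective e.toMonoidHom e.surjective

end PermIso

/-- An injective self-map of a finite set is onto. Thus only one direction of each automorphism
condition has to be checked, here and in the version for tuples. -/
theorem perm_mem_iff {X : Type u} [Finite X] {σ : Equiv.Perm X} {A : Set X}
    (h : ∀ x ∈ A, σ x ∈ A) (x : X) : σ x ∈ A ↔ x ∈ A := by
  refine ⟨fun hx => ?_, h x⟩
  let f : A → A := fun y => ⟨σ y, h _ y.2⟩
  have hf : Function.Injective f := fun y z e => Subtype.ext (σ.injective (congrArg Subtype.val e))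
  obtain ⟨y, hy⟩ := Finite.surjective_of_injective hf ⟨_, hx⟩
  exact σ.injective (congrArg Subtype.val hy) ▸ y.2

theorem perm_tuple_mem_iff {X : Type u} [Finite X] {n : ℕ} {σ : Equiv.Perm X}
    {A : Set (Fin n → X)} (h : ∀ t ∈ A, (fun k => σ (t k)) ∈ A) (t : Fin n → X) :
    (fun k => σ (t k)) ∈ A ↔ t ∈ A :=
  perm_mem_iff (σ := Equiv.piCongrRight fun _ => σ) h t

theorem OrbitSym.mem_orb {X : Type u} {G : Subgroup (Equiv.Perm X)} (o : OrbitSym G)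
    {g : Equiv.Perm X} (hg : g ∈ G) {t : Fin o.n → X} (ht : t ∈ o.orb) :
    (fun k => g (t k)) ∈ o.orb := by
  obtain ⟨s, hs⟩ := o.isOrbit
  rw [hs] at ht ⊢
  obtain ⟨g', hg', rfl⟩ := ht
  exact ⟨g * g', mul_mem hg hg', rfl⟩

/-- Take a tuple that lists all points. Its image under τ lies in its G-orbit only if τ agrees
everywhere with an element of G. So adding the orbit relations prescribes the group of a new color
class exactly. -/
theorem mem_of_forall_orbitSym {X : Type u} [Finite X] [Nonempty X] {G : Subgroup (Equiv.Perm X)}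
    {τ : Equiv.Perm X} (h : ∀ o : OrbitSym G, ∀ t ∈ o.orb, (fun k => τ (t k)) ∈ o.orb) :
    τ ∈ G := by
  let t : Fin (Nat.card X) → X := (Finite.equivFin X).symm
  obtain ⟨g, hg, e⟩ := h ⟨Nat.card X, Nat.card_pos, .inr rfl, _, t, rfl⟩ t
    ⟨1, one_mem _, rfl⟩
  have : τ = g := by
    ext x
    have := congrFun e (Finite.equivFin X x)
    simpa [t] using this
  rwa [this]

/-! ### Total preorders -/

namespace TotalPreorder

variable {V : Type u} (P : TotalPreorder V)

theorem Eqv.symm {P : TotalPreorder V} {v w : V} (h : P.Eqv v w) : P.Eqv w v := ⟨h.2, h.1⟩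

theorem Eqv.trans {P : TotalPreorder V} {v w x : V} (h : P.Eqv v w) (h' : P.Eqv w x) :
    P.Eqv v x := ⟨P.trans _ _ _ h.1 h'.1, P.trans _ _ _ h'.2 h.2⟩

theorem le_iff_of_eqv {P : TotalPreorder V} {v w v' w' : V} (h : P.Eqv v v') (h' : P.Eqv w w') :
    P.le v' w' ↔ P.le v w :=
  ⟨fun e => P.trans _ _ _ (P.trans _ _ _ h.1 e) h'.2,
    fun e => P.trans _ _ _ (P.trans _ _ _ h.2 e) h'.1⟩

/-- Comparing v with σ v and moving along the finite cycle of v, the inequality propagates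
monotonically back to v, so both inequalities hold. -/
theorem eqv_apply [Finite V] {σ : Equiv.Perm V} (h : ∀ v w, P.le (σ v) (σ w) ↔ P.le v w) (v : V) :
    P.Eqv v (σ v) := by
  obtain ⟨n, hn, e⟩ := isOfFinOrder_iff_pow_eq_one.1 (isOfFinOrder_of_finite σ)
  have hle (k : ℕ) (v w) : P.le ((σ ^ k) v) ((σ ^ k) w) ↔ P.le v w := by
    induction k generalizing v w with
    | zero => rfl
    | succ k ih => rw [pow_succ, Equiv.Perm.mul_apply, Equiv.Perm.mul_apply, ih, h]
  obtain ⟨m, rfl⟩ := Nat.exists_eq_succ_of_ne_zero hn.ne'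
  have hv : (σ ^ m) (σ v) = v := by
    rw [← Equiv.Perm.mul_apply, ← pow_succ, e, Equiv.Perm.one_apply]
  rcases P.total v (σ v) with h1 | h1
  · refine ⟨h1, ?_⟩
    have (k : ℕ) : P.le (σ v) ((σ ^ k) (σ v)) := by
      induction k with
      | zero => exact (P.eqv_refl _).1
      | succ k ih =>
        refine P.trans _ _ _ ih ?_
        rw [pow_succ, Equiv.Perm.mul_apply, hle, h]
        exact h1
    simpa [hv] using this m
  · refine ⟨?_, h1⟩
    have (k : ℕ) : P.le ((σ ^ k) (σ v)) (σ v) := by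
      induction k with
      | zero => exact (P.eqv_refl _).1
      | succ k ih =>
        refine P.trans _ _ _ ?_ ih
        rw [pow_succ, Equiv.Perm.mul_apply, hle, h]
        exact h1
    simpa [hv] using this m

/-- A union of equivalence classes. -/
def Closed (S : Set V) : Prop := ∀ v w, P.Eqv v w → v ∈ S → w ∈ S

/-- A well-order on the values is pulled back along f. -/
theorem exists_of_function {Y : Type u} (f : V → Y) :
    ∃ P : TotalPreorder V, ∀ v w, P.Eqv v w ↔ f v = f w := by
  let L : LinearOrder Y := IsWellOrder.linearOrder WellOrderingRel
  exact ⟨⟨fun v w => f v ≤ f w, fun _ _ => le_total _ _, fun _ _ _ => le_trans⟩,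
    fun v w => ⟨fun h => le_antisymm h.1 h.2, fun h => ⟨h.le, h.ge⟩⟩⟩

/-- The lexicographic combination: first P, and then an order on the values of f to break ties. -/
theorem exists_refinement (P : TotalPreorder V) {Y : Type u} (f : V → Y) :
    ∃ Q : TotalPreorder V, (∀ v w, Q.le v w → P.le v w) ∧
      ∀ v w, Q.Eqv v w ↔ P.Eqv v w ∧ f v = f w := by
  obtain ⟨L, hL⟩ := exists_of_function f
  refine ⟨⟨fun v w => P.le v w ∧ (P.le w v → L.le v w), fun v w => ?_, fun v w x h h' => ?_⟩,
    fun v w h => h.1, fun v w => ?_⟩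
  · have h1 := P.total v w
    have h2 := L.total v w
    tauto
  · refine ⟨P.trans _ _ _ h.1 h'.1, fun e => L.trans _ _ _ (h.2 ?_) (h'.2 ?_)⟩
    · exact P.trans _ _ _ h'.1 e
    · exact P.trans _ _ _ e h.1
  · rw [← hL]
    simp only [Eqv]
    tauto

end TotalPreorder

/-! ### Color classes and partial automorphisms -/

namespace RelStr

variable {V : Type u} (H : RelStr V)

/-- The color class of a vertex. -/
def vcls (v : V) : H.ColorClass := ⟨H.cls v, v, rfl⟩

theorem mem_vcls (v : V) : v ∈ (H.vcls v).1 := H.ord.eqv_refl v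

theorem vcls_eq_iff {v w : V} : H.vcls v = H.vcls w ↔ H.ord.Eqv v w := by
  refine ⟨fun h => ?_, fun h => Subtype.ext (Set.ext fun x => ⟨fun h' => ?_, fun h' => ?_⟩)⟩
  · have : w ∈ (H.vcls v).1 := h ▸ H.mem_vcls w
    exact this
  · exact h.symm.trans h'
  · exact h.trans h'

theorem eq_vcls_of_mem {C : H.ColorClass} {v : V} (h : v ∈ C.1) : C = H.vcls v := by
  obtain ⟨_, w, rfl⟩ := C
  exact (H.vcls_eq_iff (v := w)).2 h

theorem mem_iff_vcls_eq {C : H.ColorClass} {v : V} : v ∈ C.1 ↔ H.vcls v = C :=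
  ⟨fun h => (H.eq_vcls_of_mem h).symm, fun h => h ▸ H.mem_vcls v⟩

theorem eqv_of_mem {C : H.ColorClass} {v w : V} (h : v ∈ C.1) (h' : w ∈ C.1) : H.ord.Eqv v w :=
  H.vcls_eq_iff.1 ((H.eq_vcls_of_mem h).symm.trans (H.eq_vcls_of_mem h'))

theorem mem_of_eqv {C : H.ColorClass} {v w : V} (h : v ∈ C.1) (h' : H.ord.Eqv v w) : w ∈ C.1 := by
  rw [H.mem_iff_vcls_eq] at *
  rw [← h, ← H.vcls_eq_iff.2 h']

theorem colorClass_nonempty (C : H.ColorClass) : Nonempty C.1 := by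
  obtain ⟨_, w, rfl⟩ := C
  exact ⟨w, H.ord.eqv_refl w⟩

variable {H}

/-- The condition on the preorder is automatic, since all vertices of a color class are equivalent.
-/
theorem mem_colorAut {C : H.ColorClass} {τ : Equiv.Perm C.1} :
    τ ∈ H.colorAut C ↔ ∀ R (t : Fin (H.arity R) → C.1),
      (fun k => (τ (t k) : V)) ∈ H.rel R ↔ (fun k => (t k : V)) ∈ H.rel R :=
  ⟨fun h => h.1, fun h => ⟨h, fun v w => H.ord.le_iff_of_eqv
    (H.eqv_of_mem v.2 (τ v).2) (H.eqv_of_mem w.2 (τ w).2)⟩⟩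

theorem mem_colorAut_of [Finite V] {C : H.ColorClass} {τ : Equiv.Perm C.1}
    (h : ∀ R (t : Fin (H.arity R) → C.1), (fun k => (t k : V)) ∈ H.rel R →
      (fun k => (τ (t k) : V)) ∈ H.rel R) : τ ∈ H.colorAut C :=
  mem_colorAut.2 fun R t => perm_tuple_mem_iff (σ := τ)
    (A := {t : Fin (H.arity R) → C.1 | (fun k => (t k : V)) ∈ H.rel R}) (h R) t

variable (H)

/-- `σ` preserves all color classes, and all relations inside the set `S`. -/
def IsLoc (S : Set V) (σ : Equiv.Perm V) : Prop :=
  (∀ v, H.ord.Eqv v (σ v)) ∧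
    ∀ R, ∀ t ∈ H.rel R, (∀ k, t k ∈ S) → (fun k => σ (t k)) ∈ H.rel R

variable {H}

namespace IsLoc

variable {S : Set V} {σ : Equiv.Perm V}

theorem mono (h : H.IsLoc S σ) {S' : Set V} (hS : S' ⊆ S) : H.IsLoc S' σ :=
  ⟨h.1, fun R t ht hk => h.2 R t ht fun k => hS (hk k)⟩

theorem mem_iff (h : H.IsLoc S σ) (hS : H.ord.Closed S) (v : V) : σ v ∈ S ↔ v ∈ S :=
  ⟨hS _ _ (h.1 v).symm, hS _ _ (h.1 v)⟩

theorem exists_induce [Finite V] (h : H.IsLoc S σ) (hS : H.ord.Closed S) :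
    ∃ τ ∈ (H.induce S).autGroup, ∀ v : S, (τ v : V) = σ v := by
  refine ⟨σ.subtypePerm (h.mem_iff hS), ⟨fun R t => ?_, fun v w => ?_⟩, fun v => rfl⟩
  · exact perm_tuple_mem_iff (σ := σ.subtypePerm (h.mem_iff hS))
      (A := {t | (fun k => (t k : V)) ∈ H.rel R}) (fun t ht => h.2 R _ ht fun k => (t k).2) t
  · exact H.ord.le_iff_of_eqv (h.1 v) (h.1 w)

end IsLoc

/-- Extension by the identity outside S. Together with `IsLoc.exists_induce` this replaces
automorphisms of induced substructures by permutations of the whole universe, which are easier to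
transport through the constructions. -/
theorem exists_isLoc [Finite V] {S : Set V} {τ : Equiv.Perm S}
    (hτ : τ ∈ (H.induce S).autGroup) : ∃ σ, H.IsLoc S σ ∧ ∀ v : S, σ v = τ v := by
  classical
  refine ⟨Equiv.Perm.ofSubtype τ, ⟨fun v => ?_, fun R t ht hk => ?_⟩,
    fun v => Equiv.Perm.ofSubtype_apply_coe τ v⟩
  · by_cases hv : v ∈ S
    · rw [Equiv.Perm.ofSubtype_apply_of_mem τ hv]
      exact (H.ord.induce S).eqv_apply hτ.2 ⟨v, hv⟩
    · rw [Equiv.Perm.ofSubtype_apply_of_not_mem τ hv]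
      exact H.ord.eqv_refl v
  · have := (hτ.1 R fun k => ⟨t k, hk k⟩).2 ht
    simp only [Equiv.Perm.ofSubtype_apply_of_mem τ (hk _)]
    exact this

theorem closed_colorClass (C : H.ColorClass) : H.ord.Closed C.1 :=
  fun _ _ h hv => H.mem_of_eqv hv h

theorem exists_isLoc_of_mem_colorAut [Finite V] {C : H.ColorClass} {τ : Equiv.Perm C.1}
    (hτ : τ ∈ H.colorAut C) : ∃ σ, H.IsLoc C.1 σ ∧ ∀ v : C.1, σ v = τ v :=
  exists_isLoc hτ

theorem closed_unionOf (I : Set H.ColorClass) : H.ord.Closed (H.unionOf I) :=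
  fun _ _ h ⟨C, hC, hv⟩ => ⟨C, hC, H.mem_of_eqv hv h⟩

/-! ### Refinement passes -/

/-- Every color class that meets a relation of arity three has a commutative group or one of order
not divisible by four. -/
def TernaryGood (H : RelStr V) : Prop :=
  ∀ R, H.arity R = 3 → ∀ t ∈ H.rel R, ∀ k, CommOrNotFour (H.colorAut (H.vcls (t k)))

theorem closed_saturation (D : Set V) : H.ord.Closed (H.saturation D) :=
  fun _ _ h ⟨d, hd, h'⟩ => ⟨d, hd, h'.trans h⟩

theorem mem_restrictAut_iff [Finite V] {D : Set V} {τ : Equiv.Perm D} :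
    τ ∈ H.restrictAut D ↔ ∃ σ, H.IsLoc (H.saturation D) σ ∧ ∀ d : D, σ d = τ d := by
  constructor
  · rintro ⟨ρ, hρ, h⟩
    obtain ⟨σ, hσ, e⟩ := exists_isLoc hρ
    exact ⟨σ, hσ, fun d => (e _).trans (h d)⟩
  · rintro ⟨σ, hσ, h⟩
    obtain ⟨ρ, hρ, e⟩ := hσ.exists_induce (closed_saturation D)
    exact ⟨ρ, hρ, fun d => (e _).trans (h d)⟩

variable {P : TotalPreorder V}

theorem eqv_of_le (hP : ∀ v w, P.le v w → H.ord.le v w) {v w : V} (h : P.Eqv v w) :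
    H.ord.Eqv v w := ⟨hP _ _ h.1, hP _ _ h.2⟩

theorem saturation_class (hP : ∀ v w, P.le v w → H.ord.le v w) (v : V) :
    H.saturation ((H.refine P).cls v) = H.cls v :=
  Set.ext fun _ => ⟨fun ⟨_, hd, h⟩ => (eqv_of_le hP hd).trans h, fun h => ⟨v, P.eqv_refl v, h⟩⟩

/-- On an unsplit class nothing changes, because it equals its saturation. On a split class the old
relations give no upper bound on the group, but the added orbit relations do; and restrictions of
automorphisms of the old class preserve both kinds of relations. -/
theorem colorAut_refine [Finite V] (hP : ∀ v w, P.le v w → H.ord.le v w)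
    (D : (H.refine P).ColorClass) : (H.refine P).colorAut D = H.restrictAut D.1 := by
  ext τ
  constructor
  · intro hτ
    by_cases hD : D.1 = H.saturation D.1
    · obtain ⟨σ, hσ, h⟩ := exists_isLoc_of_mem_colorAut hτ
      exact mem_restrictAut_iff.2 ⟨σ, ⟨fun v => eqv_of_le hP (hσ.1 v),
        fun R t ht hk => hσ.2 (.inl R) t ht (hD ▸ hk)⟩, h⟩
    · have := (H.refine P).colorClass_nonempty D
      refine mem_of_forall_orbitSym fun o t ht => ?_
      obtain ⟨s, hs, e⟩ := (mem_colorAut.1 hτ (.inr ⟨⟨D.1, D.2, hD⟩, o⟩) t).2 ⟨t, ht, rfl⟩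
      have : (fun k => τ (t k)) = s := funext fun k => Subtype.ext (congrFun e k)
      exact this ▸ hs
  · intro hτ
    obtain ⟨σ, hσ, h⟩ := mem_restrictAut_iff.1 hτ
    apply mem_colorAut_of
    rintro (R | ⟨D', o⟩) t ht
    · have := hσ.2 R _ ht fun k => H.subset_saturation _ (t k).2
      simp only [h] at this
      exact this
    · obtain ⟨s, hs, e⟩ := ht
      have e0 := congrFun e ⟨0, o.pos⟩
      obtain ⟨D', hD', hne⟩ := D'
      obtain ⟨D, hD⟩ := D
      -- The two tuples share their first entry, which exists by `o.pos`, so the new orbit relation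
      -- belongs to the class under consideration.
      have hDD : D' = D := by
        have h1 : (H.refine P).vcls _ = ⟨D', hD'⟩ :=
          (H.refine P).mem_iff_vcls_eq.1 (s ⟨0, o.pos⟩).2
        have h2 : (H.refine P).vcls _ = ⟨D, hD⟩ :=
          (H.refine P).mem_iff_vcls_eq.1 (t ⟨0, o.pos⟩).2
        exact congrArg Subtype.val (h1.symm.trans ((congrArg _ e0.symm).trans h2))
      subst hDD
      have : t = s := funext fun k => Subtype.ext (congrFun e k)
      subst this
      exact ⟨_, o.mem_orb hτ hs, rfl⟩

theorem exists_colorAut_of_refine [Finite V] (hP : ∀ v w, P.le v w → H.ord.le v w) (v : V)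
    {τ : Equiv.Perm ((H.refine P).vcls v).1} (hτ : τ ∈ (H.refine P).colorAut ((H.refine P).vcls v)) :
    ∃ σ ∈ H.colorAut (H.vcls v), ∀ (d : ((H.refine P).vcls v).1) (hd : d.1 ∈ (H.vcls v).1),
      (σ ⟨d, hd⟩ : V) = τ d := by
  rw [colorAut_refine hP, mem_restrictAut_iff] at hτ
  obtain ⟨σ, hσ, h⟩ := hτ
  rw [show H.saturation ((H.refine P).vcls v).1 = (H.vcls v).1 from saturation_class hP v] at hσ
  obtain ⟨ρ, hρ, e⟩ := hσ.exists_induce (closed_colorClass _)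
  exact ⟨ρ, hρ, fun d hd => (e ⟨d, hd⟩).trans (h d)⟩

/-- Each automorphism of the smaller class extends to the old class, and it can be read off from any
extension. -/
theorem isSection_refine [Finite V] (hP : ∀ v w, P.le v w → H.ord.le v w) (v : V) :
    IsSection ((H.refine P).colorAut ((H.refine P).vcls v)) (H.colorAut (H.vcls v)) := by
  have hsub (d : ((H.refine P).vcls v).1) : d.1 ∈ (H.vcls v).1 := eqv_of_le hP d.2
  refine IsSection.of_rel (fun τ σ => ∀ (d : ((H.refine P).vcls v).1) (hd : d.1 ∈ (H.vcls v).1),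
      (σ.1 ⟨d, hd⟩ : V) = τ.1 d) (fun _ _ => rfl)
    (fun τ σ τ' σ' h h' d hd => ?_) (fun τ σ h d hd => ?_) (fun τ => ?_) (fun τ h => ?_)
  · have e : σ'.1 ⟨d, hd⟩ = ⟨τ'.1 d, hsub _⟩ := Subtype.ext (h' d hd)
    rw [Subgroup.coe_mul, Subgroup.coe_mul, Equiv.Perm.mul_apply, Equiv.Perm.mul_apply, e, h]
  · have e := h (τ.1⁻¹ d) (hsub _)
    rw [perm_apply_inv] at e
    have e : σ.1 ⟨(τ.1⁻¹ d : V), hsub _⟩ = ⟨d, hd⟩ := Subtype.ext e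
    rw [Subgroup.coe_inv, Subgroup.coe_inv, ← e, perm_inv_apply]
  · obtain ⟨σ, hσ, h⟩ := exists_colorAut_of_refine hP v τ.2
    exact ⟨⟨σ, hσ⟩, h⟩
  · exact Subtype.ext (Equiv.ext fun d => Subtype.ext (h d (hsub d)).symm)

/-- A fixed point of an automorphism is also fixed by its extension to the old class, which is
therefore the identity. This is why refining again after the regularization does no harm. -/
theorem isFreeGroup_refine [Finite V] (hP : ∀ v w, P.le v w → H.ord.le v w) (v : V)
    (hf : IsFreeGroup (H.colorAut (H.vcls v))) :
    IsFreeGroup ((H.refine P).colorAut ((H.refine P).vcls v)) := by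
  intro τ hτ d hd
  obtain ⟨σ, hσ, h⟩ := exists_colorAut_of_refine hP v hτ
  have := hf σ hσ ⟨d, eqv_of_le hP d.2⟩ (Subtype.ext ((h d _).trans (congrArg _ hd)))
  subst this
  exact Equiv.ext fun x => Subtype.ext (h x (eqv_of_le hP x.2)).symm

/-- Old ternary relations now meet classes whose groups are sections of the previous ones. A new
relation of arity three can only consist of |D|-tuples with |D| = 3. -/
theorem ternaryGood_refine [Finite V] (hP : ∀ v w, P.le v w → H.ord.le v w) (hH : H.TernaryGood) :
    (H.refine P).TernaryGood := by
  rintro (R | ⟨D, o⟩) hR t ht k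
  · exact (isSection_refine hP (t k)).commOrNotFour (hH R hR t ht k)
  · obtain ⟨s, hs, rfl⟩ := ht
    apply CommOrNotFour.of_perm
    have hR : o.n = 3 := hR
    have e : (⟨D.1, D.2.1⟩ : (H.refine P).ColorClass) = (H.refine P).vcls (s k) :=
      (H.refine P).eq_vcls_of_mem (s k).2
    rw [← e]
    rcases o.size with h | h
    · omega
    · exact h.symm.trans hR

theorem TransitiveRefinement.induction {H H' : RelStr V} (h : H.TransitiveRefinement H')
    (p : RelStr V → Prop) (hp : ∀ (K : RelStr V) (P : TotalPreorder V),
      (∀ v w, P.le v w → K.ord.le v w) → p K → p (K.refine P)) (h0 : p H) : p H' := by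
  obtain ⟨h, -⟩ := h
  induction h with
  | refl => exact h0
  | tail _ h ih =>
    obtain ⟨P, hP, rfl⟩ := h
    exact hp _ P hP.1 ih

/-! ### Existence and use of refinements that are transitive on three color classes -/

theorem sameOrbits_refl (v : V) {s : ℕ} : H.SameOrbits s v v :=
  ⟨H.ord.eqv_refl v, fun _ _ _ _ => ⟨1, one_mem _, rfl⟩⟩

theorem SameOrbits.symm {s : ℕ} {v w : V} (h : H.SameOrbits s v w) : H.SameOrbits s w v := by
  refine ⟨h.1.symm, fun I hI hv hw => ?_⟩
  obtain ⟨σ, hσ, e⟩ := h.2 I hI hw hv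
  exact ⟨σ⁻¹, inv_mem hσ, by rw [← e, perm_inv_apply]⟩

theorem SameOrbits.trans {s : ℕ} {v w x : V} (h : H.SameOrbits s v w) (h' : H.SameOrbits s w x) :
    H.SameOrbits s v x := by
  refine ⟨h.1.trans h'.1, fun I hI hv hx => ?_⟩
  have hw : w ∈ H.unionOf I := closed_unionOf I _ _ h.1 hv
  obtain ⟨σ, hσ, e⟩ := h.2 I hI hv hw
  obtain ⟨σ', hσ', e'⟩ := h'.2 I hI hw hx
  exact ⟨σ' * σ, mul_mem hσ' hσ, by rw [Equiv.Perm.mul_apply, e, e']⟩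

variable (H) in
theorem exists_isOrbitRefinement : ∃ P, H.IsOrbitRefinement P := by
  let s : Setoid V := ⟨H.SameOrbits 3, fun v => sameOrbits_refl v, .symm, .trans⟩
  obtain ⟨P, hP, h⟩ := H.ord.exists_refinement (fun v => Quotient.mk s v)
  refine ⟨P, hP, fun v w => ?_⟩
  rw [h, Quotient.eq]
  exact ⟨fun h => h.2, fun h => ⟨h.1, h⟩⟩

-- The number of equivalent pairs of vertices is the termination measure: it drops strictly in each
-- pass until the structure is transitive.
variable (H) in
theorem exists_transitiveRefinement [Finite V] : ∃ H', H.TransitiveRefinement H' := by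
  induction hn : {x : V × V | H.ord.Eqv x.1 x.2}.ncard using Nat.strong_induction_on generalizing H
    with
  | _ n ih =>
  by_cases h : H.TransitiveOn 3
  · exact ⟨H, .refl, h⟩
  obtain ⟨P, hP⟩ := H.exists_isOrbitRefinement
  have hlt : {x : V × V | (H.refine P).ord.Eqv x.1 x.2}.ncard < n := by
    rw [← hn]
    apply Set.ncard_lt_ncard _ (Set.toFinite _)
    -- If no pair were separated, any two vertices of the same color would lie in the same local
    -- orbits, so the structure would be transitive already.
    refine ⟨fun x hx => eqv_of_le hP.1 hx, fun hsub => h ?_⟩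
    intro I hI C hC v w hv hw
    exact ((hP.2 v w).1 (hsub (a := (v.1, w.1)) (H.eqv_of_mem hv hw))).2 I hI v.2 w.2
  obtain ⟨H', h1, h2⟩ := ih _ hlt (H.refine P) rfl
  exact ⟨H', .head ⟨P, hP, rfl⟩ h1, h2⟩

/-- The three vertices name at most three color classes, and repetitions are allowed. This matters
because several classes of a later structure may lie over the same class here. -/
theorem TransitiveOn.exists_isLoc [Finite V] (h : H.TransitiveOn 3) (f : Fin 3 → V) {v w : V}
    {i : Fin 3} (hv : H.ord.Eqv (f i) v) (hvw : H.ord.Eqv v w) :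
    ∃ σ, H.IsLoc {x | ∃ i, H.ord.Eqv (f i) x} σ ∧ σ v = w := by
  let I : Set H.ColorClass := Set.range fun i => H.vcls (f i)
  have hI : I.encard ≤ (3 : ℕ) := by
    have := Set.encard_image_le (fun i => H.vcls (f i)) Set.univ
    rw [Set.image_univ] at this
    exact this.trans (by simp [Set.encard_univ])
  have hS : H.unionOf I = {x | ∃ i, H.ord.Eqv (f i) x} := by
    ext x
    simp only [unionOf, I, Set.exists_range_iff]
    rfl
  have hv' : v ∈ H.unionOf I := by rw [hS]; exact ⟨i, hv⟩
  have hw' : w ∈ H.unionOf I := by rw [hS]; exact ⟨i, hv.trans hvw⟩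
  obtain ⟨τ, hτ, e⟩ := h I hI (H.vcls (f i)) ⟨i, rfl⟩ ⟨v, hv'⟩ ⟨w, hw'⟩ hv (hv.trans hvw)
  obtain ⟨σ, hσ, e'⟩ := RelStr.exists_isLoc hτ
  rw [hS] at hσ
  exact ⟨σ, hσ, (e' ⟨v, hv'⟩).trans (congrArg Subtype.val e)⟩

theorem TransitiveOn.colorAut [Finite V] (h : H.TransitiveOn 3) (v : V) :
    IsTransitiveGroup (H.colorAut (H.vcls v)) := by
  intro x y
  obtain ⟨σ, hσ, e⟩ := h.exists_isLoc (fun _ => v) (i := 0) x.2 (H.eqv_of_mem x.2 y.2)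
  obtain ⟨τ, hτ, e'⟩ := (hσ.mono (S' := (H.vcls v).1) fun x hx => ⟨0, hx⟩).exists_induce
    (closed_colorClass _)
  exact ⟨τ, hτ, Subtype.ext ((e' x).trans e)⟩

theorem IsLoc.mem_colorAut [Finite V] {S : Set V} {σ : Equiv.Perm V} (h : H.IsLoc S σ)
    {C : H.ColorClass} (hC : C.1 ⊆ S) {τ : Equiv.Perm C.1} (hτ : ∀ x : C.1, (τ x : V) = σ x) :
    τ ∈ H.colorAut C := by
  refine mem_colorAut_of fun R t ht => ?_
  simp only [hτ]
  exact h.2 R _ ht fun k => hC (t k).2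

/-! ### Typed relations -/

section Typed

variable {P : TotalPreorder (V × Fin 3)}

/-- The vertices in a copy of a color class. -/
def typedClassEquiv (hP : H.IsTypedOrder P) (v : V) (p : Fin 3) :
    (H.vcls v).1 ≃ ((H.typed P).vcls (v, p)).1 where
  toFun x := ⟨(x, p), (hP _ _).2 ⟨x.2, rfl⟩⟩
  invFun y := ⟨y.1.1, ((hP _ _).1 y.2).1⟩
  left_inv _ := rfl
  right_inv y := Subtype.ext (Prod.ext rfl ((hP _ _).1 y.2).2)

/-- Acting in the same way on all copies respects the matchings, and splitting respects color
classes, which σ preserves. -/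
theorem IsLoc.typed (hP : H.IsTypedOrder P) {S : Set V} {σ : Equiv.Perm V} (h : H.IsLoc S σ) :
    (H.typed P).IsLoc {x | x.1 ∈ S} (Equiv.prodCongr σ (Equiv.refl _)) := by
  refine ⟨fun x => (hP _ _).2 ⟨h.1 _, rfl⟩, ?_⟩
  have hmem {C : H.ColorClass} {v : V} (hv : v ∈ C.1) : σ v ∈ C.1 := H.mem_of_eqv hv (h.1 v)
  rintro (⟨C, p⟩ | ⟨C, p, R⟩ | ⟨R, hR, T⟩) x hx hk
  · obtain ⟨v, hv, rfl⟩ := hx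
    refine ⟨σ v, hmem hv, funext fun k => ?_⟩
    change Fin 2 at k
    fin_cases k <;> rfl
  · obtain ⟨t, ht, hC, rfl⟩ := hx
    exact ⟨fun k => σ (t k), h.2 R t ht hk, fun k => hmem (hC k), rfl⟩
  · obtain ⟨t, ht, hC, rfl⟩ := hx
    exact ⟨fun k => σ (t k), h.2 R t ht hk, fun k => hmem (hC k), rfl⟩

/-- The copied inside relations leave no room for new automorphisms; conversely, each old one acts
on the copies. -/
theorem permIso_typed [Finite V] (hP : H.IsTypedOrder P) (v : V) (p : Fin 3) :
    PermIso (H.colorAut (H.vcls v)) ((H.typed P).colorAut ((H.typed P).vcls (v, p))) := by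
  refine ⟨typedClassEquiv hP v p, fun σ => ⟨fun h => ?_, fun h => ?_⟩⟩
  · refine mem_colorAut_of fun R t ht => ?_
    obtain ⟨t', ht', -, e⟩ := (RelStr.mem_colorAut.1 h (.inside (H.vcls v) p R)
      fun k => typedClassEquiv hP v p (t k)).2 ⟨_, ht, fun k => (t k).2, rfl⟩
    have : (fun k => (σ (t k) : V)) = t' := funext fun k => by
      have := congrArg Prod.fst (congrFun e k)
      rw [Equiv.permCongr_apply, Equiv.symm_apply_apply] at this
      exact this
    rw [this]
    exact ht'
  · obtain ⟨σ', hσ', e⟩ := exists_isLoc_of_mem_colorAut h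
    refine (hσ'.typed hP).mem_colorAut (C := (H.typed P).vcls (v, p))
      (fun x hx => ((hP (v, p) x).1 hx).1) fun x => ?_
    obtain ⟨y, rfl⟩ := (typedClassEquiv hP v p).surjective x
    rw [Equiv.permCongr_apply, Equiv.symm_apply_apply]
    exact Prod.ext (e y).symm rfl

theorem ternaryGood_typed [Finite V] (hP : H.IsTypedOrder P) (hH : H.TernaryGood) :
    (H.typed P).TernaryGood := by
  rintro (⟨C, p⟩ | ⟨C, p, R⟩ | ⟨R, hR, T⟩) h3 x hx k
  · exact absurd h3 (by change ¬ 2 = 3; decide)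
  · obtain ⟨t, ht, hC, rfl⟩ := hx
    exact (permIso_typed hP (t k) p).commOrNotFour (hH R h3 t ht k)
  · obtain ⟨t, ht, hC, rfl⟩ := hx
    exact (permIso_typed hP (t k) _).commOrNotFour (hH R h3 t ht k)

/-- Distinct positions of a tuple are placed in distinct copies, so the classes of a matching or
split tuple differ even when the original entries had the same color. -/
theorem typedRelations_typed (hP : H.IsTypedOrder P) : (H.typed P).TypedRelations := by
  have hin {C : H.ColorClass} {v w : V} (hv : v ∈ C.1) (hw : w ∈ C.1) (p : Fin 3) :
      (v, p) ∈ ((H.typed P).vcls (w, p)).1 := (hP _ _).2 ⟨H.eqv_of_mem hw hv, rfl⟩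
  have hsnd {x y : V × Fin 3} (h : (H.typed P).vcls x = (H.typed P).vcls y) : x.2 = y.2 :=
    ((hP _ _).1 ((H.typed P).vcls_eq_iff.1 h)).2
  rintro (⟨C, p⟩ | ⟨C, p, R⟩ | ⟨R, hR, T⟩)
  · right
    obtain ⟨c, hc⟩ := H.colorClass_nonempty C
    let T : Fin 2 → (H.typed P).ColorClass := ![(H.typed P).vcls (c, p.castSucc),
      (H.typed P).vcls (c, p.succ)]
    refine ⟨T, fun k k' h => ?_, ?_⟩
    · change Fin 2 at k k'
      have hne : p.castSucc ≠ p.succ := Fin.castSucc_lt_succ.ne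
      fin_cases k <;> fin_cases k' <;> first | rfl | exact absurd (hsnd h) hne |
        exact absurd (hsnd h).symm hne
    · rintro _ ⟨v, hv, rfl⟩ k
      change Fin 2 at k
      fin_cases k
      · exact hin hv hc _
      · exact hin hv hc _
  · left
    rintro _ ⟨t, ht, hC, rfl⟩ _ ⟨t', ht', hC', rfl⟩ k k'
    exact (hP _ _).2 ⟨H.eqv_of_mem (hC _) (hC' _), rfl⟩
  · right
    have hne (k) : ∃ c, c ∈ (T k).1 := let ⟨c⟩ := H.colorClass_nonempty (T k); ⟨c.1, c.2⟩
    choose c hc using hne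
    refine ⟨fun k => (H.typed P).vcls (c k, Fin.castLE hR k), fun k k' h => ?_, ?_⟩
    · exact Fin.castLE_injective hR (hsnd h)
    · rintro _ ⟨t, ht, hC, rfl⟩ k
      exact hin (hC k) (hc k) _

end Typed

/-! ### Regular color classes -/

section Regular

variable {b : H.BaseChoice} {P : TotalPreorder (Σ C, H.BaseOrbit b C)}

-- A tuple that lists the whole class has trivial pointwise stabilizer.
variable (H) in
theorem nonempty_baseChoice [Finite V] : Nonempty H.BaseChoice := by
  have h (C : H.ColorClass) : ∃ n : ℕ, ∃ f : Fin (n + 1) → C.1, Function.Surjective f := by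
    have := H.colorClass_nonempty C
    obtain ⟨n, hn⟩ := Nat.exists_eq_succ_of_ne_zero (Nat.card_pos (α := C.1)).ne'
    exact ⟨n, _, (Finite.equivFinOfCardEq hn).symm.surjective⟩
  choose n f hf using h
  refine ⟨⟨n, f, fun C σ _ h => Equiv.ext fun x => ?_⟩⟩
  obtain ⟨k, rfl⟩ := hf C x
  exact h k

instance [Finite V] (C : H.ColorClass) : Finite (H.BaseOrbit b C) := by
  unfold BaseOrbit; infer_instance

theorem nonempty_baseOrbit (C : H.ColorClass) : Nonempty (H.BaseOrbit b C) :=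
  ⟨⟨b.pt C, 1, one_mem _, rfl⟩⟩

/-- Every tuple of the orbit is a translate of the base, so its pointwise stabilizer is conjugate to
a trivial one. -/
theorem eq_one_of_fix {C : H.ColorClass} {σ : Equiv.Perm C.1} (hσ : σ ∈ H.colorAut C)
    (x : H.BaseOrbit b C) (h : (fun k => σ (x.1 k)) = x.1) : σ = 1 := by
  obtain ⟨_, ρ, hρ, rfl⟩ := x
  have := b.isBase C (ρ⁻¹ * (σ * ρ)) (mul_mem (inv_mem hρ) (mul_mem hσ hρ)) fun k => by
    have := congrFun h k
    rw [Equiv.Perm.mul_apply, Equiv.Perm.mul_apply, this, perm_inv_apply]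
  rwa [inv_mul_eq_one, eq_comm, mul_eq_right] at this

theorem isFreeGroup_orbitAction (C : H.ColorClass) : IsFreeGroup (H.orbitAction b C) := by
  rintro τ ⟨σ, hσ, h⟩ x hx
  have : σ = 1 := eq_one_of_fix hσ x (by rw [← h x, hx])
  subst this
  exact Equiv.ext fun y => Subtype.ext (h y)

theorem isSection_orbitAction (C : H.ColorClass) :
    IsSection (H.orbitAction b C) (H.colorAut C) := by
  refine IsSection.of_rel (fun τ σ => ∀ x, (τ.1 x).1 = fun k => σ.1 (x.1 k)) (fun _ => rfl)
    (fun τ σ τ' σ' h h' x => ?_) (fun τ σ h x => ?_) (fun τ => ?_) (fun τ h => ?_)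
  · rw [Subgroup.coe_mul, Equiv.Perm.mul_apply, h, h']
    rfl
  · have e := h (τ.1⁻¹ x)
    rw [perm_apply_inv] at e
    rw [e]
    exact funext fun k => (perm_inv_apply σ.1 _).symm
  · obtain ⟨σ, hσ, h⟩ := τ.2
    exact ⟨⟨σ, hσ⟩, h⟩
  · exact Subtype.ext (Equiv.ext fun y => Subtype.ext (h y))

/-- The vertices of a regular color class. -/
noncomputable def regularClassEquiv (hP : H.IsRegularOrder b P) (C : H.ColorClass) (x : H.BaseOrbit b C) :
    H.BaseOrbit b C ≃ ((H.regular b P).vcls ⟨C, x⟩).1 :=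
  Equiv.ofBijective (fun y => ⟨⟨C, y⟩, (hP _ _).2 rfl⟩) ⟨fun y y' h => by
    simpa using congrArg Subtype.val h, fun ⟨⟨C', y⟩, hy⟩ => by
      obtain rfl : C = C' := (hP _ _).1 hy
      exact ⟨y, rfl⟩⟩

/-- The orbit relations force every automorphism into the induced group. Conversely, the induced
permutations respect the other relations because these depend only on first entries, on which the
group acts as it does on C. -/
theorem permIso_regular [Finite V] (hP : H.IsRegularOrder b P) (C : H.ColorClass)
    (x : H.BaseOrbit b C) :
    PermIso (H.orbitAction b C) ((H.regular b P).colorAut ((H.regular b P).vcls ⟨C, x⟩)) := by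
  refine ⟨regularClassEquiv hP C x, fun τ => ⟨fun h => ?_, fun h => ?_⟩⟩
  · have := nonempty_baseOrbit (b := b) C
    refine mem_of_forall_orbitSym fun o t ht => ?_
    obtain ⟨s, hs, e⟩ := (mem_colorAut.1 h (.orbit C o)
      fun k => regularClassEquiv hP C x (t k)).2 ⟨_, ht, rfl⟩
    have : (fun k => τ (t k)) = s := funext fun k => by
      have := congrFun e k
      rw [Equiv.permCongr_apply, Equiv.symm_apply_apply] at this
      have this : (⟨C, τ (t k)⟩ : Σ C, H.BaseOrbit b C) = ⟨C, s k⟩ := this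
      simpa using this
    rwa [this]
  · have hval (y : H.BaseOrbit b C) : (regularClassEquiv hP C x y).1 = ⟨C, y⟩ := rfl
    refine mem_colorAut_of fun R t ht => ?_
    obtain ⟨z, rfl⟩ : ∃ z : Fin _ → H.BaseOrbit b C, t = fun k => regularClassEquiv hP C x (z k) :=
      ⟨fun k => (regularClassEquiv hP C x).symm (t k), by simp⟩
    simp only [Equiv.permCongr_apply, Equiv.symm_apply_apply, hval] at ht ⊢
    cases R with
    | orbit C' o =>
      obtain ⟨s, hs, e⟩ := ht
      obtain rfl : C = C' := congrArg Sigma.fst (congrFun e ⟨0, o.pos⟩)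
      have : z = s := funext fun k => by simpa using congrFun e k
      subst this
      exact ⟨_, o.mem_orb h hs, rfl⟩
    | first C' =>
      obtain ⟨s, s', hs, e⟩ := ht
      obtain rfl : C = C' := congrArg Sigma.fst (congrFun e (0 : Fin 2))
      have h0 : z (0 : Fin 2) = s := by
        have := congrFun e (0 : Fin 2)
        exact eq_of_heq (Sigma.mk.inj this).2
      have h1 : z (1 : Fin 2) = s' := by
        have := congrFun e (1 : Fin 2)
        exact eq_of_heq (Sigma.mk.inj this).2
      obtain ⟨σ, hσ, hτ⟩ := h
      refine ⟨τ s, τ s', ?_, funext fun k => ?_⟩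
      · rw [hτ, hτ]
        exact congrArg σ hs
      · change Fin 2 at k
        fin_cases k
        · exact congrArg (fun y => (⟨C, τ y⟩ : Σ C, H.BaseOrbit b C)) h0
        · exact congrArg (fun y => (⟨C, τ y⟩ : Σ C, H.BaseOrbit b C)) h1
    | old R =>
      obtain ⟨σ, hσ, hτ⟩ := h
      change (fun k => ((z k).1 0 : V)) ∈ H.rel R at ht
      change (fun k => ((τ (z k)).1 0 : V)) ∈ H.rel R
      simp only [hτ]
      exact (mem_colorAut.1 hσ R fun k => (z k).1 0).2 ht

theorem ternaryGood_regular [Finite V] (hP : H.IsRegularOrder b P) (hH : H.TernaryGood) :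
    (H.regular b P).TernaryGood := by
  intro R h3 x hx k
  cases R with
  | orbit C o =>
    have h3 : o.n = 3 := h3
    obtain ⟨s, hs, rfl⟩ := hx
    apply CommOrNotFour.of_perm
    rw [← Nat.card_congr (regularClassEquiv hP C (s k))]
    rcases o.size with h | h
    · omega
    · exact h.symm.trans h3
  | first C => exact absurd h3 (by change ¬ 2 = 3; decide)
  | old R =>
    refine (permIso_regular hP (x k).1 (x k).2).commOrNotFour
      ((isSection_orbitAction _).commOrNotFour ?_)
    rw [H.eq_vcls_of_mem ((x k).2.1 0).2]
    exact hH R h3 _ hx k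

end Regular

/-! ### Types of ternary relations -/

theorem TripleType.injective (T : H.TripleType) : Function.Injective T.1 := by
  have key {i j : Fin 3} (hij : i < j) : T.1 i ≠ T.1 j := fun h => by
    obtain ⟨c, hc⟩ := H.colorClass_nonempty (T.1 i)
    exact (T.2.1 i j hij c hc c (h ▸ hc)).2 (H.ord.eqv_refl c).1
  intro i j h
  rcases lt_trichotomy i j with hij | hij | hij
  · exact absurd h (key hij)
  · exact hij
  · exact absurd h.symm (key hij)

theorem TripleType.not_homogeneous (T : H.TripleType) {R : H.Sym} {e : Fin (H.arity R) ≃ Fin 3}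
    {v : Fin 3 → V} (hv : ∀ i, v i ∈ (T.1 i).1) (h : H.RelUpToOrder R e v) :
    ¬ H.Homogeneous R := fun hR => by
  have := hR _ h _ h (e.symm 0) (e.symm 1)
  rw [e.apply_symm_apply, e.apply_symm_apply, ← H.vcls_eq_iff, ← H.eq_vcls_of_mem (hv 0),
    ← H.eq_vcls_of_mem (hv 1)] at this
  exact absurd (T.injective this) (by decide)

/-- The order of the positions is determined by the type. -/
theorem TripleType.equiv_unique (hH : H.TypedRelations) (T : H.TripleType) {R : H.Sym}
    {e e' : Fin (H.arity R) ≃ Fin 3} {v v' : Fin 3 → V} (hv : ∀ i, v i ∈ (T.1 i).1)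
    (hv' : ∀ i, v' i ∈ (T.1 i).1) (h : H.RelUpToOrder R e v) (h' : H.RelUpToOrder R e' v') :
    e = e' := by
  obtain ⟨T', -, hT⟩ := (hH R).resolve_left (T.not_homogeneous hv h)
  ext1 k
  apply T.injective
  rw [H.eq_vcls_of_mem (hv (e k)), H.eq_vcls_of_mem (hv' (e' k)),
    ← H.eq_vcls_of_mem (hT _ h k), ← H.eq_vcls_of_mem (hT _ h' k)]

/-- Some relation of type `T` is a bijection between two of the color classes of `T`. -/
def IsLinked (T : H.TripleType) : Prop :=
  ∃ (R : H.Sym) (e : Fin (H.arity R) ≃ Fin 3) (j k : Fin 3), j ≠ k ∧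
    ∃ r : (T.1 j).1 → (T.1 k).1 → Prop, (∀ a, ∃! b, r a b) ∧ (∀ b, ∃! a, r a b) ∧
      ∀ v : (i : Fin 3) → (T.1 i).1,
        H.RelUpToOrder R e (fun i => (v i : V)) ↔ r (v j) (v k)

/-- Restricting a partial automorphism to the three classes gives an element of the product;
relations of type T are preserved because all entries of their tuples lie in S. -/
theorem IsLoc.exists_typeGroup [Finite V] {S : Set V} {σ : Equiv.Perm V} (h : H.IsLoc S σ)
    (T : H.TripleType) (hT : ∀ i, (T.1 i).1 ⊆ S) :
    ∃ g ∈ H.typeGroup T, ∀ i (x : (T.1 i).1), (g i x : V) = σ x := by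
  let g : (i : Fin 3) → Equiv.Perm (T.1 i).1 := fun i =>
    σ.subtypePerm ((h.mono (hT i)).mem_iff (closed_colorClass _))
  refine ⟨g, ⟨fun i => h.mem_colorAut (hT i) fun _ => rfl, fun R e v => ?_⟩, fun _ _ => rfl⟩
  let S' : Set V := {x | ∃ i, x ∈ (T.1 i).1}
  have h' := h.mono (S' := S') fun x ⟨i, hx⟩ => hT i hx
  obtain ⟨τ, hτ, e'⟩ := h'.exists_induce fun x y hxy ⟨i, hx⟩ => ⟨i, H.mem_of_eqv hx hxy⟩
  have : (fun k => (τ ⟨v (e k), e k, (v (e k)).2⟩ : V)) ∈ H.rel R ↔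
    (fun k => (v (e k) : V)) ∈ H.rel R := hτ.1 R fun k => ⟨v (e k), e k, (v (e k)).2⟩
  simp only [e'] at this
  exact this

/-! ### The structure with ternary relations -/

section Ternary

variable {P : TotalPreorder H.WithCopies}

/-- The vertices in an old color class. -/
noncomputable def ternaryClassEquiv (hP : H.IsTernaryOrder P) (v : V) :
    (H.vcls v).1 ≃ ((H.ternary P).vcls (.inl v)).1 :=
  Equiv.ofBijective (fun x => ⟨.inl x, (hP.1 _ _).2 x.2⟩) ⟨fun x x' h => by
    simpa [Subtype.ext_iff] using h, fun ⟨y, hy⟩ => by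
      rcases y with y | y
      · exact ⟨⟨y, (hP.1 _ _).1 hy⟩, rfl⟩
      · exact absurd hy (hP.2.2 _ _)⟩

/-- The vertices in a copy of a color class. -/
noncomputable def ternaryCopyEquiv (hP : H.IsTernaryOrder P) (y : Σ p : H.PairType, p.1.2.1) :
    y.1.1.2.1 ≃ ((H.ternary P).vcls (.inr y)).1 :=
  Equiv.ofBijective (fun x => ⟨.inr ⟨y.1, x⟩, (hP.2.1 _ _).2 rfl⟩) ⟨fun x x' h => by
    simpa [Subtype.ext_iff] using h, fun ⟨z, hz⟩ => by
      rcases z with z | z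
      · exact absurd (TotalPreorder.Eqv.symm hz) (hP.2.2 _ _)
      · obtain ⟨p, w⟩ := y
        obtain ⟨q, z⟩ := z
        obtain rfl : p = q := (hP.2.1 _ _).1 hz
        exact ⟨z, rfl⟩⟩

/-- A class preserving permutation acts also on the copies of color classes. -/
def copyPerm (σ : Equiv.Perm V) (hσ : ∀ v, H.ord.Eqv v (σ v)) : Equiv.Perm H.WithCopies :=
  Equiv.sumCongr σ (Equiv.sigmaCongrRight fun _ => σ.subtypePerm fun v =>
    ⟨fun h => H.mem_of_eqv h (hσ v).symm, fun h => H.mem_of_eqv h (hσ v)⟩)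

/-- Each copy moves along with its original, so the third entry of a triple remains the copy of the
second. -/
theorem IsLoc.ternary (hP : H.IsTernaryOrder P) {S : Set V} {σ : Equiv.Perm V} (h : H.IsLoc S σ) :
    (H.ternary P).IsLoc {x | Sum.elim id (fun y => (y.2 : V)) x ∈ S} (copyPerm σ h.1) := by
  have hmem {C : H.ColorClass} {v : V} (hv : v ∈ C.1) : σ v ∈ C.1 := H.mem_of_eqv hv (h.1 v)
  refine ⟨fun x => ?_, ?_⟩
  · rcases x with x | x
    · exact (hP.1 _ _).2 (h.1 x)
    · exact (hP.2.1 _ _).2 rfl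
  rintro (⟨C, R⟩ | ⟨p, R⟩ | ⟨R, hR⟩ | ⟨p, R, e⟩ | ⟨p⟩) x hx hk
  · obtain ⟨t, ht, hC, rfl⟩ := hx
    exact ⟨fun k => σ (t k), h.2 R t ht hk, fun k => hmem (hC k), rfl⟩
  · obtain ⟨s, hs, rfl⟩ := hx
    exact ⟨fun k => ⟨σ (s k), hmem (s k).2⟩, h.2 R _ hs hk, rfl⟩
  · obtain ⟨t, ht, rfl⟩ := hx
    exact ⟨fun k => σ (t k), h.2 R t ht hk, rfl⟩
  · obtain ⟨v, hv, w, hR, rfl⟩ := hx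
    refine ⟨σ v, hmem hv, ⟨σ w, hmem w.2⟩, ?_, funext fun k => ?_⟩
    · have hvw : ∀ k : Fin 2, ![v, (w : V)] k ∈ S := by
        intro k
        fin_cases k
        · exact hk (0 : Fin 3)
        · exact hk (1 : Fin 3)
      have := h.2 R _ hR fun k => hvw _
      have e' : ∀ k : Fin 2, σ (![v, (w : V)] k) = ![σ v, σ w] k := by
        intro k
        fin_cases k <;> rfl
      simp only [e'] at this
      exact this
    · change Fin 3 at k
      fin_cases k <;> rfl
  · obtain ⟨v, hv, w, rfl⟩ := hx
    refine ⟨σ v, hmem hv, ⟨σ w, hmem w.2⟩, funext fun k => ?_⟩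
    change Fin 3 at k
    fin_cases k <;> rfl

instance [Finite V] : Finite H.WithCopies := by
  unfold WithCopies PairType
  infer_instance

theorem permIso_ternary_inl [Finite V] (hP : H.IsTernaryOrder P) (v : V) :
    PermIso (H.colorAut (H.vcls v)) ((H.ternary P).colorAut ((H.ternary P).vcls (.inl v))) := by
  refine ⟨ternaryClassEquiv hP v, fun σ => ⟨fun h => ?_, fun h => ?_⟩⟩
  · refine mem_colorAut_of fun R t ht => ?_
    obtain ⟨t', ht', -, e⟩ := (RelStr.mem_colorAut.1 h (.inside (H.vcls v) R)
      fun k => ternaryClassEquiv hP v (t k)).2 ⟨_, ht, fun k => (t k).2, rfl⟩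
    have : (fun k => (σ (t k) : V)) = t' := funext fun k => by
      have := congrFun e k
      rw [Equiv.permCongr_apply, Equiv.symm_apply_apply] at this
      exact Sum.inl_injective this
    rw [this]
    exact ht'
  · obtain ⟨σ', hσ', e⟩ := exists_isLoc_of_mem_colorAut h
    refine (hσ'.ternary hP).mem_colorAut (C := (H.ternary P).vcls (.inl v)) (fun x hx => ?_)
      fun x => ?_
    · obtain ⟨y, hy⟩ := (ternaryClassEquiv hP v).surjective ⟨x, hx⟩
      obtain rfl : _ = x := congrArg Subtype.val hy
      exact y.2
    · obtain ⟨y, rfl⟩ := (ternaryClassEquiv hP v).surjective x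
      rw [Equiv.permCongr_apply, Equiv.symm_apply_apply]
      exact congrArg Sum.inl (e y).symm

theorem permIso_ternary_inr [Finite V] (hP : H.IsTernaryOrder P)
    (y : Σ p : H.PairType, p.1.2.1) :
    PermIso (H.colorAut y.1.1.2) ((H.ternary P).colorAut ((H.ternary P).vcls (.inr y))) := by
  refine ⟨ternaryCopyEquiv hP y, fun σ => ⟨fun h => ?_, fun h => ?_⟩⟩
  · refine mem_colorAut_of fun R t ht => ?_
    obtain ⟨t', ht', e⟩ := (RelStr.mem_colorAut.1 h (.insideCopy y.1 R)
      fun k => ternaryCopyEquiv hP y (t k)).2 ⟨_, ht, rfl⟩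
    have : (fun k => σ (t k)) = t' := funext fun k => by
      have := congrFun e k
      rw [Equiv.permCongr_apply, Equiv.symm_apply_apply] at this
      have := Sum.inr_injective this
      exact eq_of_heq (Sigma.mk.inj this).2
    subst this
    exact ht'
  · obtain ⟨σ', hσ', e⟩ := exists_isLoc_of_mem_colorAut h
    refine (hσ'.ternary hP).mem_colorAut (C := (H.ternary P).vcls (.inr y)) (fun x hx => ?_)
      fun x => ?_
    · obtain ⟨z, hz⟩ := (ternaryCopyEquiv hP y).surjective ⟨x, hx⟩
      obtain rfl : _ = x := congrArg Subtype.val hz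
      exact z.2
    · obtain ⟨z, rfl⟩ := (ternaryCopyEquiv hP y).surjective x
      rw [Equiv.permCongr_apply, Equiv.symm_apply_apply]
      refine congrArg Sum.inr (congrArg (Sigma.mk y.1) (Subtype.ext ?_))
      exact (e z).symm

/-- A property of permutation groups that is invariant under renaming passes to the ternary
structure. -/
theorem forall_colorAut_ternary [Finite V] (hP : H.IsTernaryOrder P)
    (p : ∀ {X : Type u}, Subgroup (Equiv.Perm X) → Prop)
    (hp : ∀ {X Y : Type u} [Finite X] {G : Subgroup (Equiv.Perm X)} {G' : Subgroup (Equiv.Perm Y)},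
      PermIso G G' → p G → p G') (h : ∀ C, p (H.colorAut C)) (C : (H.ternary P).ColorClass) :
    p ((H.ternary P).colorAut C) := by
  obtain ⟨x, hx⟩ := (H.ternary P).colorClass_nonempty C
  obtain rfl := (H.ternary P).eq_vcls_of_mem hx
  rcases x with v | y
  · exact hp (permIso_ternary_inl hP v) (h _)
  · exact hp (permIso_ternary_inr hP y) (h _)

theorem homogeneous_ternary_inside (hP : H.IsTernaryOrder P) (C : H.ColorClass) (R : H.Sym) :
    (H.ternary P).Homogeneous (.inside C R) := by
  rintro _ ⟨t, ht, hC, rfl⟩ _ ⟨t', ht', hC', rfl⟩ k k'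
  exact (hP.1 _ _).2 (H.eqv_of_mem (hC _) (hC' _))

theorem homogeneous_ternary_insideCopy (hP : H.IsTernaryOrder P) (p : H.PairType) (R : H.Sym) :
    (H.ternary P).Homogeneous (.insideCopy p R) := by
  rintro _ ⟨t, ht, rfl⟩ _ ⟨t', ht', rfl⟩ k k'
  exact (hP.2.1 _ _).2 rfl

theorem exists_pairType_classes (hP : H.IsTernaryOrder P) (p : H.PairType) :
    ∃ T : Fin 3 → (H.ternary P).ColorClass, Function.Injective T ∧
      ∀ v ∈ p.1.1.1, ∀ w : p.1.2.1, ∀ k,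
        (![Sum.inl v, Sum.inl w, Sum.inr ⟨p, w⟩] : Fin 3 → H.WithCopies) k ∈ (T k).1 := by
  obtain ⟨c, hc⟩ := H.colorClass_nonempty p.1.1
  obtain ⟨d, hd⟩ := H.colorClass_nonempty p.1.2
  have h01 : (H.ternary P).vcls (.inl c) ≠ (H.ternary P).vcls (.inl d) := fun h => by
    rw [vcls_eq_iff] at h
    exact (p.2.1 c hc d hd).2 ((hP.1 _ _).1 h).2
  have h2 (v y) : (H.ternary P).vcls (.inl v) ≠ (H.ternary P).vcls (.inr y) := fun h => by
    rw [vcls_eq_iff] at h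
    exact hP.2.2 _ _ h
  refine ⟨![(H.ternary P).vcls (.inl c), (H.ternary P).vcls (.inl d),
    (H.ternary P).vcls (.inr ⟨p, ⟨d, hd⟩⟩)], fun k k' h => ?_, fun v hv w k => ?_⟩
  · fin_cases k <;> fin_cases k' <;> first
      | rfl
      | exact absurd h h01
      | exact absurd h.symm h01
      | exact absurd h (h2 _ _)
      | exact absurd h.symm (h2 _ _)
  · fin_cases k
    · exact (hP.1 _ _).2 (H.eqv_of_mem hc hv)
    · exact (hP.1 _ _).2 (H.eqv_of_mem hd w.2)
    · exact (hP.2.1 _ _).2 rfl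

theorem typedRelations_ternary (hP : H.IsTernaryOrder P) (hH : H.TypedRelations) :
    (H.ternary P).TypedRelations := by
  rintro (⟨C, R⟩ | ⟨p, R⟩ | ⟨R, hR⟩ | ⟨p, R, e⟩ | ⟨p⟩)
  · exact .inl (homogeneous_ternary_inside hP C R)
  · exact .inl (homogeneous_ternary_insideCopy hP p R)
  · rcases hH R with h | ⟨T, hT, h⟩
    · left
      rintro _ ⟨t, ht, rfl⟩ _ ⟨t', ht', rfl⟩ k k'
      exact (hP.1 _ _).2 (h t ht t' ht' k k')
    · right
      have hne (k) : ∃ c, c ∈ (T k).1 := let ⟨c⟩ := H.colorClass_nonempty (T k); ⟨c.1, c.2⟩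
      choose c hc using hne
      refine ⟨fun k => (H.ternary P).vcls (.inl (c k)), fun k k' e => hT ?_, ?_⟩
      · have e := (hP.1 _ _).1 (((H.ternary P).vcls_eq_iff).1 e)
        rw [H.eq_vcls_of_mem (hc k), H.eq_vcls_of_mem (hc k'), H.vcls_eq_iff]
        exact e
      · rintro _ ⟨t, ht, rfl⟩ k
        exact (hP.1 _ _).2 (H.eqv_of_mem (hc k) (h t ht k))
  · obtain ⟨T, hT, h⟩ := exists_pairType_classes hP p
    refine .inr ⟨T, hT, ?_⟩
    rintro _ ⟨v, hv, w, -, rfl⟩ k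
    exact h v hv w k
  · obtain ⟨T, hT, h⟩ := exists_pairType_classes hP p
    refine .inr ⟨T, hT, ?_⟩
    rintro _ ⟨v, hv, w, rfl⟩ k
    exact h v hv w k

/-- A single triple (a, d, d') shows that the classes of T are C, D and the copy D', up to the
reordering e. The matching relation leaves the entry in C arbitrary, so it imposes only the
bijection between D and D'. -/
theorem isLinked_of_matching (hP : H.IsTernaryOrder P) (T : (H.ternary P).TripleType)
    (p : H.PairType) (e : Fin 3 ≃ Fin 3) {u : Fin 3 → H.WithCopies} (hu : ∀ i, u i ∈ (T.1 i).1)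
    {a : V} (ha : a ∈ p.1.1.1) {d : p.1.2.1}
    (h : (fun k => u (e k)) = ![Sum.inl a, Sum.inl d, Sum.inr ⟨p, d⟩]) :
    (H.ternary P).IsLinked T := by
  have h0 : u (e 0) = Sum.inl a := congrFun h 0
  have h1 : u (e 1) = Sum.inl (d : V) := congrFun h 1
  have h2 : u (e 2) = Sum.inr ⟨p, d⟩ := congrFun h 2
  have c0 {x} (hx : x ∈ (T.1 (e 0)).1) : ∃ v ∈ p.1.1.1, x = Sum.inl v := by
    have hx := (H.ternary P).eqv_of_mem (hu (e 0)) hx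
    rw [h0] at hx
    rcases x with x | x
    · exact ⟨x, H.mem_of_eqv ha ((hP.1 _ _).1 hx), rfl⟩
    · exact absurd hx (hP.2.2 _ _)
  have c1 {x} (hx : x ∈ (T.1 (e 1)).1) : ∃ w : p.1.2.1, x = Sum.inl (w : V) := by
    have hx := (H.ternary P).eqv_of_mem (hu (e 1)) hx
    rw [h1] at hx
    rcases x with x | x
    · exact ⟨⟨x, H.mem_of_eqv d.2 ((hP.1 _ _).1 hx)⟩, rfl⟩
    · exact absurd hx (hP.2.2 _ _)
  have c2 {x} (hx : x ∈ (T.1 (e 2)).1) : ∃ w : p.1.2.1, x = Sum.inr ⟨p, w⟩ := by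
    have hx := (H.ternary P).eqv_of_mem (hu (e 2)) hx
    rw [h2] at hx
    rcases x with x | ⟨q, x⟩
    · exact absurd hx.symm (hP.2.2 _ _)
    · obtain rfl : p = q := (hP.2.1 _ _).1 hx
      exact ⟨x, rfl⟩
  have m1 (w : p.1.2.1) : Sum.inl (w : V) ∈ (T.1 (e 1)).1 := by
    refine (H.ternary P).mem_of_eqv (h1 ▸ hu (e 1)) ((hP.1 _ _).2 (H.eqv_of_mem d.2 w.2))
  have m2 (w : p.1.2.1) : Sum.inr ⟨p, w⟩ ∈ (T.1 (e 2)).1 := by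
    have h := hu (e 2)
    rw [h2] at h
    exact (H.ternary P).mem_of_eqv h ((hP.2.1 _ _).2 rfl)
  -- The linked classes sit at the images under e of the last two positions of a triple.
  refine ⟨.matching p, e, e 1, e 2, fun h => absurd (e.injective h) (by decide),
    fun x y => ∃ w : p.1.2.1, x.1 = Sum.inl (w : V) ∧ y.1 = Sum.inr ⟨p, w⟩,
    fun x => ?_, fun y => ?_, fun v => ?_⟩
  · obtain ⟨w, hw⟩ := c1 x.2
    refine ⟨⟨_, m2 w⟩, ⟨w, hw, rfl⟩, ?_⟩
    rintro y ⟨w', hw', hy⟩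
    rw [hw] at hw'
    obtain rfl : w = w' := Subtype.ext (Sum.inl_injective hw')
    exact Subtype.ext hy
  · obtain ⟨w, hw⟩ := c2 y.2
    refine ⟨⟨_, m1 w⟩, ⟨w, rfl, hw⟩, ?_⟩
    rintro x ⟨w', hx, hw'⟩
    rw [hw] at hw'
    obtain rfl : w = w' := by simpa using hw'
    exact Subtype.ext hx
  · constructor
    · rintro ⟨x, hx, w, h⟩
      exact ⟨w, congrFun h (1 : Fin 3), congrFun h (2 : Fin 3)⟩
    · rintro ⟨w, h1, h2⟩
      obtain ⟨x, hx, h0⟩ := c0 (v (e 0)).2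
      refine ⟨x, hx, w, funext fun k => ?_⟩
      change Fin 3 at k
      fin_cases k
      · exact h0
      · exact h1
      · exact h2

/-- The origin of a relation witnessing the type decides: an old ternary relation yields good
groups, while edge and matching triples yield a link. Inside relations are homogeneous and witness
no type. -/
theorem commOrNotFour_or_isLinked [Finite V] (hP : H.IsTernaryOrder P) (hH : H.TernaryGood)
    (T : (H.ternary P).TripleType) :
    (∀ i, CommOrNotFour ((H.ternary P).colorAut (T.1 i))) ∨ (H.ternary P).IsLinked T := by
  obtain ⟨R, e, u, hu, hR⟩ := T.2.2
  cases R with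
  | inside C R => exact absurd (homogeneous_ternary_inside hP C R) (T.not_homogeneous hu hR)
  | insideCopy p R => exact absurd (homogeneous_ternary_insideCopy hP p R) (T.not_homogeneous hu hR)
  | old R h3 =>
    obtain ⟨t, ht, ht'⟩ := hR
    refine .inl fun i => ?_
    have hi := congrFun ht' (e.symm i)
    rw [e.apply_symm_apply] at hi
    have hi' := hu i
    rw [hi] at hi'
    rw [(H.ternary P).eq_vcls_of_mem hi']
    exact (permIso_ternary_inl hP _).commOrNotFour (hH R h3 t ht _)
  | edge p R e' =>
    obtain ⟨a, ha, d, -, h⟩ := hR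
    exact .inr (isLinked_of_matching hP T p e hu ha h)
  | matching p =>
    obtain ⟨a, ha, d, h⟩ := hR
    exact .inr (isLinked_of_matching hP T p e hu ha h)

end Ternary

/-- The three classes lie over at most three classes of H. Transitivity there provides a partial
automorphism, which is transported through the typed and the ternary structure. The vertices x and y
lie in the same copy, so it suffices to match the underlying vertices. -/
theorem typeGroup_transitive [Finite V] (hH : H.TransitiveOn 3) {P : TotalPreorder (V × Fin 3)}
    (hP : H.IsTypedOrder P) {P' : TotalPreorder (H.typed P).WithCopies}
    (hP' : (H.typed P).IsTernaryOrder P') (T : ((H.typed P).ternary P').TripleType) (i : Fin 3)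
    (x y : (T.1 i).1) : ∃ g ∈ ((H.typed P).ternary P').typeGroup T, g i x = y := by
  -- Forgets both kinds of copies.
  let β : (H.typed P).WithCopies → V := Sum.elim (fun v => v.1) fun y => (y.2 : V × Fin 3).1
  have hβ {x y} (h : P'.Eqv x y) : H.ord.Eqv (β x) (β y) := by
    rcases x with x | ⟨p, x⟩ <;> rcases y with y | ⟨q, y⟩
    · exact ((hP _ _).1 ((hP'.1 _ _).1 h)).1
    · exact absurd h (hP'.2.2 _ _)
    · exact absurd h.symm (hP'.2.2 _ _)
    · obtain rfl : p = q := (hP'.2.1 _ _).1 h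
      exact ((hP _ _).1 ((H.typed P).eqv_of_mem x.2 y.2)).1
  have hne (j) : ∃ u, u ∈ (T.1 j).1 :=
    let ⟨c⟩ := ((H.typed P).ternary P').colorClass_nonempty (T.1 j); ⟨c.1, c.2⟩
  choose u hu using hne
  have hxy := ((H.typed P).ternary P').eqv_of_mem x.2 y.2
  obtain ⟨σ, hσ, e⟩ := hH.exists_isLoc (fun j => β (u j)) (i := i)
    (hβ (((H.typed P).ternary P').eqv_of_mem (hu i) x.2)) (hβ hxy)
  obtain ⟨g, hg, h⟩ := ((hσ.typed hP).ternary hP').exists_typeGroup T fun j z hz => by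
    have := hβ (((H.typed P).ternary P').eqv_of_mem (hu j) hz)
    rcases z with z | z
    · exact ⟨j, this⟩
    · exact ⟨j, this⟩
  refine ⟨g, hg, Subtype.ext ((h i x).trans ?_)⟩
  obtain ⟨x, hx⟩ := x
  obtain ⟨y, hy⟩ := y
  change P'.Eqv x y at hxy
  change σ (β x) = β y at e
  rcases x with x | ⟨p, x⟩ <;> rcases y with y | ⟨q, y⟩
  · exact congrArg Sum.inl (Prod.ext e ((hP _ _).1 ((hP'.1 _ _).1 hxy)).2)
  · exact absurd hxy (hP'.2.2 _ _)
  · exact absurd hxy.symm (hP'.2.2 _ _)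
  · obtain rfl : p = q := (hP'.2.1 _ _).1 hxy
    refine congrArg Sum.inr (congrArg (Sigma.mk p) (Subtype.ext (Prod.ext e ?_)))
    exact ((hP _ _).1 ((H.typed P).eqv_of_mem x.2 y.2)).2

end RelStr

/-- Two permutation groups that act compatibly along a surjection. -/
theorem exists_normal_of_factor {X Y : Type u} {G : Subgroup (Equiv.Perm X)}
    {G' : Subgroup (Equiv.Perm Y)} {f : X → Y} (hf : Function.Surjective f)
    (h : ∀ σ ∈ G, ∃ τ ∈ G', ∀ x, τ (f x) = f (σ x))
    (h' : ∀ τ ∈ G', ∃ σ ∈ G, ∀ x, τ (f x) = f (σ x)) :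
    ∃ (N : Subgroup G) (_ : N.Normal), Nonempty (G' ≃* G ⧸ N) ∧
      ∀ σ : G, σ ∈ N ↔ ∀ x, f (σ.1 x) = f x := by
  choose τ hτ e using h
  let F : G →* G' := MonoidHom.mk' (fun σ => ⟨τ σ.1 σ.2, hτ _ _⟩) fun σ ρ => by
    refine Subtype.ext (Equiv.ext fun y => ?_)
    obtain ⟨x, rfl⟩ := hf y
    exact (e _ (σ * ρ).2 x).trans ((congrArg _ (e ρ.1 ρ.2 x)).trans (e σ.1 σ.2 _)).symm
  have hF : Function.Surjective F := fun ρ => by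
    obtain ⟨σ, hσ, e'⟩ := h' ρ.1 ρ.2
    refine ⟨⟨σ, hσ⟩, Subtype.ext (Equiv.ext fun y => ?_)⟩
    obtain ⟨x, rfl⟩ := hf y
    exact (e σ hσ x).trans (e' x).symm
  refine ⟨F.ker, inferInstance, ⟨(QuotientGroup.quotientKerEquivOfSurjective F hF).symm⟩,
    fun σ => ⟨fun hσ x => ?_, fun hσ => ?_⟩⟩
  · have : τ σ.1 σ.2 = 1 := congrArg Subtype.val (MonoidHom.mem_ker.1 hσ)
    rw [← e σ.1 σ.2, this]
    rfl
  · refine MonoidHom.mem_ker.2 (Subtype.ext (Equiv.ext fun y => ?_))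
    obtain ⟨x, rfl⟩ := hf y
    exact (e σ.1 σ.2 x).trans (hσ x)

namespace RelStr

variable {V : Type u} {H : RelStr V}

/-! ### Quotient color classes -/

theorem mem_typeGroup_of [Finite V] {T : H.TripleType} {σ : (i : Fin 3) → Equiv.Perm (T.1 i).1}
    (h : ∀ i, σ i ∈ H.colorAut (T.1 i))
    (h' : ∀ R (e : Fin (H.arity R) ≃ Fin 3) (v : (i : Fin 3) → (T.1 i).1),
      H.RelUpToOrder R e (fun i => (v i : V)) → H.RelUpToOrder R e (fun i => (σ i (v i) : V))) :
    σ ∈ H.typeGroup T :=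
  ⟨h, fun R e v => perm_mem_iff (σ := Equiv.piCongrRight σ)
    (A := {v | H.RelUpToOrder R e (fun i => (v i : V))}) (h' R e) v⟩

theorem mem_colorAut_of_mem_typeKernel {T : H.TripleType} {i : Fin 3} {n : Equiv.Perm (T.1 i).1}
    (hn : n ∈ H.typeKernel T i) : n ∈ H.colorAut (T.1 i) := by
  have := (show Pi.mulSingle i n ∈ H.typeGroup T from hn).1 i
  rwa [Pi.mulSingle_eq_same] at this

theorem toQuotient_eq_iff {T : H.TripleType} {i : Fin 3} {v w : (T.1 i).1} :
    H.toQuotient T i v = H.toQuotient T i w ↔ ∃ n ∈ H.typeKernel T i, n v = w := by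
  have : H.toQuotient T i v = H.toQuotient T i w ↔
      v ∈ MulAction.orbit (H.typeKernel T i) w := Quotient.eq (r := MulAction.orbitRel _ _)
  rw [this]
  constructor
  · rintro ⟨n, rfl⟩
    exact ⟨n.1⁻¹, inv_mem n.2, perm_inv_apply _ _⟩
  · rintro ⟨n, hn, rfl⟩
    exact ⟨⟨n⁻¹, inv_mem hn⟩, perm_inv_apply _ _⟩

theorem toQuotient_surjective (T : H.TripleType) (i : Fin 3) :
    Function.Surjective (H.toQuotient T i) := Quotient.mk_surjective

instance [Finite V] (T : H.TripleType) (i : Fin 3) : Finite (H.QuotientClass T i) :=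
  Finite.of_surjective _ (toQuotient_surjective T i)

instance (T : H.TripleType) (i : Fin 3) : Nonempty (H.QuotientClass T i) :=
  (H.colorClass_nonempty (T.1 i)).map (H.toQuotient T i)

instance [Finite V] : Finite H.QuotientVertex := by
  unfold QuotientVertex TripleType
  infer_instance

variable (H) in
/-- The color classes are regular, the relations are typed, and local automorphisms of types are
transitive. -/
structure IsRegularTyped : Prop where
  free : ∀ C, IsFreeGroup (H.colorAut C)
  transitive : ∀ C, IsTransitiveGroup (H.colorAut C)
  dihedral : ∀ C, IsCyclicOrDihedral (H.colorAut C)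
  typed : H.TypedRelations
  typeGroup : ∀ (T : H.TripleType) (i : Fin 3) (x y : (T.1 i).1), ∃ g ∈ H.typeGroup T, g i x = y

namespace IsRegularTyped

variable {T : H.TripleType} {i : Fin 3}

/-- Transitivity supplies an element whose i-th component agrees with σ at one point; freeness makes
them agree everywhere. -/
theorem exists_typeGroup (hH : H.IsRegularTyped) {σ : Equiv.Perm (T.1 i).1}
    (hσ : σ ∈ H.colorAut (T.1 i)) :
    ∃ g ∈ H.typeGroup T, g i = σ := by
  obtain ⟨x⟩ := H.colorClass_nonempty (T.1 i)
  obtain ⟨g, hg, e⟩ := hH.typeGroup T i x (σ x)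
  refine ⟨g, hg, ?_⟩
  have := hH.free _ (σ⁻¹ * g i) (mul_mem (inv_mem hσ) (hg.1 i)) x (by
    rw [Equiv.Perm.mul_apply, e, perm_inv_apply])
  exact (inv_mul_eq_one.1 this).symm

/-- Conjugate by an element of the local group with i-th component σ: the other components remain
trivial. -/
theorem conj_mem_typeKernel (hH : H.IsRegularTyped) {σ : Equiv.Perm (T.1 i).1}
    (hσ : σ ∈ H.colorAut (T.1 i))
    {n : Equiv.Perm (T.1 i).1} (hn : n ∈ H.typeKernel T i) : σ * n * σ⁻¹ ∈ H.typeKernel T i := by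
  obtain ⟨g, hg, rfl⟩ := hH.exists_typeGroup hσ
  have h := mul_mem (mul_mem hg hn) (inv_mem hg)
  have e : g * MonoidHom.mulSingle (fun i => Equiv.Perm (T.1 i).1) i n * g⁻¹ =
      MonoidHom.mulSingle (fun i => Equiv.Perm (T.1 i).1) i (g i * n * (g i)⁻¹) := by
    funext j
    by_cases hj : j = i
    · subst hj
      simp
    · simp [Pi.mulSingle_eq_of_ne hj]
  rw [e] at h
  exact h

theorem toQuotient_congr (hH : H.IsRegularTyped) {σ : Equiv.Perm (T.1 i).1}
    (hσ : σ ∈ H.colorAut (T.1 i))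
    {v w : (T.1 i).1} (h : H.toQuotient T i v = H.toQuotient T i w) :
    H.toQuotient T i (σ v) = H.toQuotient T i (σ w) := by
  obtain ⟨n, hn, rfl⟩ := toQuotient_eq_iff.1 h
  refine toQuotient_eq_iff.2 ⟨_, hH.conj_mem_typeKernel hσ hn, ?_⟩
  rw [Equiv.Perm.mul_apply, Equiv.Perm.mul_apply, perm_inv_apply]

/-- Normality of the kernel makes σ permute its orbits. -/
theorem exists_quotientAction (hH : H.IsRegularTyped) {σ : Equiv.Perm (T.1 i).1}
    (hσ : σ ∈ H.colorAut (T.1 i)) :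
    ∃ τ ∈ H.quotientAction T i, ∀ v, τ (H.toQuotient T i v) = H.toQuotient T i (σ v) := by
  let f (σ : Equiv.Perm (T.1 i).1) (hσ : σ ∈ H.colorAut (T.1 i)) :
      H.QuotientClass T i → H.QuotientClass T i :=
    Quotient.lift (fun v => H.toQuotient T i (σ v)) fun v w h =>
      hH.toQuotient_congr hσ (Quotient.sound h)
  let τ : Equiv.Perm (H.QuotientClass T i) := ⟨f σ hσ, f σ⁻¹ (inv_mem hσ), fun q => by
    obtain ⟨v, rfl⟩ := toQuotient_surjective T i q
    exact congrArg _ (perm_inv_apply σ v), fun q => by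
    obtain ⟨v, rfl⟩ := toQuotient_surjective T i q
    exact congrArg _ (perm_apply_inv σ v)⟩
  exact ⟨τ, ⟨σ, hσ, fun _ => rfl⟩, fun _ => rfl⟩

theorem isSection_quotientAction (T : H.TripleType) (i : Fin 3) :
    IsSection (H.quotientAction T i) (H.colorAut (T.1 i)) := by
  refine IsSection.of_rel (fun τ σ => ∀ v, τ.1 (H.toQuotient T i v) = H.toQuotient T i (σ.1 v))
    (fun _ => rfl) (fun τ σ τ' σ' h h' v => ?_) (fun τ σ h v => ?_) (fun τ => ?_) (fun τ h => ?_)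
  · rw [Subgroup.coe_mul, Equiv.Perm.mul_apply, h', h]
    rfl
  · have e := h (σ.1⁻¹ v)
    rw [perm_apply_inv] at e
    rw [← e]
    exact perm_inv_apply _ _
  · obtain ⟨σ, hσ, h⟩ := τ.2
    exact ⟨⟨σ, hσ⟩, h⟩
  · refine Subtype.ext (Equiv.ext fun q => ?_)
    obtain ⟨v, rfl⟩ := toQuotient_surjective T i q
    exact h v

/-- If σ fixes the orbit of v, it agrees at v with a kernel element, hence equals it by freeness,
and so fixes all orbits. -/
theorem isFreeGroup_quotientAction (hH : H.IsRegularTyped) (T : H.TripleType) (i : Fin 3) :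
    IsFreeGroup (H.quotientAction T i) := by
  rintro τ ⟨σ, hσ, h⟩ q hq
  obtain ⟨v, rfl⟩ := toQuotient_surjective T i q
  rw [h, eq_comm, toQuotient_eq_iff] at hq
  obtain ⟨n, hn, e⟩ := hq
  have := hH.free _ (σ⁻¹ * n) (mul_mem (inv_mem hσ) (mem_colorAut_of_mem_typeKernel hn)) v (by
    rw [Equiv.Perm.mul_apply, e, perm_inv_apply])
  obtain rfl := inv_mul_eq_one.1 this
  refine Equiv.ext fun q => ?_
  obtain ⟨w, rfl⟩ := toQuotient_surjective T i q
  rw [h]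
  exact (toQuotient_eq_iff.2 ⟨σ, hn, rfl⟩).symm

theorem isTransitiveGroup_quotientAction (hH : H.IsRegularTyped) (T : H.TripleType) (i : Fin 3) :
    IsTransitiveGroup (H.quotientAction T i) := by
  intro q q'
  obtain ⟨v, rfl⟩ := toQuotient_surjective T i q
  obtain ⟨w, rfl⟩ := toQuotient_surjective T i q'
  obtain ⟨σ, hσ, rfl⟩ := hH.transitive _ v w
  obtain ⟨τ, hτ, h⟩ := hH.exists_quotientAction hσ
  exact ⟨τ, hτ, h v⟩

end IsRegularTyped

/-! ### The quotient structure -/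

section Quotient

variable {P : TotalPreorder (V ⊕ H.QuotientVertex)}

/-- An extension color class. -/
def extClass (hP : H.IsQuotientOrder P) (C : H.ColorClass) : (H.quotient P).ColorClass :=
  ⟨Sum.inl '' C.1, by
    obtain ⟨_, v, rfl⟩ := C
    refine ⟨.inl v, Set.ext fun x => ⟨?_, fun hx => ?_⟩⟩
    · rintro ⟨w, hw, rfl⟩
      exact (hP.1 _ _).2 hw
    · rcases x with x | x
      · exact ⟨x, (hP.1 _ _).1 hx, rfl⟩
      · exact absurd hx (hP.2.2 _ _)⟩

/-- A group color class. -/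
def groupClass (hP : H.IsQuotientOrder P) (T : H.TripleType) (i : Fin 3) :
    (H.quotient P).ColorClass :=
  ⟨Set.range fun q : H.QuotientClass T i => Sum.inr ⟨(T, i), q⟩, by
    obtain ⟨q⟩ := (inferInstance : Nonempty (H.QuotientClass T i))
    refine ⟨.inr ⟨(T, i), q⟩, Set.ext fun x => ⟨?_, fun hx => ?_⟩⟩
    · rintro ⟨q', rfl⟩
      exact (hP.2.1 _ _).2 rfl
    · rcases x with x | ⟨y, q'⟩
      · exact absurd (TotalPreorder.Eqv.symm hx) (hP.2.2 _ _)
      · obtain rfl : (T, i) = y := (hP.2.1 _ _).1 hx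
        exact ⟨q', rfl⟩⟩

theorem eq_extClass_or_groupClass (hP : H.IsQuotientOrder P) (D : (H.quotient P).ColorClass) :
    (∃ C, D = extClass hP C) ∨ ∃ T i, D = groupClass hP T i := by
  obtain ⟨x, hx⟩ := (H.quotient P).colorClass_nonempty D
  rw [(H.quotient P).eq_vcls_of_mem hx]
  rcases x with v | ⟨⟨T, i⟩, q⟩
  · have hv : Sum.inl v ∈ (extClass hP (H.vcls v)).1 := ⟨v, H.mem_vcls v, rfl⟩
    exact .inl ⟨H.vcls v, ((H.quotient P).eq_vcls_of_mem hv).symm⟩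
  · have hq : Sum.inr ⟨(T, i), q⟩ ∈ (groupClass hP T i).1 := ⟨q, rfl⟩
    exact .inr ⟨T, i, ((H.quotient P).eq_vcls_of_mem hq).symm⟩

/-- The vertices of an extension color class. -/
noncomputable def extClassEquiv (hP : H.IsQuotientOrder P) (C : H.ColorClass) :
    C.1 ≃ (extClass hP C).1 := Equiv.Set.image _ _ Sum.inl_injective

/-- The vertices of a group color class. -/
noncomputable def groupClassEquiv (hP : H.IsQuotientOrder P) (T : H.TripleType) (i : Fin 3) :
    H.QuotientClass T i ≃ (groupClass hP T i).1 := Equiv.ofInjective _ fun q q' h => by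
  simpa using h

theorem extClassEquiv_apply (hP : H.IsQuotientOrder P) {C : H.ColorClass} (v : C.1) :
    (extClassEquiv hP C v : V ⊕ H.QuotientVertex) = Sum.inl (v : V) := rfl

theorem groupClassEquiv_apply (hP : H.IsQuotientOrder P) {T : H.TripleType} {i : Fin 3}
    (q : H.QuotientClass T i) :
    (groupClassEquiv hP T i q : V ⊕ H.QuotientVertex) = Sum.inr ⟨(T, i), q⟩ := rfl

theorem mem_colorAut_extClass [Finite V] (hP : H.IsQuotientOrder P) (C : H.ColorClass)
    (σ : Equiv.Perm C.1) :
    (extClassEquiv hP C).permCongr σ ∈ (H.quotient P).colorAut (extClass hP C) ↔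
      σ ∈ H.colorAut C := by
  constructor
  · intro h
    refine mem_colorAut_of fun R t ht => ?_
    obtain ⟨t', ht', -, e⟩ := (mem_colorAut.1 h (.inside C R)
      fun k => extClassEquiv hP C (t k)).2 ⟨_, ht, fun k => (t k).2, rfl⟩
    have : (fun k => (σ (t k) : V)) = t' := funext fun k => by
      have := congrFun e k
      rw [Equiv.permCongr_apply, Equiv.symm_apply_apply] at this
      exact Sum.inl_injective this
    rw [this]
    exact ht'
  · intro h
    refine mem_colorAut_of fun R t ht => ?_
    obtain ⟨z, rfl⟩ : ∃ z : Fin _ → C.1, t = fun k => extClassEquiv hP C (z k) :=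
      ⟨fun k => (extClassEquiv hP C).symm (t k), by simp⟩
    simp only [Equiv.permCongr_apply, Equiv.symm_apply_apply, extClassEquiv_apply] at ht ⊢
    cases R with
    | inside C' R =>
      obtain ⟨t, ht, hC, e⟩ := ht
      obtain rfl : (fun k => (z k : V)) = t := funext fun k => Sum.inl_injective (congrFun e k)
      exact ⟨_, (mem_colorAut.1 h R z).2 ht,
        fun k => H.mem_of_eqv (hC k) (H.eqv_of_mem (z k).2 (σ (z k)).2), rfl⟩
    | orbit y o =>
      obtain ⟨s, hs, e⟩ := ht
      exact absurd (congrFun e ⟨0, o.pos⟩) Sum.inl_ne_inr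
    | orbitMap y =>
      obtain ⟨v, e⟩ := ht
      exact absurd (congrFun e (1 : Fin 2)) Sum.inl_ne_inr
    | moved T R =>
      obtain ⟨e', v, hR, e⟩ := ht
      exact absurd (congrFun e (0 : Fin 3)) Sum.inl_ne_inr

/-- Only the orbit relations have tuples inside one group class: orbit maps involve an extension
vertex, and moved triples have entries in three different classes. -/
theorem mem_colorAut_groupClass [Finite V] (hP : H.IsQuotientOrder P) (T : H.TripleType) (i : Fin 3)
    (τ : Equiv.Perm (H.QuotientClass T i)) :
    (groupClassEquiv hP T i).permCongr τ ∈ (H.quotient P).colorAut (groupClass hP T i) ↔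
      τ ∈ H.quotientAction T i := by
  constructor
  · intro h
    refine mem_of_forall_orbitSym fun o t ht => ?_
    obtain ⟨s, hs, e⟩ := (mem_colorAut.1 h (.orbit (T, i) o)
      fun k => groupClassEquiv hP T i (t k)).2 ⟨_, ht, rfl⟩
    have : (fun k => τ (t k)) = s := funext fun k => by
      have := congrFun e k
      rw [Equiv.permCongr_apply, Equiv.symm_apply_apply] at this
      exact eq_of_heq (Sigma.mk.inj (Sum.inr_injective this)).2
    rwa [this]
  · intro h
    refine mem_colorAut_of fun R t ht => ?_
    obtain ⟨z, rfl⟩ : ∃ z : Fin _ → H.QuotientClass T i, t = fun k => groupClassEquiv hP T i (z k) :=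
      ⟨fun k => (groupClassEquiv hP T i).symm (t k), by simp⟩
    simp only [Equiv.permCongr_apply, Equiv.symm_apply_apply, groupClassEquiv_apply] at ht ⊢
    cases R with
    | inside C' R =>
      obtain ⟨t, ht, hC, e⟩ := ht
      exact absurd (congrFun e ⟨0, H.arity_pos R⟩) Sum.inr_ne_inl
    | orbit y o =>
      obtain ⟨s, hs, e⟩ := ht
      obtain rfl : (T, i) = y :=
        congrArg Sigma.fst (Sum.inr_injective (congrFun e ⟨0, o.pos⟩))
      obtain rfl : z = s := funext fun k =>
        eq_of_heq (Sigma.mk.inj (Sum.inr_injective (congrFun e k))).2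
      exact ⟨_, o.mem_orb h hs, rfl⟩
    | orbitMap y =>
      obtain ⟨v, e⟩ := ht
      exact absurd (congrFun e (0 : Fin 2)) Sum.inr_ne_inl
    | moved T' R =>
      obtain ⟨e', v, hR, e⟩ := ht
      have h0 : (T, i) = (T', 0) :=
        congrArg Sigma.fst (Sum.inr_injective (congrFun e (0 : Fin 3)))
      have h1 : (T, i) = (T', 1) :=
        congrArg Sigma.fst (Sum.inr_injective (congrFun e (1 : Fin 3)))
      exact absurd (congrArg Prod.snd (h0.symm.trans h1)) (by decide : ¬ (0 : Fin 3) = 1)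

theorem permIso_extClass [Finite V] (hP : H.IsQuotientOrder P) (C : H.ColorClass) :
    PermIso (H.colorAut C) ((H.quotient P).colorAut (extClass hP C)) :=
  ⟨_, mem_colorAut_extClass hP C⟩

theorem permIso_groupClass [Finite V] (hP : H.IsQuotientOrder P) (T : H.TripleType) (i : Fin 3) :
    PermIso (H.quotientAction T i) ((H.quotient P).colorAut (groupClass hP T i)) :=
  ⟨_, mem_colorAut_groupClass hP T i⟩

theorem homogeneous_quotient_inside (hP : H.IsQuotientOrder P) (C : H.ColorClass) (R : H.Sym) :
    (H.quotient P).Homogeneous (.inside C R) := by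
  rintro _ ⟨t, ht, hC, rfl⟩ _ ⟨t', ht', hC', rfl⟩ k k'
  exact (hP.1 _ _).2 (H.eqv_of_mem (hC _) (hC' _))

theorem homogeneous_quotient_orbit (hP : H.IsQuotientOrder P) (x : H.TripleType × Fin 3)
    (o : OrbitSym (H.quotientAction x.1 x.2)) : (H.quotient P).Homogeneous (.orbit x o) := by
  rintro _ ⟨s, hs, rfl⟩ _ ⟨s', hs', rfl⟩ k k'
  exact (hP.2.1 _ _).2 rfl

theorem groupClass_inj (hP : H.IsQuotientOrder P) {T T' : H.TripleType} {i i' : Fin 3}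
    (h : groupClass hP T i = groupClass hP T' i') : T = T' ∧ i = i' := by
  obtain ⟨q⟩ := (inferInstance : Nonempty (H.QuotientClass T i))
  have : Sum.inr ⟨(T, i), q⟩ ∈ (groupClass hP T' i').1 := h ▸ ⟨q, rfl⟩
  obtain ⟨q', hq'⟩ := this
  have := congrArg Sigma.fst (Sum.inr_injective hq')
  exact ⟨(congrArg Prod.fst this).symm, (congrArg Prod.snd this).symm⟩

theorem typedRelations_quotient (hP : H.IsQuotientOrder P) : (H.quotient P).TypedRelations := by
  rintro (⟨C, R⟩ | ⟨x, o⟩ | ⟨x⟩ | ⟨T, R⟩)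
  · exact .inl (homogeneous_quotient_inside hP C R)
  · exact .inl (homogeneous_quotient_orbit hP x o)
  · right
    let T : Fin 2 → (H.quotient P).ColorClass := ![extClass hP (x.1.1 x.2), groupClass hP x.1 x.2]
    have hne : extClass hP (x.1.1 x.2) ≠ groupClass hP x.1 x.2 := fun h => by
      obtain ⟨v⟩ := H.colorClass_nonempty (x.1.1 x.2)
      have : Sum.inl (v : V) ∈ (groupClass hP x.1 x.2).1 := h ▸ ⟨v, v.2, rfl⟩
      obtain ⟨q, hq⟩ := this
      exact Sum.inr_ne_inl hq
    refine ⟨T, fun k k' h => ?_, ?_⟩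
    · change Fin 2 at k k'
      fin_cases k <;> fin_cases k' <;> first | rfl | exact absurd h hne | exact absurd h.symm hne
    · rintro _ ⟨v, rfl⟩ k
      change Fin 2 at k
      fin_cases k
      · exact ⟨v, v.2, rfl⟩
      · exact ⟨_, rfl⟩
  · refine .inr ⟨fun i => groupClass hP T i, fun i j h => (groupClass_inj hP h).2, ?_⟩
    rintro _ ⟨e, v, hR, rfl⟩ i
    exact ⟨_, rfl⟩

/-- Inside relations and orbit maps contain extension vertices, and orbit relations are homogeneous.
Only moved triples remain, and they belong to the three group classes of one type. -/
theorem IsGroupType.eq_groupClass (hP : H.IsQuotientOrder P) {n : ℕ}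
    {T : Fin n → (H.quotient P).ColorClass}
    (h : (H.quotient P).IsGroupType (Set.range Sum.inr) T) :
    ∃ T' : H.TripleType, (⟨n, T⟩ : Σ n : ℕ, Fin n → (H.quotient P).ColorClass) =
      ⟨3, groupClass hP T'⟩ := by
  obtain ⟨⟨h2, hinj, R, t, ht, rfl, hT⟩, hG⟩ := h
  have hinl {k v} (hk : t k = Sum.inl v) : False := by
    obtain ⟨q, hq⟩ := hG _ (hT k)
    exact Sum.inr_ne_inl (hq.trans hk)
  cases R with
  | inside C R =>
    obtain ⟨t', ht', hC, rfl⟩ := ht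
    exact (hinl (k := ⟨0, H.arity_pos R⟩) rfl).elim
  | orbit x o =>
    -- A type has at least two positions, and homogeneity would put both into the same class.
    have := homogeneous_quotient_orbit hP x o t ht t ht ⟨0, by omega⟩ ⟨1, by omega⟩
    rw [← vcls_eq_iff, ← (H.quotient P).eq_vcls_of_mem (hT _),
      ← (H.quotient P).eq_vcls_of_mem (hT _)] at this
    exact absurd (hinj this) (by simp)
  | orbitMap x =>
    obtain ⟨v, rfl⟩ := ht
    exact (hinl (k := (0 : Fin 2)) rfl).elim
  | moved T' R =>
    obtain ⟨e, v, hR, rfl⟩ := ht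
    refine ⟨T', ?_⟩
    have : T = groupClass hP T' := funext fun i => by
      exact ((H.quotient P).eq_vcls_of_mem (hT i)).trans
        ((H.quotient P).eq_vcls_of_mem (C := groupClass hP T' i) ⟨_, rfl⟩).symm
    subst this
    rfl

end Quotient

/-! ### Local automorphisms of group types -/

section Local

variable {P : TotalPreorder (V ⊕ H.QuotientVertex)}

/-- A vertex of a group type. -/
def groupVertex (hP : H.IsQuotientOrder P) (T : H.TripleType) (i : Fin 3)
    (q : H.QuotientClass T i) : (H.quotient P).support (groupClass hP T) :=
  ⟨Sum.inr ⟨(T, i), q⟩, i, q, rfl⟩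

theorem groupVertex_inj (hP : H.IsQuotientOrder P) {T : H.TripleType} {i : Fin 3}
    {q q' : H.QuotientClass T i} (h : groupVertex hP T i q = groupVertex hP T i q') : q = q' :=
  eq_of_heq (Sigma.mk.inj (Sum.inr_injective (congrArg Subtype.val h))).2

theorem exists_groupVertex (hP : H.IsQuotientOrder P) {T : H.TripleType}
    (x : (H.quotient P).support (groupClass hP T)) : ∃ i q, x = groupVertex hP T i q := by
  obtain ⟨x, i, q, rfl⟩ := x
  exact ⟨i, q, rfl⟩

theorem localAut_ext (hP : H.IsQuotientOrder P) {T : H.TripleType}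
    {σ τ : Equiv.Perm ((H.quotient P).support (groupClass hP T))}
    (h : ∀ i q, σ (groupVertex hP T i q) = τ (groupVertex hP T i q)) : σ = τ := by
  refine Equiv.ext fun x => ?_
  obtain ⟨i, q, rfl⟩ := exists_groupVertex hP x
  exact h i q

/-- Local automorphisms preserve each group class, so restriction is a homomorphism. -/
theorem exists_localHom [Finite V] (hP : H.IsQuotientOrder P) (T : H.TripleType) (i : Fin 3) :
    ∃ π : (H.quotient P).localAut (groupClass hP T) →* H.quotientAction T i,
      ∀ τ q, τ.1 (groupVertex hP T i q) = groupVertex hP T i ((π τ).1 q) := by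
  have h (τ : (H.quotient P).localAut (groupClass hP T)) : ∃ ρ : H.quotientAction T i,
      ∀ q, τ.1 (groupVertex hP T i q) = groupVertex hP T i (ρ.1 q) := by
    obtain ⟨σ, hσ, e⟩ := exists_isLoc τ.2
    obtain ⟨ρ, hρ, e'⟩ := (hσ.mono (S' := (groupClass hP T i).1)
      fun x hx => ⟨i, hx⟩).exists_induce (closed_colorClass _)
    obtain ⟨ρ, rfl⟩ := (groupClassEquiv hP T i).permCongr.surjective ρ
    refine ⟨⟨ρ, (mem_colorAut_groupClass hP T i ρ).1 hρ⟩, fun q => Subtype.ext ?_⟩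
    rw [← e]
    refine (e' (groupClassEquiv hP T i q)).symm.trans ?_
    rw [Equiv.permCongr_apply, Equiv.symm_apply_apply]
    rfl
  choose π hπ using h
  refine ⟨MonoidHom.mk' π fun σ τ => Subtype.ext (Equiv.ext fun q => groupVertex_inj hP ?_), hπ⟩
  rw [← hπ, Subgroup.coe_mul, Equiv.Perm.mul_apply, hπ, hπ]
  rfl

/-- Applying each component to representatives carries a moved tuple to a moved tuple. With
`IsRegularTyped.exists_typeGroup` this gives the surjective projections of the local group. -/
theorem exists_localAut [Finite V] (hP : H.IsQuotientOrder P) (hH : H.IsRegularTyped)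
    {T : H.TripleType} {g : (i : Fin 3) → Equiv.Perm (T.1 i).1} (hg : g ∈ H.typeGroup T) :
    ∃ τ ∈ (H.quotient P).localAut (groupClass hP T), ∀ i v,
      τ (groupVertex hP T i (H.toQuotient T i v)) =
        groupVertex hP T i (H.toQuotient T i (g i v)) := by
  choose ρ hρ e using fun i => hH.exists_quotientAction (hg.1 i)
  let φ : (Σ i, H.QuotientClass T i) ≃ (H.quotient P).support (groupClass hP T) :=
    Equiv.ofBijective (fun x => groupVertex hP T x.1 x.2) ⟨fun ⟨i, q⟩ ⟨i', q'⟩ h => by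
      have h := Sum.inr_injective (congrArg Subtype.val h)
      obtain rfl : i = i' := congrArg Prod.snd (congrArg Sigma.fst h)
      exact congrArg (Sigma.mk i) (eq_of_heq (Sigma.mk.inj h).2), fun x => by
      obtain ⟨i, q, rfl⟩ := exists_groupVertex hP x
      exact ⟨⟨i, q⟩, rfl⟩⟩
  let τ := φ.permCongr (Equiv.sigmaCongrRight ρ)
  have hτ (i q) : τ (groupVertex hP T i q) = groupVertex hP T i (ρ i q) := by
    change φ.permCongr (Equiv.sigmaCongrRight ρ) (φ ⟨i, q⟩) = φ ⟨i, ρ i q⟩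
    rw [Equiv.permCongr_apply, Equiv.symm_apply_apply]
    rfl
  have hcls (x) : P.Eqv x.1 (τ x).1 := by
    obtain ⟨i, q, rfl⟩ := exists_groupVertex hP x
    rw [hτ]
    exact (hP.2.1 _ _).2 rfl
  refine ⟨τ, ⟨fun R t => ?_, fun v w => P.le_iff_of_eqv (hcls v) (hcls w)⟩,
    fun i v => by rw [hτ, e]⟩
  refine perm_tuple_mem_iff (σ := τ) (A := {t : Fin ((H.quotient P).arity R) →
    (H.quotient P).support (groupClass hP T) | (fun k => (t k : V ⊕ H.QuotientVertex)) ∈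
      (H.quotient P).rel R}) (fun t ht => ?_) t
  change (fun k => (τ (t k) : V ⊕ H.QuotientVertex)) ∈ (H.quotient P).rel R
  change (fun k => (t k : V ⊕ H.QuotientVertex)) ∈ (H.quotient P).rel R at ht
  have hinl {k v} (hk : (t k : V ⊕ H.QuotientVertex) = Sum.inl v) : False := by
    obtain ⟨i, q, h⟩ := exists_groupVertex hP (t k)
    rw [h] at hk
    exact Sum.inr_ne_inl hk
  cases R with
  | inside C R =>
    obtain ⟨t', ht', hC, h⟩ := ht
    exact (hinl (congrFun h ⟨0, H.arity_pos R⟩)).elim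
  | orbit y o =>
    obtain ⟨s, hs, h⟩ := ht
    obtain ⟨i, hy⟩ : ∃ i, (T, i) = y := by
      obtain ⟨i, q, h'⟩ := exists_groupVertex hP (t ⟨0, o.pos⟩)
      have h0 := congrFun h ⟨0, o.pos⟩
      simp only [h'] at h0
      exact ⟨i, congrArg Sigma.fst (Sum.inr_injective h0)⟩
    subst hy
    obtain rfl : t = fun k => groupVertex hP T i (s k) :=
      funext fun k => Subtype.ext (congrFun h k)
    refine ⟨_, o.mem_orb (hρ i) hs, funext fun k => ?_⟩
    exact congrArg Subtype.val (hτ i (s k))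
  | orbitMap y =>
    obtain ⟨v, h⟩ := ht
    exact (hinl (congrFun h (0 : Fin 2))).elim
  | moved T' R =>
    obtain ⟨e', v, hR, h⟩ := ht
    obtain rfl : T = T' := by
      obtain ⟨i, q, h'⟩ := exists_groupVertex hP (t (0 : Fin 3))
      have h0 := congrFun h (0 : Fin 3)
      simp only [h'] at h0
      exact congrArg Prod.fst (congrArg Sigma.fst (Sum.inr_injective h0))
    obtain rfl : t = fun k => groupVertex hP T k (H.toQuotient T k (v k)) :=
      funext fun k => Subtype.ext (congrFun h k)
    refine ⟨e', fun i => g i (v i), (hg.2 R e' v).2 hR, funext fun k => ?_⟩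
    exact congrArg Subtype.val ((hτ k _).trans (congrArg _ (e k (v k))))

/-- The image of a moved tuple is again a moved tuple, but its representatives are known only up to
kernel orbits. That they stand in the same order of positions is `TripleType.equiv_unique`. -/
theorem localAut_rel (hP : H.IsQuotientOrder P) (hH : H.TypedRelations) {T : H.TripleType}
    {τ : Equiv.Perm ((H.quotient P).support (groupClass hP T))}
    (hτ : τ ∈ (H.quotient P).localAut (groupClass hP T)) {R : H.Sym}
    {e : Fin (H.arity R) ≃ Fin 3} {v : (i : Fin 3) → (T.1 i).1}
    (h : H.RelUpToOrder R e (fun i => (v i : V))) :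
    ∃ v' : (i : Fin 3) → (T.1 i).1, H.RelUpToOrder R e (fun i => (v' i : V)) ∧
      ∀ i, τ (groupVertex hP T i (H.toQuotient T i (v i))) =
        groupVertex hP T i (H.toQuotient T i (v' i)) := by
  obtain ⟨e', v', h', e2⟩ := (hτ.1 (.moved T R)
    fun i => groupVertex hP T i (H.toQuotient T i (v i))).2 ⟨e, v, h, rfl⟩
  obtain rfl := T.equiv_unique hH (fun i => (v i).2) (fun i => (v' i).2) h h'
  exact ⟨v', h', fun i => Subtype.ext (congrFun e2 i)⟩

/-- Let σ induce τ on the i-th class. The image tuple given by `localAut_rel` differs from the tuple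
with σ applied at position i only by kernel elements, and these preserve the relations. So σ alone
at position i is a local automorphism, that is, σ lies in the i-th kernel and acts trivially on its
orbits. -/
theorem localAut_eq_one [Finite V] (hP : H.IsQuotientOrder P) (hH : H.IsRegularTyped)
    {T : H.TripleType} {τ : Equiv.Perm ((H.quotient P).support (groupClass hP T))}
    (hτ : τ ∈ (H.quotient P).localAut (groupClass hP T)) (i : Fin 3)
    (h : ∀ j, j ≠ i → ∀ q, τ (groupVertex hP T j q) = groupVertex hP T j q) : τ = 1 := by
  obtain ⟨π, hπ⟩ := exists_localHom hP T i
  obtain ⟨σ, hσ, hπσ⟩ := (π ⟨τ, hτ⟩).2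
  have key (v : (T.1 i).1) : τ (groupVertex hP T i (H.toQuotient T i v)) =
      groupVertex hP T i (H.toQuotient T i (σ v)) := by
    rw [← hπσ]
    exact hπ ⟨τ, hτ⟩ _
  have hmem : σ ∈ H.typeKernel T i := by
    change Pi.mulSingle i σ ∈ H.typeGroup T
    refine mem_typeGroup_of (fun j => ?_) fun R e v hR => ?_
    · by_cases hj : j = i
      · subst hj
        rwa [Pi.mulSingle_eq_same]
      · rw [Pi.mulSingle_eq_of_ne hj]
        exact one_mem _
    · obtain ⟨v', hR', hv'⟩ := localAut_rel hP hH.typed hτ hR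
      -- Correction factors that carry the representatives of the image tuple to the desired
      -- entries.
      have hn (j : Fin 3) : ∃ n ∈ H.typeKernel T j,
          n (v' j) = (Pi.mulSingle i σ : (i : Fin 3) → Equiv.Perm (T.1 i).1) j (v j) := by
        rw [← toQuotient_eq_iff]
        apply groupVertex_inj hP
        rw [← hv']
        by_cases hj : j = i
        · subst hj
          rw [Pi.mulSingle_eq_same, key]
        · rw [Pi.mulSingle_eq_of_ne hj, h j hj]
          rfl
      choose n hn e' using hn
      -- The local group contains each kernel, hence also the product of elements of the three
      -- kernels.
      have hn : n ∈ H.typeGroup T := Subgroup.pi_mem_of_mulSingle_mem _ hn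
      simp only [← e']
      exact (hn.2 R e v').2 hR'
  refine localAut_ext hP fun j q => ?_
  by_cases hj : j = i
  · subst hj
    obtain ⟨v, rfl⟩ := toQuotient_surjective T j q
    rw [key]
    exact congrArg _ (toQuotient_eq_iff.2 ⟨σ, hmem, rfl⟩).symm
  · exact h j hj q

/-- The projection to each class is a 2-group inside a section of a color group, hence commutative;
a local automorphism is determined by its three projections. -/
theorem localAut_comm [Finite V] (hP : H.IsQuotientOrder P) {T : H.TripleType}
    (hT : ∀ i, CommOrNotFour (H.colorAut (T.1 i)))
    (hp : IsPGroup 2 ((H.quotient P).localAut (groupClass hP T)))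
    (a b : (H.quotient P).localAut (groupClass hP T)) : a * b = b * a := by
  refine Subtype.ext (localAut_ext hP fun i q => ?_)
  obtain ⟨π, hπ⟩ := exists_localHom hP T i
  have hc : CommOrNotFour π.range :=
    ((IsRegularTyped.isSection_quotientAction T i).commOrNotFour (hT i)).of_injective
      π.range.subtype Subtype.val_injective
  have := hc.comm_of_isPGroup (hp.of_surjective π.rangeRestrict π.rangeRestrict_surjective)
    (π.rangeRestrict a) (π.rangeRestrict b)
  rw [← map_mul, ← map_mul] at this
  have : π (a * b) = π (b * a) := congrArg Subtype.val this
  rw [hπ, hπ, this]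

/-- The bijection transfers triviality from class j to class k, and 2-injectivity then removes the
third class. Hence the projection to class j is injective into a section of one cyclic or dihedral
color group. -/
theorem localAut_isCyclicOrDihedral [Finite V] (hP : H.IsQuotientOrder P) (hH : H.IsRegularTyped)
    {T : H.TripleType} (hT : H.IsLinked T) :
    IsCyclicOrDihedral ((H.quotient P).localAut (groupClass hP T)) := by
  obtain ⟨R, e, j, k, hjk, r, hr, hr', hR⟩ := hT
  obtain ⟨π, hπ⟩ := exists_localHom hP T j
  refine ((IsRegularTyped.isSection_quotientAction T j).isCyclicOrDihedral
    (hH.dihedral _)).of_injective π ?_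
  rw [injective_iff_map_eq_one]
  intro τ hτ
  obtain ⟨c⟩ : Nonempty ((i : Fin 3) → (T.1 i).1) :=
    ⟨fun i => Classical.choice (H.colorClass_nonempty (T.1 i))⟩
  have hfull (a : (T.1 j).1) (b : (T.1 k).1) : ∃ v : (i : Fin 3) → (T.1 i).1, v j = a ∧ v k = b := by
    classical
    exact ⟨Function.update (Function.update c j a) k b, by simp [hjk], by simp⟩
  -- A kernel element moves one of the linked classes and fixes the other, so the bijection forces
  -- it to fix every point; the quotients of the linked classes lose nothing.
  have hkj (a b n) (hn : n ∈ H.typeKernel T j) (hab : r a b) : n a = a := by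
    obtain ⟨v, rfl, rfl⟩ := hfull a b
    have := (hn.2 R e v).2 ((hR v).2 hab)
    rw [hR] at this
    simp only [MonoidHom.mulSingle_apply, Pi.mulSingle_eq_same, Pi.mulSingle_eq_of_ne hjk.symm] at this
    exact (hr' _).unique this hab
  have hkk (a b n) (hn : n ∈ H.typeKernel T k) (hab : r a b) : n b = b := by
    obtain ⟨v, rfl, rfl⟩ := hfull a b
    have := (hn.2 R e v).2 ((hR v).2 hab)
    rw [hR] at this
    simp only [MonoidHom.mulSingle_apply, Pi.mulSingle_eq_same, Pi.mulSingle_eq_of_ne hjk] at this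
    exact (hr _).unique this hab
  have hj (q) : τ.1 (groupVertex hP T j q) = groupVertex hP T j q := by
    rw [hπ, hτ]
    rfl
  -- Take a tuple through linked points a and b. Since τ fixes the orbit of a and that orbit is a
  -- single point, the image tuple contains a again, hence also its partner b.
  have hk (q) : τ.1 (groupVertex hP T k q) = groupVertex hP T k q := by
    obtain ⟨b, rfl⟩ := toQuotient_surjective T k q
    obtain ⟨a, hab, -⟩ := hr' b
    obtain ⟨v, rfl, rfl⟩ := hfull a b
    obtain ⟨v', hv', h⟩ := localAut_rel hP hH.typed τ.2 ((hR v).2 hab)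
    rw [hR] at hv'
    have h1 := h j
    rw [hj] at h1
    obtain ⟨n, hn, e1⟩ := toQuotient_eq_iff.1 (groupVertex_inj hP h1)
    rw [hkj _ _ n hn hab] at e1
    rw [← e1] at hv'
    rw [h k, (hr _).unique hv' hab]
  have hthird : ∀ j k : Fin 3, j ≠ k → ∃ i, ∀ j', j' ≠ i → j' = j ∨ j' = k := by decide
  obtain ⟨i, hi⟩ := hthird j k hjk
  refine Subtype.ext (localAut_eq_one hP hH τ.2 i fun j' hj' q => ?_)
  rcases hi j' hj' with rfl | rfl
  · exact hj q
  · exact hk q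

end Local

/-! ### The quotient structure is a double-CFI-free 2-injective quotient structure -/

section Final

variable {P : TotalPreorder (V ⊕ H.QuotientVertex)}

/-- The witness N consists of the automorphisms of the extension class that act trivially on the
group class. The kernel of the type lies in it and already identifies the points of each fiber. -/
theorem exists_isQuotientVia [Finite V] (hP : H.IsQuotientOrder P) (hH : H.IsRegularTyped)
    (T : H.TripleType) (i : Fin 3) :
    ∃ (N : Subgroup ((H.quotient P).colorAut (extClass hP (T.1 i)))) (_ : N.Normal),
      (H.quotient P).IsQuotientVia (extClass hP (T.1 i)) (groupClass hP T i) N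
        (.orbitMap (T, i)) := by
  let φ := extClassEquiv hP (T.1 i)
  let ψ := groupClassEquiv hP T i
  let f : (extClass hP (T.1 i)).1 → (groupClass hP T i).1 := fun x =>
    ψ (H.toQuotient T i (φ.symm x))
  have hfφ (v) : f (φ v) = ψ (H.toQuotient T i v) := by simp [f]
  have hf : Function.Surjective f :=
    ψ.surjective.comp ((toQuotient_surjective T i).comp φ.symm.surjective)
  have lift (σ τ) (h : ∀ v, τ (H.toQuotient T i v) = H.toQuotient T i (σ v)) (x) :
      ψ.permCongr τ (f x) = f (φ.permCongr σ x) := by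
    obtain ⟨v, rfl⟩ := φ.surjective x
    rw [Equiv.permCongr_apply, Equiv.permCongr_apply, Equiv.symm_apply_apply, h]
    exact (hfφ _).symm
  obtain ⟨N, hN, hiso, hmem⟩ := exists_normal_of_factor
    (G := (H.quotient P).colorAut (extClass hP (T.1 i)))
    (G' := (H.quotient P).colorAut (groupClass hP T i)) hf (fun σ hσ => by
      obtain ⟨σ, rfl⟩ := φ.permCongr.surjective σ
      obtain ⟨τ, hτ, h⟩ := hH.exists_quotientAction ((mem_colorAut_extClass hP _ σ).1 hσ)
      exact ⟨_, (mem_colorAut_groupClass hP T i τ).2 hτ, lift σ τ h⟩) (fun τ hτ => by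
      obtain ⟨τ, rfl⟩ := ψ.permCongr.surjective τ
      obtain ⟨σ, hσ, h⟩ := (mem_colorAut_groupClass hP T i τ).1 hτ
      exact ⟨_, (mem_colorAut_extClass hP _ σ).2 hσ, lift σ τ h⟩)
  refine ⟨N, hN, hiso, rfl, f, hf, fun x y => ⟨fun h => ?_, ?_⟩, fun t => ⟨?_, ?_⟩⟩
  · obtain ⟨v, rfl⟩ := φ.surjective x
    obtain ⟨w, rfl⟩ := φ.surjective y
    rw [hfφ, hfφ] at h
    obtain ⟨n, hn, rfl⟩ := toQuotient_eq_iff.1 (ψ.injective h)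
    refine ⟨⟨φ.permCongr n, (mem_colorAut_extClass hP _ n).2 (mem_colorAut_of_mem_typeKernel hn)⟩,
      (hmem _).2 fun x => ?_, ?_⟩
    · obtain ⟨w, rfl⟩ := φ.surjective x
      rw [Equiv.permCongr_apply, Equiv.symm_apply_apply, hfφ, hfφ]
      exact congrArg ψ (toQuotient_eq_iff.2 ⟨n, hn, rfl⟩).symm
    · rw [Equiv.permCongr_apply, Equiv.symm_apply_apply]
  · rintro ⟨g, hg, rfl⟩
    exact ((hmem g).1 hg x).symm
  · rintro ⟨v, rfl⟩
    refine ⟨φ v, fun k => ?_⟩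
    rw [hfφ]
    change Fin 2 at k
    fin_cases k <;> rfl
  · rintro ⟨x, hx⟩
    obtain ⟨v, rfl⟩ := φ.surjective x
    rw [hfφ] at hx
    refine ⟨v, funext fun k => (hx k).trans ?_⟩
    change Fin 2 at k
    fin_cases k <;> rfl

theorem isTwoInjectiveQuotient_quotient [Finite V] (hP : H.IsQuotientOrder P)
    (hH : H.IsRegularTyped) : (H.quotient P).IsTwoInjectiveQuotient (Set.range Sum.inr) where
  union v w h := by
    rcases v with v | v <;> rcases w with w | w
    · simp
    · exact absurd h (hP.2.2 _ _)
    · exact absurd (TotalPreorder.Eqv.symm h) (hP.2.2 _ _)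
    · simp
  arity R hR := by
    cases R with
    | inside C R => exact absurd (homogeneous_quotient_inside hP C R) hR
    | orbit x o => exact absurd (homogeneous_quotient_orbit hP x o) hR
    | orbitMap x => exact (by decide : 2 ≤ 3)
    | moved T R => exact le_refl 3
  typed := typedRelations_quotient hP
  regular C := by
    have := (H.quotient P).colorClass_nonempty C
    rcases eq_extClass_or_groupClass hP C with ⟨C, rfl⟩ | ⟨T, i, rfl⟩
    · exact isRegularGroup_of_free_of_transitive ((permIso_extClass hP C).free (hH.free C))
        ((permIso_extClass hP C).transitive (hH.transitive C))
    · exact isRegularGroup_of_free_of_transitive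
        ((permIso_groupClass hP T i).free (hH.isFreeGroup_quotientAction T i))
        ((permIso_groupClass hP T i).transitive (hH.isTransitiveGroup_quotientAction T i))
  quotient D hD := by
    rcases eq_extClass_or_groupClass hP D with ⟨C, rfl⟩ | ⟨T, i, rfl⟩
    · obtain ⟨v⟩ := H.colorClass_nonempty C
      obtain ⟨y, hy⟩ := hD ⟨v, v.2, rfl⟩
      exact absurd hy Sum.inr_ne_inl
    obtain ⟨N, hN, h⟩ := exists_isQuotientVia hP hH T i
    refine ⟨extClass hP (T.1 i), ?_, N, hN, _, h, ?_⟩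
    · ext x
      simp only [Set.mem_inter_iff, Set.mem_empty_iff_false, iff_false]
      rintro ⟨⟨v, hv, rfl⟩, ⟨y, hy⟩⟩
      exact Sum.inr_ne_inl hy
    · rintro R' t ht ⟨k, q, hk⟩ ⟨k', hk'⟩
      cases R' with
      | inside C R =>
        obtain ⟨t, ht, hC, rfl⟩ := ht
        exact absurd hk Sum.inr_ne_inl
      | orbit x o =>
        obtain ⟨s, hs, rfl⟩ := ht
        exact absurd ⟨_, rfl⟩ hk'
      | orbitMap x =>
        obtain ⟨v, rfl⟩ := ht
        change Fin 2 at k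
        fin_cases k
        · exact absurd hk Sum.inr_ne_inl
        · obtain rfl : (T, i) = x := congrArg Sigma.fst (Sum.inr_injective hk)
          rfl
      | moved T R =>
        obtain ⟨e, v, hR, rfl⟩ := ht
        exact absurd ⟨_, rfl⟩ hk'
  group_arity R hR hG := by
    cases R with
    | inside C R => exact absurd (homogeneous_quotient_inside hP C R) hR
    | orbit x o => exact absurd (homogeneous_quotient_orbit hP x o) hR
    | orbitMap x =>
      obtain ⟨v⟩ := H.colorClass_nonempty (x.1.1 x.2)
      obtain ⟨y, hy⟩ := hG _ ⟨v, rfl⟩ (0 : Fin 2)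
      exact absurd hy Sum.inr_ne_inl
    | moved T R => rfl
  -- Group classes are indexed by pairs (T, i), so distinct types never share one.
  group_type m n T T' hT hT' := by
    rintro ⟨i, j, hij⟩
    obtain ⟨S, hS⟩ := hT.eq_groupClass hP
    obtain ⟨S', hS'⟩ := hT'.eq_groupClass hP
    obtain ⟨rfl, hS⟩ := Sigma.mk.inj hS
    obtain ⟨rfl, hS'⟩ := Sigma.mk.inj hS'
    obtain rfl := eq_of_heq hS
    obtain rfl := eq_of_heq hS'
    obtain ⟨rfl, -⟩ := groupClass_inj hP hij
    rfl
  two_injective T hT := by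
    obtain ⟨S, hS⟩ := hT.eq_groupClass hP
    obtain rfl := eq_of_heq (Sigma.mk.inj hS).2
    refine ⟨fun i ρ hρ => ?_, fun i τ hτ h => ?_⟩
    · obtain ⟨ρ, rfl⟩ := (groupClassEquiv hP S i).permCongr.surjective ρ
      obtain ⟨σ, hσ, hρσ⟩ := (mem_colorAut_groupClass hP S i ρ).1 hρ
      obtain ⟨g, hg, rfl⟩ := hH.exists_typeGroup hσ
      obtain ⟨τ, hτ, e⟩ := exists_localAut hP hH hg
      refine ⟨τ, hτ, fun x => ?_⟩
      obtain ⟨q, rfl⟩ := (groupClassEquiv hP S i).surjective x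
      obtain ⟨v, rfl⟩ := toQuotient_surjective S i q
      rw [Equiv.permCongr_apply, Equiv.symm_apply_apply, hρσ]
      exact congrArg Subtype.val (e i v)
    · exact localAut_eq_one hP hH hτ i fun j hj q => h j hj _ ⟨q, rfl⟩

/-- An isomorphism would carry the law x^4 = 1 to the local group. For good color groups this
2-group is commutative, against `hX`; for a linked type it has at most eight elements, against `hc`.
-/
theorem isEmpty_localAut_mulEquiv [Finite V] (hP : H.IsQuotientOrder P) (hH : H.IsRegularTyped)
    (hT : ∀ T : H.TripleType, (∀ i, CommOrNotFour (H.colorAut (T.1 i))) ∨ H.IsLinked T)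
    {X : Type} [Group X] (h4 : ∀ x : X, x ^ 4 = 1) (hc : 8 < Nat.card X)
    (hX : ∃ x y : X, x * y ≠ y * x) {n : ℕ} {T : Fin n → (H.quotient P).ColorClass}
    (h : (H.quotient P).IsGroupType (Set.range Sum.inr) T) :
    IsEmpty ((H.quotient P).localAut T ≃* X) := by
  obtain ⟨S, hS⟩ := h.eq_groupClass hP
  obtain ⟨rfl, hS⟩ := Sigma.mk.inj hS
  obtain rfl := eq_of_heq hS
  refine ⟨fun f => ?_⟩
  have h4' (a : (H.quotient P).localAut (groupClass hP S)) : a ^ 4 = 1 :=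
    f.injective (by rw [map_pow, h4, map_one])
  rcases hT S with hS | hS
  · obtain ⟨x, y, hxy⟩ := hX
    have := localAut_comm hP hS (fun a => ⟨2, h4' a⟩) (f.symm x) (f.symm y)
    rw [← map_mul, ← map_mul] at this
    exact hxy (f.symm.injective this)
  · have := (localAut_isCyclicOrDihedral hP hH hS).card_le_eight h4'
    rw [Nat.card_congr f.toEquiv] at this
    omega

theorem isDoubleCFIFree_quotient [Finite V] (hP : H.IsQuotientOrder P) (hH : H.IsRegularTyped)
    (hT : ∀ T : H.TripleType, (∀ i, CommOrNotFour (H.colorAut (T.1 i))) ∨ H.IsLinked T) :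
    (H.quotient P).IsDoubleCFIFree (Set.range Sum.inr) where
  twoInjective := isTwoInjectiveQuotient_quotient hP hH
  dihedral C := by
    rcases eq_extClass_or_groupClass hP C with ⟨C, rfl⟩ | ⟨T, i, rfl⟩
    · exact (permIso_extClass hP C).isCyclicOrDihedral (hH.dihedral C)
    · exact (permIso_groupClass hP T i).isCyclicOrDihedral
        ((IsRegularTyped.isSection_quotientAction T i).isCyclicOrDihedral (hH.dihedral _))
  not_doubleCFI _ _ h := isEmpty_localAut_mulEquiv hP hH hT doubleCFI_pow_four card_doubleCFI
    doubleCFI_not_comm h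
  not_doubleCFICyclic _ _ h := isEmpty_localAut_mulEquiv hP hH hT doubleCFICyclic_pow_four
    card_doubleCFICyclic doubleCFICyclic_not_comm h

end Final

/-! ### The normal-form reduction -/

theorem TransitiveRefinement.isCyclicOrDihedral [Finite V] {H' : RelStr V}
    (h : H.TransitiveRefinement H') (hH : ∀ v, IsCyclicOrDihedral (H.colorAut (H.vcls v))) :
    ∀ v, IsCyclicOrDihedral (H'.colorAut (H'.vcls v)) :=
  h.induction (fun K => ∀ v, IsCyclicOrDihedral (K.colorAut (K.vcls v)))
    (fun _ _ hP hK v => (isSection_refine hP v).isCyclicOrDihedral (hK v)) hH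

theorem TransitiveRefinement.ternaryGood [Finite V] {H' : RelStr V}
    (h : H.TransitiveRefinement H') (hH : H.TernaryGood) : H'.TernaryGood :=
  h.induction TernaryGood (fun _ _ hP hK => ternaryGood_refine hP hK) hH

theorem TransitiveRefinement.isFreeGroup [Finite V] {H' : RelStr V}
    (h : H.TransitiveRefinement H') (hH : ∀ v, IsFreeGroup (H.colorAut (H.vcls v))) :
    ∀ v, IsFreeGroup (H'.colorAut (H'.vcls v)) :=
  h.induction (fun K => ∀ v, IsFreeGroup (K.colorAut (K.vcls v)))
    (fun _ _ hP hK v => isFreeGroup_refine hP v (hK v)) hH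

/-- A non-abelian color group has order 2k with k odd. -/
theorem ternaryGood_of_isOddDihedral (hH : H.IsOddDihedral) : H.TernaryGood := by
  intro R _ t _ k
  by_cases h : ∀ a b : H.colorAut (H.vcls (t k)), a * b = b * a
  · exact .inl h
  · obtain ⟨n, hn, ⟨e⟩⟩ := hH.2 _ h
    exact CommOrNotFour.of_odd_dihedral hn e

theorem ternaryGood_of_isGraph (hH : H.IsGraph) : H.TernaryGood := by
  intro R h3
  obtain ⟨E, hE, h2⟩ := hH
  rw [hE R, h2] at h3
  exact absurd h3 (by decide)

theorem isRegularTyped_ternary [Finite V] (hH : H.TransitiveOn 3)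
    (hf : ∀ v, IsFreeGroup (H.colorAut (H.vcls v)))
    (hd : ∀ v, IsCyclicOrDihedral (H.colorAut (H.vcls v))) {P : TotalPreorder (V × Fin 3)}
    (hP : H.IsTypedOrder P) {P' : TotalPreorder (H.typed P).WithCopies}
    (hP' : (H.typed P).IsTernaryOrder P') : ((H.typed P).ternary P').IsRegularTyped where
  free := forall_colorAut_ternary hP' IsFreeGroup PermIso.free fun C => by
    obtain ⟨_, x, rfl⟩ := C
    exact (permIso_typed hP x.1 x.2).free (hf x.1)
  transitive := forall_colorAut_ternary hP' IsTransitiveGroup PermIso.transitive fun C => by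
    obtain ⟨_, x, rfl⟩ := C
    exact (permIso_typed hP x.1 x.2).transitive (hH.colorAut x.1)
  dihedral := forall_colorAut_ternary hP' (fun G => IsCyclicOrDihedral G)
    PermIso.isCyclicOrDihedral fun C => by
    obtain ⟨_, x, rfl⟩ := C
    exact (permIso_typed hP x.1 x.2).isCyclicOrDihedral (hd x.1)
  typed := typedRelations_ternary hP' (typedRelations_typed hP)
  typeGroup := typeGroup_transitive hH hP hP'

/-! ### Existence of an output, and the double-CFI-freeness of every output -/

variable (H) in
theorem exists_isTypedOrder : ∃ P, H.IsTypedOrder P := by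
  obtain ⟨P, hP⟩ := TotalPreorder.exists_of_function fun x : V × Fin 3 => (H.vcls x.1, x.2)
  exact ⟨P, fun x y => by rw [hP, Prod.mk_inj, H.vcls_eq_iff]⟩

variable (H) in
theorem exists_isRegularOrder (b : H.BaseChoice) : ∃ P, H.IsRegularOrder b P :=
  TotalPreorder.exists_of_function fun x : Σ C, H.BaseOrbit b C => x.1

theorem exists_sumOrder {X Y Z : Type u} (Q : TotalPreorder X) (f : Y → Z) :
    ∃ P : TotalPreorder (X ⊕ Y), (∀ v w, P.Eqv (Sum.inl v) (Sum.inl w) ↔ Q.Eqv v w) ∧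
      (∀ x y, P.Eqv (Sum.inr x) (Sum.inr y) ↔ f x = f y) ∧
      ∀ v y, ¬ P.Eqv (Sum.inl v) (Sum.inr y) := by
  obtain ⟨P, hP⟩ := TotalPreorder.exists_of_function
    (Sum.map (fun v => {w | Q.Eqv v w}) f : X ⊕ Y → Set X ⊕ Z)
  refine ⟨P, fun v w => ?_, fun x y => ?_, fun v y => ?_⟩
  · rw [hP, Sum.map_inl, Sum.map_inl, Sum.inl.injEq]
    refine ⟨fun h => ?_, fun h => Set.ext fun x => ⟨fun h' => h.symm.trans h', fun h' => h.trans h'⟩⟩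
    have : w ∈ {x | Q.Eqv v x} := h ▸ Q.eqv_refl w
    exact this
  · rw [hP, Sum.map_inr, Sum.map_inr, Sum.inr.injEq]
  · rw [hP, Sum.map_inl, Sum.map_inr]
    exact Sum.inl_ne_inr

variable (H) in
theorem exists_isNormalFormOf [Finite V] :
    ∃ (W : Type u) (H' : RelStr W) (G : Set W), H.IsNormalFormOf H' G := by
  obtain ⟨H₁, h₁⟩ := H.exists_transitiveRefinement
  obtain ⟨P₂, h₂⟩ := H₁.exists_isTypedOrder
  obtain ⟨b⟩ := (H₁.typed P₂).nonempty_baseChoice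
  obtain ⟨P₃, h₃⟩ := (H₁.typed P₂).exists_isRegularOrder b
  obtain ⟨H₄, h₄⟩ := ((H₁.typed P₂).regular b P₃).exists_transitiveRefinement
  obtain ⟨P₅, h₅⟩ := H₄.exists_isTypedOrder
  obtain ⟨P₆, h₆⟩ := exists_sumOrder (H₄.typed P₅).ord
    fun y : Σ p : (H₄.typed P₅).PairType, p.1.2.1 => y.1
  obtain ⟨P₇, h₇⟩ := exists_sumOrder ((H₄.typed P₅).ternary P₆).ord
    fun y : ((H₄.typed P₅).ternary P₆).QuotientVertex => y.1
  exact ⟨_, _, _, .mk H₁ h₁ P₂ h₂ b P₃ h₃ H₄ h₄ P₅ h₅ P₆ h₆ P₇ h₇⟩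

theorem IsNormalFormOf.isDoubleCFIFree [Finite V] (hd : H.HasDihedralColors) (h3 : H.TernaryGood)
    {W : Type u} {H' : RelStr W} {G : Set W} (h : H.IsNormalFormOf H' G) :
    H'.IsDoubleCFIFree G := by
  obtain ⟨H₁, h₁, P₂, h₂, b, P₃, h₃, H₄, h₄, P₅, h₅, P₆, h₆, P₇, h₇⟩ := h
  have d₁ := h₁.isCyclicOrDihedral fun v => hd (H.vcls v)
  have d₃ (x) : IsCyclicOrDihedral (((H₁.typed P₂).regular b P₃).colorAut
      (((H₁.typed P₂).regular b P₃).vcls x)) := by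
    obtain ⟨⟨_, v, rfl⟩, t⟩ := x
    exact (permIso_regular h₃ _ t).isCyclicOrDihedral
      ((isSection_orbitAction _).isCyclicOrDihedral
        ((permIso_typed h₂ v.1 v.2).isCyclicOrDihedral (d₁ v.1)))
  -- Freeness comes from the choice of bases alone; nothing about the groups of the input is needed.
  have f₃ (x) : IsFreeGroup (((H₁.typed P₂).regular b P₃).colorAut
      (((H₁.typed P₂).regular b P₃).vcls x)) :=
    (permIso_regular h₃ x.1 x.2).free (isFreeGroup_orbitAction _)
  have t₃ := ternaryGood_regular h₃ (ternaryGood_typed h₂ (h₁.ternaryGood h3))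
  exact isDoubleCFIFree_quotient h₇
    (isRegularTyped_ternary h₄.2 (h₄.isFreeGroup f₃) (h₄.isCyclicOrDihedral d₃) h₅ h₆)
    (commOrNotFour_or_isLinked h₆ (ternaryGood_typed h₅ (h₄.ternaryGood t₃)))

end RelStr

end NormalForm

theorem mainTheorem7 {V : Type u} [Finite V] (H : NormalForm.RelStr V) [Finite H.Sym] (q : ℕ)
    (hq : H.IsBounded q) (hArity : H.ArityAtMost 3) (hDihedral : H.HasDihedralColors)
    (hCase : H.IsOddDihedral ∨ H.IsGraph) :
    (∃ (W : Type u) (H' : NormalForm.RelStr W) (G : Set W), H.IsNormalFormOf H' G) ∧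
    ∀ (W : Type u) (H' : NormalForm.RelStr W) (G : Set W), H.IsNormalFormOf H' G →
      H'.IsDoubleCFIFree G :=
  ⟨H.exists_isNormalFormOf, fun _ _ _ h => h.isDoubleCFIFree hDihedral
    (hCase.elim NormalForm.RelStr.ternaryGood_of_isOddDihedral
      NormalForm.RelStr.ternaryGood_of_isGraph)⟩
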